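/- **Setting.** Let $n\ge 1$ and let $(D,\omega_D)$ be a compact connected Kähler manifold of complex dimension $n-1$ (for instance a toric Kähler–Einstein Fano manifold). Let $\widehat M=\mathbb C\times D$, let $z$ be the coordinate on $\mathbb C$, and for $\lambda>0$ put $r:=|z|^{\lambda}$ and $\widehat\omega:=\frac i2\partial\bar\partial|z|^{2\lambda}+\omega_D$. Let $M$ be a toric manifold of complex dimension $n$: a complex manifold with an effective holomorphic action of $(\mathbb C^*)^n$ whose fixed point set is compact and which has an open dense orbit. Let $J$ be its complex structure, $T=T^n\subset(\mathbb C^*)^n$ the real torus, and $\mathfrak t$ its Lie algebra, identified with the vector fields on $M$ generated by the action of $T$. (For instance, $M=\overline M\setminus\pi^{-1}(\{\infty\}\times D)$ for a toric Fano manifold $\overline M$ obtained by a torus-equivariant, possibly iterated, blowup $\pi:\overline M\to\mathbb P^1\times D$ along smooth torus-invariant subvarieties contained in $\{0\}\times D$, where $D$ is a toric Kähler–Einstein Fano manifold.) Let $\omega$ be the Kähler form of a complete $T$-invariant Kähler metric on $M$, let $X$ be a vector field on $M$ with $JX\in\mathfrak t$, and let $\nu:M\setminus K\to\widehat M\setminus\widehat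 K$, with $K\subset M$ and $\widehat K\subset\widehat M$ compact, be a biholomorphism such that $$d\nu(X)=\tfrac{2}{\lambda}\operatorname{Re}(z\partial_z)\qquad\text{and}\qquad \omega=\nu^*\widehat\omega\quad\text{on } M\setminus K .$$ Write $\omega\lrcorner Y=\omega(Y,\cdot)$ and $\Delta_\omega f=\operatorname{tr}_\omega(i\partial\bar\partial f)$. **Lemma.** There exists a unique smooth $T$-invariant function $f:M\to\mathbb R$ such that $-\omega\lrcorner JX=df$ on $M$ and $f=\nu^*\left(\frac{r^2}{2}-1\right)$ outside a compact subset of $M$. It satisfies $$\Delta_\omega f+f-\tfrac X2\cdot f=0$$ outside a compact subset of $M$. If $M\setminus K$ is connected, then both $f=\nu^*\left(\frac{r^2}{2}-1\right)$ and this equation hold on all of $M\setminus K$. Moreover $f\to+\infty$ as $r\circ\nu\to+\infty$ on $M\setminus K$, $f(p)\to+\infty$ as $p$ leaves every compact subset of $M$, and $f$ is proper. -/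

import Mathlib

open scoped Manifold ContDiff Topology

noncomputable section

namespace KahlerToric

/-! Conventions. A complex manifold is a Hausdorff second countable space `M` charted on a finite
dimensional complex normed space `E` with complex analytic transition maps, i.e.
`IsManifold 𝓘(ℂ, E) ω M`. Its underlying real manifold uses the same charts with the model
`𝓘(ℝ, E)`. In Mathlib `TangentSpace 𝓘(ℝ, E) p` is by definition the vector space `E`, a vector
being written in the preferred chart at `p`; as the charts are holomorphic, the complex structure
`J` of `M` is multiplication by `i` on each tangent space. -/

section Forms

variable (E : Type*) [NormedAddCommGroup E] [NormedSpace ℂ E]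

/-- The complex structure on a tangent space. -/
def J : E →L[ℝ] E := Complex.I • ContinuousLinearMap.id ℝ E

variable (M : Type*) [TopologicalSpace M] [ChartedSpace E M]

/-- Real vector fields: `X p` lies in `TangentSpace 𝓘(ℝ, E) p = E`. -/
abbrev VField : Type _ := M → E

/-- Fields of real bilinear forms on the tangent spaces: `Ω p u v` for `u v` in
`TangentSpace 𝓘(ℝ, E) p = E`. -/
abbrev BilinField : Type _ := M → E →L[ℝ] E →L[ℝ] ℝ

variable {E M}

/-- The differential of a map between the underlying real manifolds. -/
def tangentMapAt {F N : Type*} [NormedAddCommGroup F] [NormedSpace ℂ F]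
    [TopologicalSpace N] [ChartedSpace F N] (φ : M → N) (p : M) : E →L[ℝ] F :=
  mfderiv 𝓘(ℝ, E) 𝓘(ℝ, F) φ p

/-- The differential of a real-valued function. -/
def diff (f : M → ℝ) (p : M) : E →L[ℝ] ℝ :=
  mfderiv 𝓘(ℝ, E) 𝓘(ℝ, ℝ) f p

/-- The coordinate expression of `Ω` in the preferred chart at `x`, i.e. its pullback under the
inverse of that chart; it is meaningful on the target of the chart. -/
def coordExpr (Ω : BilinField E M) (x : M) (y : E) : E →L[ℝ] E →L[ℝ] ℝ :=
  (Ω ((chartAt E x).symm y)).bilinearComp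
    (tangentMapAt (chartAt E x).symm y) (tangentMapAt (chartAt E x).symm y)

/-- `Ω` is the Kähler form of a Kähler metric: a smooth closed real `(1,1)`-form such that
`Ω (v, J v) > 0` for `v ≠ 0`. -/
structure IsKahler (Ω : BilinField E M) : Prop where
  alternating : ∀ p v, Ω p v v = 0
  smooth : ∀ x, ContDiffOn ℝ ∞ (coordExpr Ω x) (chartAt E x).target
  closed : ∀ x, ∀ y ∈ (chartAt E x).target, ∀ u v w : E,
    fderiv ℝ (coordExpr Ω x) y u v w + fderiv ℝ (coordExpr Ω x) y v w u
      + fderiv ℝ (coordExpr Ω x) y w u v = 0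
  invariant : ∀ p u v, Ω p (J E u) (J E v) = Ω p u v
  positive : ∀ p v, v ≠ 0 → 0 < Ω p v (J E v)

/-- The Riemannian metric `g (u, v) = Ω (u, J v)` of a Kähler form. -/
def metric (Ω : BilinField E M) : BilinField E M :=
  fun p => (Ω p).bilinearComp (ContinuousLinearMap.id ℝ E) (J E)

/-- The Riemannian distance of the metric of `Ω`: the infimum of the lengths of `C^1` paths. -/
def kahlerEDist (Ω : BilinField E M) : M → M → ENNReal :=
  letI : ∀ p : M, ENorm (TangentSpace 𝓘(ℝ, E) p) :=
    fun p => ⟨fun v : E => ENNReal.ofReal (Real.sqrt (metric Ω p v v))⟩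
  Manifold.riemannianEDist 𝓘(ℝ, E)

/-- The metric of `Ω` is complete: Cauchy sequences for its Riemannian distance converge. -/
def IsCompleteMetric (Ω : BilinField E M) : Prop :=
  ∀ a : ℕ → M, (∀ ε : ENNReal, 0 < ε → ∃ N, ∀ k ≥ N, ∀ l ≥ N, kahlerEDist Ω (a k) (a l) < ε) →
    ∃ x, Filter.Tendsto a Filter.atTop (𝓝 x)

/-- The real `(1,1)`-form `i ∂ ∂̄ φ` of a function on the complex vector space `E`. As
`i ∂ ∂̄ φ = (1/2) d (- dφ ∘ J)`, its value on `(u, v)` is `(1/2) (D²φ (v, J u) - D²φ (u, J v))`. -/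
def flatDdbar (φ : E → ℝ) (y : E) : E →L[ℝ] E →L[ℝ] ℝ :=
  (1 / 2 : ℝ) •
    (((fderiv ℝ (fderiv ℝ φ) y).bilinearComp (ContinuousLinearMap.id ℝ E) (J E)).flip
      - (fderiv ℝ (fderiv ℝ φ) y).bilinearComp (ContinuousLinearMap.id ℝ E) (J E))

/-- The real `(1,1)`-form `i ∂ ∂̄ f` of a function on `M`, computed at `p` in the preferred
(holomorphic) chart at `p`. -/
def ddbar (f : M → ℝ) : BilinField E M := fun p =>
  flatDdbar (f ∘ (chartAt E p).symm) (chartAt E p p)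

/-- The Kähler Laplacian `Δ_Ω f = tr_Ω (i ∂ ∂̄ f)`. In a unitary frame this is
`∑ⱼ (i ∂ ∂̄ f)(eⱼ, J eⱼ)`, which is half of the trace of the symmetric form
`(u, v) ↦ (i ∂ ∂̄ f)(u, J v)` with respect to the metric of `Ω`. -/
def laplacian (Ω : BilinField E M) (f : M → ℝ) (p : M) : ℝ :=
  (1 / 2 : ℝ) * LinearMap.trace ℝ E
    ((metric Ω p).inverse ∘L metric (ddbar f) p : E →L[ℝ] E).toLinearMap

end Forms

section Toric

/-- The exponential map `ℂⁿ → (ℂ*)ⁿ`. -/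
def torusExp {n : ℕ} (w : Fin n → ℂ) : Fin n → ℂˣ :=
  fun j => Units.mk0 (Complex.exp (w j)) (Complex.exp_ne_zero _)

/-- The inclusion of the real torus `Tⁿ = (S¹)ⁿ` in `(ℂ*)ⁿ`. -/
def realTorus {n : ℕ} (t : Fin n → Circle) : Fin n → ℂˣ :=
  fun j => Circle.toUnits (t j)

variable (n : ℕ) (E : Type*) [NormedAddCommGroup E] [NormedSpace ℂ E]
  (M : Type*) [TopologicalSpace M] [ChartedSpace E M] [MulAction (Fin n → ℂˣ) M]

/-- `M` is a toric manifold of complex dimension `n`: the torus `(ℂ*)ⁿ` acts holomorphically and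
effectively, with compact fixed point set and an open dense orbit. Since the exponential map
`ℂⁿ → (ℂ*)ⁿ` is a holomorphic covering, the action `(ℂ*)ⁿ × M → M` is holomorphic if and only if
its composition with that covering is. -/
structure IsToric : Prop where
  finrank_eq : Module.finrank ℂ E = n
  holomorphic : ContMDiff (𝓘(ℂ, Fin n → ℂ).prod 𝓘(ℂ, E)) 𝓘(ℂ, E) ω
    (fun q : (Fin n → ℂ) × M => torusExp q.1 • q.2)
  effective : ∀ t : Fin n → ℂˣ, (∀ p : M, t • p = p) → t = 1
  compact_fixedPoints : IsCompact (MulAction.fixedPoints (Fin n → ℂˣ) M)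
  dense_orbit : ∃ p : M, IsOpen (MulAction.orbit (Fin n → ℂˣ) p) ∧
    Dense (MulAction.orbit (Fin n → ℂˣ) p)

variable {n E M}

/-- The vector field on `M` generated by `b ∈ ℝⁿ`, the Lie algebra of the real torus: its value at
`p` is the velocity at `s = 0` of `s ↦ (e^{i s b₁}, …, e^{i s bₙ}) • p`. -/
def torusField (b : Fin n → ℝ) : VField E M := fun p =>
  (mfderiv 𝓘(ℝ, ℝ) 𝓘(ℝ, E)
    (fun s : ℝ => torusExp (fun j => ((s * b j : ℝ) : ℂ) * Complex.I) • p) 0 : ℝ →L[ℝ] E) 1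

/-- The vector field `V` lies in the Lie algebra of the real torus. -/
def InTorusLieAlgebra (n : ℕ) [MulAction (Fin n → ℂˣ) M] (V : VField E M) : Prop :=
  ∃ b : Fin n → ℝ, V = torusField b

/-- A function invariant under the real torus. -/
def TorusInvariant (n : ℕ) [MulAction (Fin n → ℂˣ) M] (f : M → ℝ) : Prop :=
  ∀ (t : Fin n → Circle) (p : M), f (realTorus t • p) = f p

/-- A bilinear form invariant under (pullback by) the real torus. -/
def TorusInvariantForm (n : ℕ) [MulAction (Fin n → ℂˣ) M] (Ω : BilinField E M) : Prop :=
  ∀ (t : Fin n → Circle) (p : M) (u v : E),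
    Ω (realTorus t • p) (tangentMapAt (fun q : M => realTorus t • q) p u)
      (tangentMapAt (fun q : M => realTorus t • q) p v) = Ω p u v

end Toric

section Model

/-- The form `(i/2) ∂ ∂̄ |z|^{2a}` on `ℂ`. -/
def coneForm (a : ℝ) (z : ℂ) : ℂ →L[ℝ] ℂ →L[ℝ] ℝ :=
  (1 / 2 : ℝ) • flatDdbar (fun w : ℂ => ‖w‖ ^ (2 * a)) z

variable {F : Type*} [NormedAddCommGroup F] [NormedSpace ℂ F]
  {D : Type*} [TopologicalSpace D] [ChartedSpace F D]

/-- The product form `(i/2) ∂ ∂̄ |z|^{2a} + Ω_D` on `ℂ × D`; the tangent space at `(z, x)` is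
`ℂ × F`. -/
def modelForm (a : ℝ) (ΩD : BilinField F D) (q : ℂ × D) : (ℂ × F) →L[ℝ] (ℂ × F) →L[ℝ] ℝ :=
  (coneForm a q.1).bilinearComp (ContinuousLinearMap.fst ℝ ℂ F) (ContinuousLinearMap.fst ℝ ℂ F)
    + (ΩD q.2).bilinearComp (ContinuousLinearMap.snd ℝ ℂ F) (ContinuousLinearMap.snd ℝ ℂ F)

/-- The function `r = |z|^a` on `ℂ × D`. -/
def radius (a : ℝ) (q : ℂ × D) : ℝ := ‖q.1‖ ^ a

/-- The vector field `(2/a) Re (z ∂_z) = r ∂_r` on `ℂ × D`. The complex vector field `z ∂_z` is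
`(1/2) (Y - i J Y)` with `Y = x ∂_x + y ∂_y` the radial field, whose value at `z` is the vector
`z`; so `2 Re (z ∂_z) = Y`. -/
def modelField (a : ℝ) (q : ℂ × D) : ℂ × F := ((1 / a : ℝ) • q.1, 0)

variable {E : Type*} [NormedAddCommGroup E] [NormedSpace ℂ E]
  {M : Type*} [TopologicalSpace M] [ChartedSpace E M]

/-- The real differential at `p` of a map from `M` to `ℂ × D`. -/
def prodTangentMapAt (φ : M → ℂ × D) (p : M) : E →L[ℝ] ℂ × F :=
  mfderiv 𝓘(ℝ, E) (𝓘(ℝ, ℂ).prod 𝓘(ℝ, F)) φ p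

/-- `ν : M \ K → (ℂ × D) \ K'` is a biholomorphism between complements of compact sets with
`dν(X) = (2/a) Re (z ∂_z)` and `Ω = ν^* ((i/2) ∂ ∂̄ |z|^{2a} + Ω_D)`. -/
structure IsModelAtInfinity (a : ℝ) (ΩD : BilinField F D) (Ω : BilinField E M) (X : VField E M)
    (K : Set M) (K' : Set (ℂ × D)) (ν : OpenPartialHomeomorph M (ℂ × D)) : Prop where
  compact : IsCompact K
  compact' : IsCompact K'
  source_eq : ν.source = Kᶜ
  target_eq : ν.target = K'ᶜ
  holomorphic : ContMDiffOn 𝓘(ℂ, E) (𝓘(ℂ, ℂ).prod 𝓘(ℂ, F)) ω ν Kᶜ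
  holomorphic_symm : ContMDiffOn (𝓘(ℂ, ℂ).prod 𝓘(ℂ, F)) 𝓘(ℂ, E) ω ν.symm K'ᶜ
  map_field : ∀ p ∉ K, prodTangentMapAt ν p (X p) = modelField (F := F) a (ν p)
  pullback : ∀ p ∉ K, ∀ u v : E,
    Ω p u v = modelForm a ΩD (ν p) (prodTangentMapAt ν p u) (prodTangentMapAt ν p v)

/-- `f` is a smooth torus-invariant Hamiltonian potential of `J X`, i.e. `- Ω ⌟ J X = df`, that is
equal to `ν^* (r^2 / 2 - 1)` outside a compact set. -/
structure IsNormalisedPotential (n : ℕ) [MulAction (Fin n → ℂˣ) M] (a : ℝ) (Ω : BilinField E M)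
    (X : VField E M) (ν : OpenPartialHomeomorph M (ℂ × D)) (f : M → ℝ) : Prop where
  smooth : ContMDiff 𝓘(ℝ, E) 𝓘(ℝ, ℝ) ∞ f
  invariant : TorusInvariant n f
  hamiltonian : ∀ p v, - Ω p (J E (X p)) v = diff f p v
  at_infinity : ∀ᶠ p in Filter.cocompact M, f p = radius a (ν p) ^ 2 / 2 - 1

end Model

end KahlerToric

end

/-! The flow of `J X` preserves `Ω`, so by Cartan's formula the one-form `-Ω (J X, ·)` is closed.
Nothing is assumed about the first cohomology of `M`, so exactness needs an argument. The dense
orbit is the image of `ℂⁿ` under the exponential map followed by the orbit map. On `ℂⁿ` the pulled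
back one-form has a primitive, and this descends to the orbit once it is constant in the imaginary
directions, i.e. once `Ω (J X, V) = 0` for every `V` in the Lie algebra of the torus. Such a pairing
is constant on the orbit (`IsToric.pull_imagVec_eq_zero`), so one point suffices. A point in the end
will do: there `-Ω (J X, ·) = d (r²/2)`, and `r² = Ω (X, J X)` is invariant under the torus
(`IsModelAtInfinity.torusField_orthogonal`).

To cross the complement of the dense orbit, observe that in a chart it is the zero set of a
holomorphic function, the determinant of the infinitesimal action. Such a set does not separate a
ball, so a local primitive differs from the orbit potential by a single constant
(`IsToric.orbit_potential_sub_eq`). The shifted local primitives glue to a smooth invariant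
potential (`IsToric.exists_potential`).

The part `|z| > R` of the end is connected because `D` is, so there the potential is `r²/2 - 1`
after subtracting a constant. On it `i ∂ ∂̄ f` is the cone part of `Ω`, of trace `1`, and `X f =
r²`; the equation becomes `1 + (r²/2 - 1) - r²/2 = 0`. Uniqueness follows because `M` is connected
and not compact.

Properness rests on `IsModelAtInfinity.eventually_cocompact`: leaving every compact subset of `M`
forces `|z|` to infinity. Otherwise the images under `ν` accumulate at some `q`. If `q ∉ K'`, the
points themselves accumulate at `ν⁻¹ q`. If `q ∈ K'`, short curves towards `K'` are lifted to `M`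
until they first meet `K'`; by completeness the lifts end in `K`. Hence the points approach the
compact set `K`, a subsequence is Cauchy, and completeness makes it converge. -/

noncomputable section

namespace KahlerToric

/-! ### Differentials of maps of real manifolds, read in charts -/

section RealDifferential

variable {E : Type*} [NormedAddCommGroup E] [NormedSpace ℝ E]
  {F : Type*} [NormedAddCommGroup F] [NormedSpace ℝ F]
  {G : Type*} [NormedAddCommGroup G] [NormedSpace ℝ G]
  {M : Type*} [TopologicalSpace M] [ChartedSpace E M]
  {N : Type*} [TopologicalSpace N] [ChartedSpace F N]
  {P : Type*} [TopologicalSpace P] [ChartedSpace G P]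

variable (E F) in
/-- The differential of a map between boundaryless real manifolds, with values in the space of
linear maps between the model spaces. -/
def rdiff (φ : M → N) (p : M) : E →L[ℝ] F := mfderiv 𝓘(ℝ, E) 𝓘(ℝ, F) φ p

theorem rdiff_comp {g : N → P} {f : M → N} (p : M)
    (hg : MDifferentiableAt 𝓘(ℝ, F) 𝓘(ℝ, G) g (f p))
    (hf : MDifferentiableAt 𝓘(ℝ, E) 𝓘(ℝ, F) f p) :
    rdiff E G (g ∘ f) p = (rdiff F G g (f p)).comp (rdiff E F f p) :=
  mfderiv_comp p hg hf

theorem rdiff_eq_fderiv (f : E → F) (x : E) : rdiff E F f x = fderiv ℝ f x :=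
  mfderiv_eq_fderiv

theorem rdiff_id (p : M) : rdiff E E (fun q : M => q) p = ContinuousLinearMap.id ℝ E :=
  mfderiv_id

theorem rdiff_const (c : N) (p : M) : rdiff E F (fun _ : M => c) p = 0 :=
  mfderiv_const

theorem rdiff_congr {f g : M → N} {p : M} (h : f =ᶠ[𝓝 p] g) : rdiff E F f p = rdiff E F g p := by
  have := h.eq_of_nhds
  unfold rdiff
  exact h.mfderiv_eq

variable [IsManifold 𝓘(ℝ, E) ∞ M]

theorem chartAt_mdiff (x : M) {p : M} (hp : p ∈ (chartAt E x).source) :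
    MDifferentiableAt 𝓘(ℝ, E) 𝓘(ℝ, E) (chartAt E x) p :=
  mdifferentiableAt_atlas (chart_mem_atlas E x) hp

theorem chartAt_symm_mdiff (x : M) {y : E} (hy : y ∈ (chartAt E x).target) :
    MDifferentiableAt 𝓘(ℝ, E) 𝓘(ℝ, E) (chartAt E x).symm y :=
  mdifferentiableAt_atlas_symm (chart_mem_atlas E x) hy

theorem rdiff_chartAt_symm_comp (x : M) {p : M} (hp : p ∈ (chartAt E x).source) :
    (rdiff E E (chartAt E x).symm (chartAt E x p)).comp (rdiff E E (chartAt E x) p)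
      = ContinuousLinearMap.id ℝ E := by
  rw [← rdiff_comp p (chartAt_symm_mdiff x ((chartAt E x).map_source hp)) (chartAt_mdiff x hp),
    ← rdiff_id p]
  apply rdiff_congr
  filter_upwards [(chartAt E x).open_source.mem_nhds hp] with q hq
  exact (chartAt E x).left_inv hq

/-- A map to a manifold factors through a chart. -/
theorem rdiff_eq_symm_comp_fderiv {φ : G → M} {w : G} (x : M)
    (hφ : MDifferentiableAt 𝓘(ℝ, G) 𝓘(ℝ, E) φ w) (hx : φ w ∈ (chartAt E x).source) :
    rdiff G E φ w = (rdiff E E (chartAt E x).symm (chartAt E x (φ w))).comp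
      (fderiv ℝ (chartAt E x ∘ φ) w) := by
  rw [← rdiff_eq_fderiv, rdiff_comp w (chartAt_mdiff x hx) hφ, ← ContinuousLinearMap.comp_assoc,
    rdiff_chartAt_symm_comp x hx, ContinuousLinearMap.id_comp]

theorem chartAt_comp_contDiffAt {φ : G → M} {w : G} (x : M)
    (hφ : ContMDiffAt 𝓘(ℝ, G) 𝓘(ℝ, E) ∞ φ w) (hx : φ w ∈ (chartAt E x).source) :
    ContDiffAt ℝ ∞ (chartAt E x ∘ φ) w := by
  rw [← contMDiffAt_iff_contDiffAt]
  exact ((contMDiffOn_chart (I := 𝓘(ℝ, E)) (n := ∞)).contMDiffAt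
    ((chartAt E x).open_source.mem_nhds hx)).comp w hφ

end RealDifferential

/-! ### Holomorphic maps as real maps -/

section RestrictScalars

variable {E : Type*} [NormedAddCommGroup E] [NormedSpace ℂ E]
  {F : Type*} [NormedAddCommGroup F] [NormedSpace ℂ F]
  {M : Type*} [TopologicalSpace M] [ChartedSpace E M]
  {N : Type*} [TopologicalSpace N] [ChartedSpace F N]

instance isManifold_real [IsManifold 𝓘(ℂ, E) ω M] : IsManifold 𝓘(ℝ, E) ω M := by
  apply isManifold_of_contDiffOn
  intro e e' he he'
  have h := (contDiffGroupoid ω 𝓘(ℂ, E)).compatible he he'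
  have h2 := (contDiffGroupoid ω 𝓘(ℂ, E)).mem_iff_of_eqOnSource (e := e.symm ≫ₕ e')
    (e' := e.symm ≫ₕ e') (Setoid.refl _) |>.1 h
  rw [contDiffGroupoid, mem_groupoid_of_pregroupoid] at h2
  exact ContDiffOn.restrict_scalars ℝ h2.1

theorem contMDiffAt_real {n : WithTop ℕ∞} {φ : M → N} {p : M}
    (h : ContMDiffAt 𝓘(ℂ, E) 𝓘(ℂ, F) n φ p) : ContMDiffAt 𝓘(ℝ, E) 𝓘(ℝ, F) n φ p := by
  rw [contMDiffAt_iff] at h ⊢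
  refine ⟨h.1, ?_⟩
  exact ContDiffWithinAt.restrict_scalars ℝ h.2

theorem mdifferentiableAt_real {φ : M → N} {p : M}
    (h : MDifferentiableAt 𝓘(ℂ, E) 𝓘(ℂ, F) φ p) : MDifferentiableAt 𝓘(ℝ, E) 𝓘(ℝ, F) φ p := by
  rw [mdifferentiableAt_iff] at h ⊢
  refine ⟨h.1, ?_⟩
  exact DifferentiableWithinAt.restrictScalars ℝ h.2

/-- The differential of a holomorphic map commutes with the complex structures. -/
theorem rdiff_J {φ : M → N} {p : M} (h : MDifferentiableAt 𝓘(ℂ, E) 𝓘(ℂ, F) φ p) (v : E) :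
    rdiff E F φ p (J E v) = J F (rdiff E F φ p v) := by
  have h' := mdifferentiableAt_real h
  have h1 := h.hasMFDerivAt
  set L : E →L[ℂ] F := mfderiv 𝓘(ℂ, E) 𝓘(ℂ, F) φ p
  have h2 : HasFDerivWithinAt (writtenInExtChartAt 𝓘(ℂ, E) 𝓘(ℂ, F) p φ)
    (L.restrictScalars ℝ) (Set.range 𝓘(ℂ, E))
      (extChartAt 𝓘(ℂ, E) p p) := HasFDerivWithinAt.restrictScalars ℝ h1.2
  have h3 : HasMFDerivAt 𝓘(ℝ, E) 𝓘(ℝ, F) φ p (L.restrictScalars ℝ) := ⟨h1.1, h2⟩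
  have h4 : rdiff E F φ p = L.restrictScalars ℝ := h3.mfderiv
  rw [h4]
  exact L.map_smul Complex.I v

end RestrictScalars

/-! ### Closed two-forms, pullbacks and Cartan's formula -/

section FlatForms

variable {E : Type*} [NormedAddCommGroup E] [NormedSpace ℝ E]
  {G : Type*} [NormedAddCommGroup G] [NormedSpace ℝ G]
  {Q : Type*} [NormedAddCommGroup Q] [NormedSpace ℝ Q]

theorem contDiffAt_flip {n : WithTop ℕ∞} {B : Q → E →L[ℝ] G →L[ℝ] ℝ} {w : Q}
    (hB : ContDiffAt ℝ n B w) : ContDiffAt ℝ n (fun w => (B w).flip) w := by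
  have hT : ContDiff ℝ n (fun f : E →L[ℝ] G →L[ℝ] ℝ => f.flip) :=
    IsBoundedLinearMap.contDiff ⟨⟨fun _ _ => rfl, fun _ _ => rfl⟩, 1, one_pos, fun f => by simp⟩
  exact hT.contDiffAt.comp w hB

theorem contDiffAt_bilinearComp {n : WithTop ℕ∞} {B : Q → E →L[ℝ] E →L[ℝ] ℝ} {L : Q → G →L[ℝ] E}
    {w : Q} (hB : ContDiffAt ℝ n B w) (hL : ContDiffAt ℝ n L w) :
    ContDiffAt ℝ n (fun w => (B w).bilinearComp (L w) (L w)) w := by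
  have h1 : ContDiffAt ℝ n (fun w => ((B w).comp (L w)).flip) w :=
    contDiffAt_flip (hB.clm_comp hL)
  exact contDiffAt_flip (h1.clm_comp hL)

theorem fderiv_apply₂ {B : Q → E →L[ℝ] G →L[ℝ] ℝ} {w : Q} (hB : DifferentiableAt ℝ B w)
    (u : Q) (v : E) (v' : G) : fderiv ℝ (fun w => B w v v') w u = fderiv ℝ B w u v v' := by
  have h1 := (hB.hasFDerivAt.clm_apply (hasFDerivAt_const v w))
  have h2 := (h1.clm_apply (hasFDerivAt_const v' w))
  rw [h2.fderiv]
  simp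

theorem fderiv_apply₁ {B : Q → E →L[ℝ] ℝ} {w : Q} (hB : DifferentiableAt ℝ B w)
    (u : Q) (v : E) : fderiv ℝ (fun w => B w v) w u = fderiv ℝ B w u v := by
  have h1 := (hB.hasFDerivAt.clm_apply (hasFDerivAt_const v w))
  rw [h1.fderiv]
  simp

/-- The pullback of a closed alternating form on a normed space is closed. -/
theorem closed_bilinearComp_fderiv {β : E → E →L[ℝ] E →L[ℝ] ℝ} {χ : G → E} {w : G}
    (hβ : ContDiffAt ℝ ∞ β (χ w)) (hχ : ContDiffAt ℝ ∞ χ w)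
    (halt : ∀ v v', β (χ w) v v' = - β (χ w) v' v)
    (hcl : ∀ u v v' : E, fderiv ℝ β (χ w) u v v' + fderiv ℝ β (χ w) v v' u
      + fderiv ℝ β (χ w) v' u v = 0) (u v v' : G) :
    let γ := fun w => (β (χ w)).bilinearComp (fderiv ℝ χ w) (fderiv ℝ χ w)
    fderiv ℝ γ w u v v' + fderiv ℝ γ w v v' u + fderiv ℝ γ w v' u v = 0 := by
  intro γ
  have hχ' : ContDiffAt ℝ ∞ (fderiv ℝ χ) w := hχ.fderiv_right (by simp)
  have hγ : DifferentiableAt ℝ γ w :=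
    (contDiffAt_bilinearComp (hβ.comp w hχ) hχ').differentiableAt (by simp)
  have dβ : HasFDerivAt (fun w => β (χ w)) ((fderiv ℝ β (χ w)).comp (fderiv ℝ χ w)) w :=
    ((hβ.differentiableAt (by simp)).hasFDerivAt).comp w
      (hχ.differentiableAt (by simp)).hasFDerivAt
  have dχ := (hχ'.differentiableAt (by simp)).hasFDerivAt
  have sym : ∀ a b, fderiv ℝ (fderiv ℝ χ) w a b = fderiv ℝ (fderiv ℝ χ) w b a := fun a b =>
    (hχ.isSymmSndFDerivAt (by simpa using ENat.LEInfty.out)).eq a b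
  have key : ∀ u v v', fderiv ℝ γ w u v v' =
      fderiv ℝ β (χ w) (fderiv ℝ χ w u) (fderiv ℝ χ w v) (fderiv ℝ χ w v')
      + β (χ w) (fderiv ℝ (fderiv ℝ χ) w u v) (fderiv ℝ χ w v')
      + β (χ w) (fderiv ℝ χ w v) (fderiv ℝ (fderiv ℝ χ) w u v') := by
    intro u v v'
    rw [← fderiv_apply₂ hγ]
    have h1 := dβ.clm_apply (dχ.clm_apply (hasFDerivAt_const v w))
    have h2 := h1.clm_apply (dχ.clm_apply (hasFDerivAt_const v' w))
    have : (fun w => γ w v v') = fun w => β (χ w) (fderiv ℝ χ w v) (fderiv ℝ χ w v') := rfl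
    rw [this, h2.fderiv]
    simp
    ring
  -- The terms containing second derivatives of `χ` cancel in pairs: the second derivative is
  -- symmetric and `β` is alternating.
  rw [key, key, key]
  have := hcl (fderiv ℝ χ w u) (fderiv ℝ χ w v) (fderiv ℝ χ w v')
  rw [sym u v, sym v v', sym v' u, halt (fderiv ℝ χ w v) , halt (fderiv ℝ χ w v'),
    halt (fderiv ℝ χ w u)]
  linarith

end FlatForms

section Pullback

variable {E : Type*} [NormedAddCommGroup E] [NormedSpace ℂ E]
  {M : Type*} [TopologicalSpace M] [ChartedSpace E M]
  {G : Type*} [NormedAddCommGroup G] [NormedSpace ℝ G]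

theorem IsKahler.antisymm {Ω : BilinField E M} (h : IsKahler Ω) (p : M) (u v : E) :
    Ω p u v = - Ω p v u := by
  have := h.alternating p (u + v)
  simp only [map_add, add_apply, h.alternating] at this
  linarith

/-- The pullback of a field of bilinear forms to a normed space. -/
def pull (Ω : BilinField E M) (φ : G → M) (w : G) : G →L[ℝ] G →L[ℝ] ℝ :=
  (Ω (φ w)).bilinearComp (rdiff G E φ w) (rdiff G E φ w)

theorem pull_apply (Ω : BilinField E M) (φ : G → M) (w u v : G) :
    pull Ω φ w u v = Ω (φ w) (rdiff G E φ w u) (rdiff G E φ w v) := rfl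

theorem IsKahler.coordExpr_contDiffAt {Ω : BilinField E M} (h : IsKahler Ω) (x : M) {y : E}
    (hy : y ∈ (chartAt E x).target) : ContDiffAt ℝ ∞ (coordExpr Ω x) y :=
  (h.smooth x).contDiffAt ((chartAt E x).open_target.mem_nhds hy)

theorem IsKahler.pull_antisymm {Ω : BilinField E M} (h : IsKahler Ω) (φ : G → M) (w u v : G) :
    pull Ω φ w u v = - pull Ω φ w v u := h.antisymm _ _ _

variable [IsManifold 𝓘(ℂ, E) ω M]

theorem pull_eq_coordExpr (Ω : BilinField E M) {φ : G → M} {w : G} (x : M)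
    (hφ : MDifferentiableAt 𝓘(ℝ, G) 𝓘(ℝ, E) φ w) (hx : φ w ∈ (chartAt E x).source) :
    pull Ω φ w = (coordExpr Ω x ((chartAt E x ∘ φ) w)).bilinearComp
      (fderiv ℝ (chartAt E x ∘ φ) w) (fderiv ℝ (chartAt E x ∘ φ) w) := by
  ext u v
  rw [pull_apply, rdiff_eq_symm_comp_fderiv x hφ hx]
  simp only [coordExpr, Function.comp_apply, ContinuousLinearMap.bilinearComp_apply,
    ContinuousLinearMap.comp_apply, (chartAt E x).left_inv hx]
  rfl

theorem pull_eventuallyEq (Ω : BilinField E M) {φ : G → M} {w : G}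
    (hφ : ContMDiffAt 𝓘(ℝ, G) 𝓘(ℝ, E) ∞ φ w) (x : M) (hx : φ w ∈ (chartAt E x).source) :
    pull Ω φ =ᶠ[𝓝 w] fun w => (coordExpr Ω x ((chartAt E x ∘ φ) w)).bilinearComp
      (fderiv ℝ (chartAt E x ∘ φ) w) (fderiv ℝ (chartAt E x ∘ φ) w) := by
  have h1 : ∀ᶠ w' in 𝓝 w, ContMDiffAt 𝓘(ℝ, G) 𝓘(ℝ, E) 1 φ w' :=
    (contMDiffAt_iff_contMDiffAt_nhds (by simp)).1 (hφ.of_le ENat.LEInfty.out)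
  filter_upwards [h1, hφ.continuousAt ((chartAt E x).open_source.mem_nhds hx)] with w' h h'
  exact pull_eq_coordExpr Ω x (h.mdifferentiableAt (by simp)) h'

theorem IsKahler.pull_contDiffAt {Ω : BilinField E M} (h : IsKahler Ω) {φ : G → M} {w : G}
    (hφ : ContMDiffAt 𝓘(ℝ, G) 𝓘(ℝ, E) ∞ φ w) : ContDiffAt ℝ ∞ (pull Ω φ) w := by
  have hx := mem_chart_source E (φ w)
  have hχ := chartAt_comp_contDiffAt (φ w) hφ hx
  refine ContDiffAt.congr_of_eventuallyEq ?_ (pull_eventuallyEq Ω hφ (φ w) hx)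
  have h1 : ContDiffAt ℝ ∞ (coordExpr Ω (φ w)) ((chartAt E (φ w) ∘ φ) w) :=
    h.coordExpr_contDiffAt (φ w) ((chartAt E (φ w)).map_source hx)
  have h2 : ContDiffAt ℝ ∞ (coordExpr Ω (φ w) ∘ (chartAt E (φ w) ∘ φ)) w := h1.comp w hχ
  exact contDiffAt_bilinearComp h2 (hχ.fderiv_right (by simp))

theorem IsKahler.pull_closed {Ω : BilinField E M} (h : IsKahler Ω) {φ : G → M} {w : G}
    (hφ : ContMDiffAt 𝓘(ℝ, G) 𝓘(ℝ, E) ∞ φ w) (u v v' : G) :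
    fderiv ℝ (pull Ω φ) w u v v' + fderiv ℝ (pull Ω φ) w v v' u
      + fderiv ℝ (pull Ω φ) w v' u v = 0 := by
  have hx := mem_chart_source E (φ w)
  have hχ := chartAt_comp_contDiffAt (φ w) hφ hx
  have ht := (chartAt E (φ w)).map_source hx
  rw [(pull_eventuallyEq Ω hφ (φ w) hx).fderiv_eq]
  exact closed_bilinearComp_fderiv (β := coordExpr Ω (φ w)) (χ := chartAt E (φ w) ∘ φ)
    (h.coordExpr_contDiffAt (φ w) ht) hχ (fun _ _ => h.antisymm _ _ _)
    (fun u v v' => h.closed (φ w) _ ht u v v') u v v'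

theorem IsKahler.fderiv_pull_eq_zero {Ω : BilinField E M} (h : IsKahler Ω) {φ : G → M} {w : G}
    (hφ : ContMDiffAt 𝓘(ℝ, G) 𝓘(ℝ, E) ∞ φ w) {ξ : G}
    (hξ : ∀ s : ℝ, pull Ω φ (w + s • ξ) = pull Ω φ w) : fderiv ℝ (pull Ω φ) w ξ = 0 := by
  rw [← ((h.pull_contDiffAt hφ).differentiableAt (by simp)).lineDeriv_eq_fderiv (v := ξ), lineDeriv]
  simp [hξ]

/-- Cartan's formula for a form that is constant in the direction `ξ`: its contraction with `ξ`
is closed. -/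
theorem IsKahler.pull_contract_symm {Ω : BilinField E M} (h : IsKahler Ω) {φ : G → M} {w : G}
    (hφ : ContMDiffAt 𝓘(ℝ, G) 𝓘(ℝ, E) ∞ φ w) {ξ : G}
    (hξ : ∀ s : ℝ, pull Ω φ (w + s • ξ) = pull Ω φ w) (u v : G) :
    fderiv ℝ (pull Ω φ) w u ξ v = fderiv ℝ (pull Ω φ) w v ξ u := by
  have hd := (h.pull_contDiffAt hφ).differentiableAt (by simp)
  have h0 := h.fderiv_pull_eq_zero hφ hξ
  have h1 := h.pull_closed hφ ξ u v
  have h2 : fderiv ℝ (pull Ω φ) w u v ξ = - fderiv ℝ (pull Ω φ) w u ξ v := by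
    rw [← fderiv_apply₂ hd, ← fderiv_apply₂ hd, ← neg_apply, ← fderiv_fun_neg]
    congr 2
    ext w'
    exact h.pull_antisymm φ w' _ _
  rw [h0] at h1
  simp only [zero_apply] at h1
  linarith

end Pullback

/-! ### The torus action and its orbit maps -/

section TorusExp

variable {n : ℕ}

theorem torusExp_zero : torusExp (0 : Fin n → ℂ) = 1 := by
  ext j; simp [torusExp]

theorem torusExp_add (w w' : Fin n → ℂ) : torusExp (w + w') = torusExp w * torusExp w' := by
  ext j; simp [torusExp, Complex.exp_add]

theorem torusExp_surjective : Function.Surjective (torusExp : (Fin n → ℂ) → Fin n → ℂˣ) := by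
  intro t
  refine ⟨fun j => Complex.log (t j), ?_⟩
  ext j
  simp [torusExp, Complex.exp_log (t j).ne_zero]

/-- The vector `i c` of the Lie algebra of the real torus. -/
def imagVec (c : Fin n → ℝ) : Fin n → ℂ := fun j => (c j : ℂ) * Complex.I

/-- The vector `c` of the Lie algebra of the complex torus. -/
def realVec (c : Fin n → ℝ) : Fin n → ℂ := fun j => (c j : ℂ)

theorem imagVec_smul (s : ℝ) (c : Fin n → ℝ) : imagVec (s • c) = s • imagVec c := by
  ext j; simp [imagVec, mul_assoc]

theorem J_realVec (c : Fin n → ℝ) : J (Fin n → ℂ) (realVec c) = imagVec c := by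
  ext j; simp [imagVec, realVec, J, mul_comm]

theorem torusExp_imagVec (c : Fin n → ℝ) :
    torusExp (imagVec c) = realTorus (fun j => Circle.exp (c j)) := by
  ext j; simp [torusExp, imagVec, realTorus]

theorem exists_torusExp_eq_realTorus (t : Fin n → Circle) :
    ∃ c : Fin n → ℝ, torusExp (imagVec c) = realTorus t := by
  refine ⟨fun j => Complex.arg (t j), ?_⟩
  rw [torusExp_imagVec]
  congr 1
  ext j
  simp

/-- The kernel of the exponential map consists of imaginary vectors. -/
theorem exists_imagVec_of_torusExp_eq_one {w : Fin n → ℂ} (h : torusExp w = 1) :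
    ∃ c : Fin n → ℝ, w = imagVec c := by
  refine ⟨fun j => (w j).im, ?_⟩
  ext j
  have h1 : Complex.exp (w j) = 1 := by
    have := congrArg Units.val (congrFun h j)
    simpa [torusExp] using this
  obtain ⟨m, hm⟩ := Complex.exp_eq_one_iff.1 h1
  have h2 : (w j).re = 0 := by rw [hm]; simp
  apply Complex.ext <;> simp [imagVec, h2]

end TorusExp

section OrbitMap

variable {n : ℕ} {M : Type*} [MulAction (Fin n → ℂˣ) M]

/-- The orbit map of a point, composed with the exponential map. -/
def orbitMap (p : M) (w : Fin n → ℂ) : M := torusExp w • p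

theorem orbitMap_zero (p : M) : orbitMap p (0 : Fin n → ℂ) = p := by
  simp [orbitMap, torusExp_zero]

theorem orbitMap_add (p : M) (w w' : Fin n → ℂ) :
    orbitMap p (w + w') = torusExp w • orbitMap p w' := by
  simp [orbitMap, torusExp_add, mul_smul]

theorem orbitMap_add' (p : M) (w w' : Fin n → ℂ) :
    orbitMap p (w + w') = orbitMap (orbitMap p w) w' := by
  rw [add_comm]; simp [orbitMap, torusExp_add, mul_smul]

end OrbitMap

section Action

variable {n : ℕ} {E : Type*} [NormedAddCommGroup E] [NormedSpace ℂ E]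
  {M : Type*} [TopologicalSpace M] [ChartedSpace E M] [MulAction (Fin n → ℂˣ) M]

theorem torusField_eq (b : Fin n → ℝ) (p : M) :
    torusField (E := E) b p = rdiff ℝ E (fun s : ℝ => orbitMap p (s • imagVec b)) 0 1 := by
  unfold torusField rdiff
  have : (fun s : ℝ => torusExp (fun j => ((s * b j : ℝ) : ℂ) * Complex.I) • p)
    = fun s : ℝ => orbitMap p (s • imagVec b) := by
    ext s
    rw [← imagVec_smul]
    rfl
  rw [this]
  rfl

/-- The action map, with the second variable in the chart at `x`. -/
def actChart (x : M) (q : (Fin n → ℂ) × E) : M := torusExp q.1 • (chartAt E x).symm q.2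

theorem IsToric.orbitMap_holo (hM : IsToric n E M) (p : M) :
    ContMDiff 𝓘(ℂ, Fin n → ℂ) 𝓘(ℂ, E) ω (orbitMap p : (Fin n → ℂ) → M) := by
  have h : ContMDiff 𝓘(ℂ, Fin n → ℂ) (𝓘(ℂ, Fin n → ℂ).prod 𝓘(ℂ, E)) ω
    (fun w : Fin n → ℂ => (w, p)) := contMDiff_id.prodMk contMDiff_const
  exact hM.holomorphic.comp h

theorem IsToric.smul_holo (hM : IsToric n E M) (w : Fin n → ℂ) :
    ContMDiff 𝓘(ℂ, E) 𝓘(ℂ, E) ω (fun q : M => torusExp w • q) := by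
  have h : ContMDiff 𝓘(ℂ, E) (𝓘(ℂ, Fin n → ℂ).prod 𝓘(ℂ, E)) ω
    (fun q : M => (w, q)) := contMDiff_const.prodMk contMDiff_id
  exact hM.holomorphic.comp h

theorem IsToric.actChart_holo [IsManifold 𝓘(ℂ, E) ω M] (hM : IsToric n E M) (x : M)
    {q : (Fin n → ℂ) × E} (hq : q.2 ∈ (chartAt E x).target) :
    ContMDiffAt 𝓘(ℂ, (Fin n → ℂ) × E) 𝓘(ℂ, E) ω (actChart x) q := by
  have h1 : ContMDiffAt 𝓘(ℂ, (Fin n → ℂ) × E) 𝓘(ℂ, Fin n → ℂ) ω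
      (Prod.fst : (Fin n → ℂ) × E → _) q := contDiff_fst.contMDiff.contMDiffAt
  have h2 : ContMDiffAt 𝓘(ℂ, (Fin n → ℂ) × E) 𝓘(ℂ, E) ω
      (Prod.snd : (Fin n → ℂ) × E → _) q := contDiff_snd.contMDiff.contMDiffAt
  have h3 : ContMDiffAt 𝓘(ℂ, E) 𝓘(ℂ, E) ω (chartAt E x).symm q.2 :=
    contMDiffOn_chart_symm.contMDiffAt ((chartAt E x).open_target.mem_nhds hq)
  exact (hM.holomorphic.contMDiffAt (x := (q.1, (chartAt E x).symm q.2))).comp q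
    (h1.prodMk (h3.comp q h2))

theorem IsToric.orbitMap_smooth (hM : IsToric n E M) (p : M) (w : Fin n → ℂ) :
    ContMDiffAt 𝓘(ℝ, Fin n → ℂ) 𝓘(ℝ, E) ∞ (orbitMap p : (Fin n → ℂ) → M) w :=
  (contMDiffAt_real (hM.orbitMap_holo p w)).of_le le_top

theorem IsToric.orbitMap_mdiff (hM : IsToric n E M) (p : M) (w : Fin n → ℂ) :
    MDifferentiableAt 𝓘(ℝ, Fin n → ℂ) 𝓘(ℝ, E) (orbitMap p : (Fin n → ℂ) → M) w :=
  (hM.orbitMap_smooth p w).mdifferentiableAt (by simp)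

theorem IsToric.smul_mdiff (hM : IsToric n E M) (w : Fin n → ℂ) (p : M) :
    MDifferentiableAt 𝓘(ℝ, E) 𝓘(ℝ, E) (fun q : M => torusExp w • q) p :=
  (contMDiffAt_real (hM.smul_holo w p)).mdifferentiableAt (by simp)

theorem IsToric.continuous_smul (hM : IsToric n E M) (w : Fin n → ℂ) :
    Continuous (fun q : M => torusExp w • q) := (hM.smul_holo w).continuous

theorem IsToric.actChart_smooth [IsManifold 𝓘(ℂ, E) ω M] (hM : IsToric n E M) (x : M)
    {q : (Fin n → ℂ) × E} (hq : q.2 ∈ (chartAt E x).target) :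
    ContMDiffAt 𝓘(ℝ, (Fin n → ℂ) × E) 𝓘(ℝ, E) ∞ (actChart x) q :=
  (contMDiffAt_real (hM.actChart_holo x hq)).of_le le_top

/-- The differential of a map along a curve `s ↦ w + s ξ`. -/
theorem rdiff_line {G : Type*} [NormedAddCommGroup G] [NormedSpace ℝ G] {φ : G → M} {w : G}
    (hφ : MDifferentiableAt 𝓘(ℝ, G) 𝓘(ℝ, E) φ w) (ξ : G) :
    rdiff ℝ E (fun s : ℝ => φ (w + s • ξ)) 0 1 = rdiff G E φ w ξ := by
  have hl : HasFDerivAt (fun s : ℝ => w + s • ξ) ((1 : ℝ →L[ℝ] ℝ).smulRight ξ) 0 :=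
    ((hasFDerivAt_id (0 : ℝ)).smul_const ξ).const_add w
  have h0 : w + (0 : ℝ) • ξ = w := by simp
  have := rdiff_comp (g := φ) (f := fun s : ℝ => w + s • ξ) (0 : ℝ) (by simpa using hφ)
    hl.differentiableAt.mdifferentiableAt
  change rdiff ℝ E (φ ∘ fun s : ℝ => w + s • ξ) 0 1 = _
  rw [this, rdiff_eq_fderiv, hl.fderiv, h0]
  simp

theorem IsToric.rdiff_orbitMap_imagVec (hM : IsToric n E M) (p : M) (w : Fin n → ℂ)
    (c : Fin n → ℝ) :
    rdiff (Fin n → ℂ) E (orbitMap p) w (imagVec c) = torusField c (orbitMap p w) := by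
  rw [torusField_eq, ← rdiff_line (hM.orbitMap_mdiff p w)]
  simp_rw [orbitMap_add']

theorem IsToric.rdiff_orbitMap_J (hM : IsToric n E M) (p : M) (w v : Fin n → ℂ) :
    rdiff (Fin n → ℂ) E (orbitMap p) w (J _ v) = J E (rdiff (Fin n → ℂ) E (orbitMap p) w v) :=
  rdiff_J ((hM.orbitMap_holo p w).mdifferentiableAt (by simp)) v

theorem J_J (v : E) : J E (J E v) = - v := by
  simp [J, smul_smul]

theorem J_injective : Function.Injective (J E) := fun u v h => by
  have := congrArg (J E) h
  simpa [J_J] using this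

/-- The orbit map is holomorphic and `J (realVec b) = imagVec b` is sent to `J X`. Hence `X`,
although not tangent to the real torus, is also the image of a constant field on `ℂⁿ`. -/
theorem IsToric.rdiff_orbitMap_realVec (hM : IsToric n E M) (p : M) (w : Fin n → ℂ)
    {X : VField E M} {b : Fin n → ℝ} (hb : (fun p => J E (X p)) = torusField b) :
    rdiff (Fin n → ℂ) E (orbitMap p) w (realVec b) = X (orbitMap p w) := by
  apply J_injective
  rw [← hM.rdiff_orbitMap_J, J_realVec, hM.rdiff_orbitMap_imagVec, ← hb]

theorem IsToric.rdiff_actChart_imagVec [IsManifold 𝓘(ℂ, E) ω M] (hM : IsToric n E M) (x : M)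
    {y : E} (hy : y ∈ (chartAt E x).target) (c : Fin n → ℝ) :
    rdiff ((Fin n → ℂ) × E) E (actChart (n := n) x) (0, y) (imagVec c, 0)
      = torusField c ((chartAt E x).symm y) := by
  rw [torusField_eq, ← rdiff_line ((hM.actChart_smooth x hy).mdifferentiableAt (by simp))]
  simp [actChart, orbitMap]

theorem IsToric.rdiff_actChart_snd [IsManifold 𝓘(ℂ, E) ω M] (hM : IsToric n E M) (x : M)
    {y : E} (hy : y ∈ (chartAt E x).target) (v : E) :
    rdiff ((Fin n → ℂ) × E) E (actChart (n := n) x) (0, y) (0, v) = rdiff E E (chartAt E x).symm y v := by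
  rw [← rdiff_line ((hM.actChart_smooth x hy).mdifferentiableAt (by simp)),
    ← rdiff_line (chartAt_symm_mdiff x hy)]
  simp [actChart, torusExp_zero]

/-- The pullback of an invariant form under a map that is equivariant in the direction `ξ` is
constant in this direction. -/
theorem IsToric.pull_translate (hM : IsToric n E M) {Ω : BilinField E M}
    (hinv : TorusInvariantForm n Ω) {G : Type*} [NormedAddCommGroup G] [NormedSpace ℝ G]
    {φ : G → M} {w ξ : G} {c : Fin n → ℝ}
    (hφ : MDifferentiableAt 𝓘(ℝ, G) 𝓘(ℝ, E) φ w)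
    (hc : ∀ w, φ (w + ξ) = torusExp (imagVec c) • φ w) :
    pull Ω φ (w + ξ) = pull Ω φ w := by
  have h1 : φ = (fun q => torusExp (imagVec c) • q) ∘ φ ∘ (fun w => w - ξ) := by
    ext w
    simp [← hc]
  have ht : HasFDerivAt (fun w => w - ξ) (ContinuousLinearMap.id ℝ G) (w + ξ) :=
    (hasFDerivAt_id _).sub_const ξ
  have hw : w + ξ - ξ = w := by abel
  have h2 : rdiff G E φ (w + ξ) = (rdiff E E (fun q : M => torusExp (imagVec c) • q) (φ w)).comp
      (rdiff G E φ w) := by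
    conv_lhs => rw [h1]
    have h3 : MDifferentiableAt 𝓘(ℝ, G) 𝓘(ℝ, E) φ ((fun w => w - ξ) (w + ξ)) := by
      simpa only [hw] using hφ
    have h4 := ht.differentiableAt.mdifferentiableAt
    rw [rdiff_comp (w + ξ) (hM.smul_mdiff _ _) (h3.comp (w + ξ) h4), rdiff_comp (w + ξ) h3 h4, rdiff_eq_fderiv,
      ht.fderiv, ContinuousLinearMap.comp_id]
    simp only [Function.comp_apply, hw]
  ext u v
  rw [pull_apply, pull_apply, h2, hc, torusExp_imagVec]
  exact hinv _ _ _ _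

end Action

/-! ### Maps with vanishing differential -/

section LocallyConstant

variable {E : Type*} [NormedAddCommGroup E] [NormedSpace ℝ E]
  {F : Type*} [NormedAddCommGroup F] [NormedSpace ℝ F]
  {M : Type*} [TopologicalSpace M] [ChartedSpace E M] [IsManifold 𝓘(ℝ, E) ∞ M]
  {N : Type*} [TopologicalSpace N] [ChartedSpace F N] [IsManifold 𝓘(ℝ, F) ∞ N]

/-- A map with vanishing differential near a point is constant near this point. -/
theorem eventually_eq_of_rdiff_eq_zero {φ : M → N} {p : M}
    (h : ∀ᶠ q in 𝓝 p, MDifferentiableAt 𝓘(ℝ, E) 𝓘(ℝ, F) φ q ∧ rdiff E F φ q = 0) :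
    ∀ᶠ q in 𝓝 p, φ q = φ p := by
  set e := chartAt E p
  set e' := chartAt F (φ p)
  have hp : p ∈ e.source := mem_chart_source E p
  have hφp : φ p ∈ e'.source := mem_chart_source F (φ p)
  have hc : ContinuousAt φ p := h.self_of_nhds.1.continuousAt
  have h1 : ∀ᶠ q in 𝓝 p, q ∈ e.source ∧ φ q ∈ e'.source ∧
      MDifferentiableAt 𝓘(ℝ, E) 𝓘(ℝ, F) φ q ∧ rdiff E F φ q = 0 := by
    filter_upwards [h, e.open_source.mem_nhds hp, hc (e'.open_source.mem_nhds hφp)]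
      with q h1 h2 h3 using ⟨h2, h3, h1.1, h1.2⟩
  have h2 : ∀ᶠ y in 𝓝 (e p), y ∈ e.target ∧ φ (e.symm y) ∈ e'.source ∧
      MDifferentiableAt 𝓘(ℝ, E) 𝓘(ℝ, F) φ (e.symm y) ∧ rdiff E F φ (e.symm y) = 0 := by
    have ht := e.map_source hp
    have hs : Filter.Tendsto e.symm (𝓝 (e p)) (𝓝 p) := by
      have := e.continuousAt_symm ht
      rwa [ContinuousAt, e.left_inv hp] at this
    filter_upwards [hs.eventually h1, e.open_target.mem_nhds ht] with y h3 h4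
    exact ⟨h4, h3.2.1, h3.2.2.1, h3.2.2.2⟩
  obtain ⟨r, hr, hB⟩ := Metric.eventually_nhds_iff_ball.1 h2
  have hd : ∀ y ∈ Metric.ball (e p) r, HasFDerivAt (e' ∘ φ ∘ e.symm) (0 : E →L[ℝ] F) y := by
    intro y hy
    obtain ⟨h3, h4, h5, h6⟩ := hB y hy
    have hs := chartAt_symm_mdiff p h3
    have he' := chartAt_mdiff (φ p) h4
    have hm : MDifferentiableAt 𝓘(ℝ, E) 𝓘(ℝ, F) (e' ∘ φ ∘ e.symm) y :=
      MDifferentiableAt.comp (I' := 𝓘(ℝ, F)) y he' (h5.comp y hs)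
    have hz : rdiff E F (e' ∘ φ ∘ e.symm) y = 0 := by
      rw [rdiff_comp (F := F) y he' (h5.comp y hs), rdiff_comp y h5 hs, h6]
      simp
    rw [← hz, rdiff_eq_fderiv]
    exact hm.differentiableAt.hasFDerivAt
  have hconst : ∀ y ∈ Metric.ball (e p) r, (e' ∘ φ ∘ e.symm) y = (e' ∘ φ ∘ e.symm) (e p) := by
    intro y hy
    exact (convex_ball (e p) r).is_const_of_fderivWithin_eq_zero (𝕜 := ℝ)
      (fun z hz => (hd z hz).differentiableAt.differentiableWithinAt)
      (fun z hz => by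
        rw [fderivWithin_of_isOpen Metric.isOpen_ball hz, (hd z hz).fderiv]) hy
        (Metric.mem_ball_self hr)
  have hpre : ∀ᶠ q in 𝓝 p, e q ∈ Metric.ball (e p) r :=
    (e.continuousAt hp) (Metric.ball_mem_nhds _ hr)
  filter_upwards [hpre, h1] with q hq hq'
  have := hconst _ hq
  simp only [Function.comp_apply, e.left_inv hq'.1, e.left_inv hp] at this
  exact e'.injOn hq'.2.1 hφp this

end LocallyConstant

/-! ### The potential along the dense orbit -/

section Orbit

variable {n : ℕ} {E : Type*} [NormedAddCommGroup E] [NormedSpace ℂ E]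
  {M : Type*} [TopologicalSpace M] [ChartedSpace E M]
  [MulAction (Fin n → ℂˣ) M]

theorem mem_orbit_iff_orbitMap {n : ℕ} {M : Type*} [MulAction (Fin n → ℂˣ) M] {p q : M} :
    q ∈ MulAction.orbit (Fin n → ℂˣ) p ↔ ∃ w : Fin n → ℂ, orbitMap p w = q := by
  constructor
  · rintro ⟨t, rfl⟩
    obtain ⟨w, rfl⟩ := torusExp_surjective t
    exact ⟨w, rfl⟩
  · rintro ⟨w, rfl⟩
    exact ⟨torusExp w, rfl⟩

/-- The stabilizer of a point with a dense orbit is trivial. -/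
theorem IsToric.torusExp_eq_one [T2Space M] (hM : IsToric n E M) {p : M}
    (hp : Dense (MulAction.orbit (Fin n → ℂˣ) p)) {w : Fin n → ℂ} (hw : orbitMap p w = p) :
    torusExp w = 1 := by
  apply hM.effective
  -- The torus is abelian, so an element that fixes `p` fixes its whole orbit, and by density all of
  -- `M`.
  have h : (fun q : M => torusExp w • q) = fun q => q := by
    apply Continuous.ext_on hp (hM.continuous_smul w) continuous_id
    rintro q ⟨t, rfl⟩
    change torusExp w • t • p = t • p
    rw [← mul_smul, mul_comm, mul_smul]
    congr 1
  exact fun q => congrFun h q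

/-- Equivariance of the orbit map: a vector killed by its differential at one point is killed at
every point. -/
theorem IsToric.rdiff_orbitMap_add (hM : IsToric n E M) (p : M) (w u v : Fin n → ℂ) :
    rdiff (Fin n → ℂ) E (orbitMap p) (w + u) v
      = rdiff E E (fun q : M => torusExp w • q) (orbitMap p u)
        (rdiff (Fin n → ℂ) E (orbitMap p) u v) := by
  rw [← rdiff_line (hM.orbitMap_mdiff p (w + u)), ← ContinuousLinearMap.comp_apply,
    ← rdiff_comp u (hM.smul_mdiff w _) (hM.orbitMap_mdiff p u),
    ← rdiff_line ((hM.smul_mdiff w _).comp u (hM.orbitMap_mdiff p u))]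
  simp only [Function.comp_apply, ← orbitMap_add, add_assoc]

variable {Ω : BilinField E M}

theorem IsToric.pull_orbitMap_translate (hM : IsToric n E M) (hinv : TorusInvariantForm n Ω)
    (p : M) (w : Fin n → ℂ) (c : Fin n → ℝ) (s : ℝ) :
    pull Ω (orbitMap p) (w + s • imagVec c) = pull Ω (orbitMap p) w := by
  rw [← imagVec_smul]
  exact hM.pull_translate hinv (c := s • c) (hM.orbitMap_mdiff p w) fun w => by
    rw [add_comm, orbitMap_add]

variable [IsManifold 𝓘(ℂ, E) ω M]

/-- The orbit map of a point with a dense orbit is an immersion. -/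
theorem IsToric.rdiff_orbitMap_injective [T2Space M] (hM : IsToric n E M) {p : M}
    (hp : Dense (MulAction.orbit (Fin n → ℂˣ) p)) :
    Function.Injective (rdiff (Fin n → ℂ) E (orbitMap p) (0 : Fin n → ℂ)) := by
  rw [injective_iff_map_eq_zero]
  intro k hk
  -- A vector `k` in the kernel at `0` lies in the kernel everywhere, so this curve has zero
  -- velocity and is constant. The stabilizer is trivial, so `exp (s k) = 1` for every real `s`, and
  -- the derivative at `s = 0` gives `k = 0`.
  let γ : ℝ → M := fun s => orbitMap p (s • k)
  have hγd : ∀ s, MDifferentiableAt 𝓘(ℝ, ℝ) 𝓘(ℝ, E) γ s := fun s =>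
    (hM.orbitMap_mdiff p (s • k)).comp s
      ((differentiableAt_id.smul_const k : DifferentiableAt ℝ (fun s : ℝ => s • k) s)
        |>.mdifferentiableAt)
  have hγ : ∀ s, rdiff ℝ E γ s = 0 := by
    intro s
    have h1 : rdiff ℝ E γ s 1 = 0 := by
      have h2 := rdiff_line (hγd s) (1 : ℝ)
      rw [← h2]
      have h3 := hM.rdiff_orbitMap_add p (s • k) 0 k
      rw [hk, map_zero, add_zero, ← rdiff_line (hM.orbitMap_mdiff p _)] at h3
      rw [← h3]
      simp only [γ, smul_eq_mul, mul_one, add_smul]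
    ext
    exact h1
  have hlc : IsLocallyConstant γ := by
    rw [IsLocallyConstant.iff_eventually_eq]
    intro s
    exact eventually_eq_of_rdiff_eq_zero (Filter.Eventually.of_forall fun s => ⟨hγd s, hγ s⟩)
  have hc : ∀ s : ℝ, orbitMap p (s • k) = p := by
    intro s
    have := hlc.apply_eq_of_isPreconnected isPreconnected_univ (Set.mem_univ s) (Set.mem_univ 0)
    simpa [γ, orbitMap_zero] using this
  have h1 : ∀ s : ℝ, torusExp (s • k) = 1 := fun s => hM.torusExp_eq_one hp (hc s)
  ext j
  have h2 : ∀ s : ℝ, Complex.exp ((s : ℂ) * k j) = 1 := by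
    intro s
    have := congrArg Units.val (congrFun (h1 s) j)
    simpa [torusExp] using this
  have h3 : HasDerivAt (fun s : ℝ => Complex.exp ((s : ℂ) * k j)) (k j) 0 := by
    have h4 : HasDerivAt (fun s : ℝ => (s : ℂ) * k j) (k j) 0 := by
      simpa using (Complex.ofRealCLM.hasDerivAt (x := (0 : ℝ))).mul_const (k j)
    simpa using h4.cexp
  have h5 : HasDerivAt (fun s : ℝ => Complex.exp ((s : ℂ) * k j)) 0 0 := by
    simp_rw [h2]
    exact hasDerivAt_const _ _
  exact h3.unique h5

/-- Two fundamental vector fields that are orthogonal for `Ω` at a point are so on its orbit. -/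
theorem IsToric.pull_imagVec_eq_zero (hM : IsToric n E M) (hΩ : IsKahler Ω)
    (hinv : TorusInvariantForm n Ω) {p : M} {b c : Fin n → ℝ}
    (h0 : Ω p (torusField b p) (torusField c p) = 0) (w : Fin n → ℂ) :
    pull Ω (orbitMap p) w (imagVec b) (imagVec c) = 0 := by
  have hd : ∀ w, DifferentiableAt ℝ (pull Ω (orbitMap (n := n) p)) w := fun w =>
    (hΩ.pull_contDiffAt (hM.orbitMap_smooth p w)).differentiableAt (by simp)
  -- Invariance along `imagVec b` makes its contraction closed, which exchanges the direction `u`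
  -- with the argument `imagVec c`. The result is a derivative along `imagVec c`, zero by
  -- invariance.
  have hz : ∀ w, fderiv ℝ (fun w => pull Ω (orbitMap (n := n) p) w (imagVec b) (imagVec c)) w
      = 0 := by
    intro w
    ext u
    rw [fderiv_apply₂ (hd w), hΩ.pull_contract_symm (hM.orbitMap_smooth p w)
      (fun s => hM.pull_orbitMap_translate hinv p w b s),
      hΩ.fderiv_pull_eq_zero (hM.orbitMap_smooth p w)
      (fun s => hM.pull_orbitMap_translate hinv p w c s)]
    simp
  have hdiff : Differentiable ℝ
      (fun w => pull Ω (orbitMap (n := n) p) w (imagVec b) (imagVec c)) := fun w =>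
    ((hd w).clm_apply (differentiableAt_const _)).clm_apply (differentiableAt_const _)
  have := is_const_of_fderiv_eq_zero hdiff hz w 0
  rw [this, pull_apply, hM.rdiff_orbitMap_imagVec, hM.rdiff_orbitMap_imagVec, orbitMap_zero]
  exact h0

/-- The potential along the dense orbit. -/
theorem IsToric.exists_orbit_potential [T2Space M] (hM : IsToric n E M) (hΩ : IsKahler Ω)
    (hinv : TorusInvariantForm n Ω) {p : M} (hp : Dense (MulAction.orbit (Fin n → ℂˣ) p))
    {b : Fin n → ℝ} (h0 : ∀ c : Fin n → ℝ, Ω p (torusField b p) (torusField c p) = 0) :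
    ∃ f : M → ℝ, (∀ w, HasFDerivAt (fun w => f (orbitMap p w))
        (-(pull Ω (orbitMap p) w (imagVec b))) w) ∧
      ∀ (w : Fin n → ℂ) (c : Fin n → ℝ), f (orbitMap p (w + imagVec c)) = f (orbitMap p w) := by
  have hd : ∀ w, DifferentiableAt ℝ (pull Ω (orbitMap (n := n) p)) w := fun w =>
    (hΩ.pull_contDiffAt (hM.orbitMap_smooth p w)).differentiableAt (by simp)
  have hd' : ∀ w, DifferentiableAt ℝ (fun w => -(pull Ω (orbitMap p) w (imagVec b))) w := fun w =>
    ((hd w).clm_apply (differentiableAt_const _)).neg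
  have hsym : ∀ w u v, fderiv ℝ (fun w => -(pull Ω (orbitMap p) w (imagVec b))) w u v
      = fderiv ℝ (fun w => -(pull Ω (orbitMap p) w (imagVec b))) w v u := by
    intro w u v
    rw [← fderiv_apply₁ (hd' w), ← fderiv_apply₁ (hd' w)]
    simp only [neg_apply, fderiv_fun_neg]
    rw [fderiv_apply₂ (hd w), fderiv_apply₂ (hd w),
      hΩ.pull_contract_symm (hM.orbitMap_smooth p w)
      (fun s => hM.pull_orbitMap_translate hinv p w b s)]
  -- Poincaré lemma on `ℂⁿ`; the periods of the orbit are dealt with by `hFc` and `hwd`.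
  obtain ⟨F, hF⟩ := Convex.exists_forall_hasFDerivAt_of_fderiv_symmetric
    (convex_univ (𝕜 := ℝ) (E := Fin n → ℂ)) isOpen_univ
    (fun w _ => (hd' w).differentiableWithinAt) (fun w _ u v => hsym w u v)
  replace hF : ∀ w, HasFDerivAt F (-(pull Ω (orbitMap p) w (imagVec b))) w :=
    fun w => hF w (Set.mem_univ _)
  have hFc : ∀ w (c : Fin n → ℝ), F (w + imagVec c) = F w := by
    intro w c
    have hl : ∀ s : ℝ, HasDerivAt (fun s : ℝ => F (w + s • imagVec c)) 0 s := by
      intro s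
      have h1 : HasDerivAt (fun s : ℝ => w + s • imagVec c) (imagVec c) s := by
        simpa using ((hasDerivAt_id s).smul_const (imagVec c)).const_add w
      have h2 := (hF (w + s • imagVec c)).comp_hasDerivAt s h1
      have h3 : (-(pull Ω (orbitMap p) (w + s • imagVec c) (imagVec b))) (imagVec c) = 0 := by
        simp [hM.pull_imagVec_eq_zero hΩ hinv (h0 c)]
      rw [h3] at h2
      exact h2
    have := is_const_of_deriv_eq_zero (fun s => (hl s).differentiableAt) (fun s => (hl s).deriv) 1 0
    simpa using this
  -- Two logarithms of the same point differ by an element of the kernel of the exponential map,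
  -- which is imaginary.
  have hwd : ∀ w w', orbitMap p w = orbitMap p w' → F w = F w' := by
    intro w w' h
    have h1 : orbitMap p (w - w') = p := by
      have h2 := congrArg (fun q => torusExp (-w') • q) h
      simp only [← orbitMap_add] at h2
      rw [neg_add_cancel, orbitMap_zero] at h2
      rw [← h2]
      congr 1
      abel
    obtain ⟨c, hc⟩ := exists_imagVec_of_torusExp_eq_one (hM.torusExp_eq_one hp h1)
    rw [← hFc w' c, ← hc]
    congr 1
    abel
  -- Off the orbit the value is a meaningless default; only values on the orbit are ever used.
  refine ⟨fun q => F (Function.invFun (orbitMap p) q), ?_⟩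
  have hval : ∀ w, F (Function.invFun (orbitMap p) (orbitMap p w)) = F w := fun w =>
    hwd _ _ (Function.invFun_eq ⟨w, rfl⟩)
  simp only [hval]
  exact ⟨hF, hFc⟩

end Orbit

/-! ### The complement of the dense orbit as an analytic set -/

section Slit

/-- A function with vanishing derivative off the zero set of a holomorphic function `g ≢ 0` on a
convex open subset of `ℂ` takes the same value at any two points where `g` does not vanish. -/
theorem eq_of_hasFDerivAt_zero_off_zeros {D : Set ℂ} (hD : IsOpen D) (hconv : Convex ℝ D)
    {g : ℂ → ℂ} (hg : DifferentiableOn ℂ g D) {u : ℂ → ℝ}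
    (hu : ∀ ζ ∈ D, g ζ ≠ 0 → HasFDerivAt u (0 : ℂ →L[ℝ] ℝ) ζ)
    (h0 : (0 : ℂ) ∈ D) (h1 : (1 : ℂ) ∈ D) (hg0 : g 0 ≠ 0) (hg1 : g 1 ≠ 0) : u 0 = u 1 := by
  have hcon : IsConnected D := ⟨⟨0, h0⟩, hconv.isPreconnected⟩
  -- The zeros of a holomorphic function that is not identically zero are discrete, hence countable
  -- in the plane.
  have hZ : (D ∩ g ⁻¹' {0}).Countable := by
    have := AnalyticOnNhd.preimage_zero_mem_codiscreteWithin (hg.analyticOnNhd hD) hg0 h0 hcon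
    have h2 : (D ∩ g ⁻¹' {0})ᶜ ∈ Filter.codiscreteWithin D := by
      filter_upwards [this] with z hz hz'
      exact hz hz'.2
    have h3 := isDiscrete_of_codiscreteWithin h2
    rw [Set.inter_eq_left.2 Set.inter_subset_left] at h3
    exact (HereditarilyLindelofSpace.isLindelof _).countable_of_isDiscrete h3
  set Z := D ∩ g ⁻¹' {0}
  have hseg : ∀ a b : ℂ, a ∈ D → b ∈ D → (∀ z ∈ segment ℝ a b, z ∉ Z) → u a = u b := by
    intro a b ha hb hab
    have hsub : segment ℝ a b ⊆ D := hconv.segment_subset ha hb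
    have := (convex_segment a b).norm_image_sub_le_of_norm_hasFDerivWithin_le (C := 0) (𝕜 := ℝ)
      (f := u) (f' := fun _ => 0)
      (fun z hz => (hu z (hsub hz) fun h => hab z hz ⟨hsub hz, h⟩).hasFDerivWithinAt)
      (fun z hz => by simp) (left_mem_segment ℝ a b) (right_mem_segment ℝ a b)
    rw [zero_mul, norm_le_zero_iff, sub_eq_zero] at this
    exact this.symm
  -- The path goes from `0` to `1` through `1/2 + i t`. A zero `z` lies on its first half only if `t
  -- = z.im / (2 z.re)`, on its second half only if `t = z.im / (2 (1 - z.re))`. Only countably many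
  -- `t` are excluded.
  have hbad : (((fun z : ℂ => z.im / (2 * z.re)) '' Z) ∪
      ((fun z : ℂ => z.im / (2 * (1 - z.re))) '' Z)).Countable :=
    (hZ.image _).union (hZ.image _)
  let m : ℝ → ℂ := fun t => ⟨1 / 2, t⟩
  have hm : Continuous m := by
    have : m = fun t : ℝ => (1 / 2 : ℂ) + t * Complex.I := by
      funext t
      apply Complex.ext <;> simp [m]
    rw [this]
    fun_prop
  have hm0 : m 0 ∈ D := by
    have h2 : m 0 = (1 / 2 : ℝ) • (0 : ℂ) + (1 / 2 : ℝ) • (1 : ℂ) := by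
      apply Complex.ext <;> simp [m]
    rw [h2]
    exact hconv h0 h1 (by norm_num) (by norm_num) (by norm_num)
  obtain ⟨t, htD, htbad⟩ : ∃ t, m t ∈ D ∧ t ∉ (((fun z : ℂ => z.im / (2 * z.re)) '' Z) ∪
      ((fun z : ℂ => z.im / (2 * (1 - z.re))) '' Z)) := by
    have hd := (hbad.dense_compl ℝ)
    obtain ⟨t, ht, ht'⟩ := hd.inter_open_nonempty (m ⁻¹' D) (hD.preimage hm) ⟨0, hm0⟩
    exact ⟨t, ht, ht'⟩
  have e1 : u 0 = u (m t) := by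
    apply hseg _ _ h0 htD
    rintro z ⟨a, s, ha, hs, has, rfl⟩ hz
    apply htbad
    left
    refine ⟨_, hz, ?_⟩
    have hs0 : s ≠ 0 := by
      rintro rfl
      apply hg0
      simpa using hz.2
    simp [m]
    field_simp
  have e2 : u 1 = u (m t) := by
    apply hseg _ _ h1 htD
    rintro z ⟨a, s, ha, hs, has, rfl⟩ hz
    apply htbad
    right
    refine ⟨_, hz, ?_⟩
    have hs0 : s ≠ 0 := by
      rintro rfl
      apply hg1
      have : a = 1 := by linarith
      simpa [this] using hz.2
    have : a = 1 - s := by linarith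
    subst this
    have h2 : (1 : ℝ) - (1 - s + s * 2⁻¹) = s / 2 := by ring
    simp [m, h2]
    field_simp
  rw [e1, e2]

end Slit

section Velocity

variable {n : ℕ} {E : Type*} [NormedAddCommGroup E] [NormedSpace ℂ E]
  {M : Type*} [TopologicalSpace M] [ChartedSpace E M]
  [MulAction (Fin n → ℂˣ) M]

/-- The infinitesimal action at the point with coordinate `y` in the chart at `x`. -/
def velocity (n : ℕ) [MulAction (Fin n → ℂˣ) M] (x : M) (y : E) : (Fin n → ℂ) →L[ℂ] E :=
  (fderiv ℂ (chartAt E x ∘ actChart (n := n) x) (0, y)).comp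
    (ContinuousLinearMap.inl ℂ (Fin n → ℂ) E)

/-- The determinant of the infinitesimal action in a chart. -/
def velocityDet (n : ℕ) [MulAction (Fin n → ℂˣ) M] (e : E ≃L[ℂ] (Fin n → ℂ)) (x : M) (y : E) :
    ℂ := Matrix.det (Matrix.of fun i j => e (velocity n x y (Pi.single j 1)) i)

theorem velocityDet_eq (e : E ≃L[ℂ] (Fin n → ℂ)) (x : M) (y : E) :
    velocityDet n e x y
      = LinearMap.det (e.toLinearEquiv.toLinearMap ∘ₗ (velocity n x y).toLinearMap) := by
  rw [← LinearMap.det_toMatrix']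
  congr 1

theorem velocityDet_ne_zero_iff (e : E ≃L[ℂ] (Fin n → ℂ)) (x : M) (y : E) :
    velocityDet n e x y ≠ 0 ↔ Function.Bijective (velocity n x y) := by
  rw [velocityDet_eq, ← isUnit_iff_ne_zero, ← LinearMap.isUnit_iff_isUnit_det,
    Module.End.isUnit_iff]
  exact Function.Bijective.of_comp_iff' e.bijective (velocity n x y)

variable [IsManifold 𝓘(ℂ, E) ω M]

theorem IsToric.contDiffAt_chartAt_actChart (hM : IsToric n E M) (x : M) {y : E}
    (hy : y ∈ (chartAt E x).target) :
    ContDiffAt ℂ ω (chartAt E x ∘ actChart (n := n) x) (0, y) := by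
  rw [← contMDiffAt_iff_contDiffAt]
  have hs : actChart (n := n) x (0, y) ∈ (chartAt E x).source := by
    simpa [actChart, torusExp_zero] using (chartAt E x).map_target hy
  exact ((contMDiffOn_chart (I := 𝓘(ℂ, E)) (n := ω)).contMDiffAt
    ((chartAt E x).open_source.mem_nhds hs)).comp _ (hM.actChart_holo x hy)

theorem IsToric.hasStrictFDerivAt_velocity (hM : IsToric n E M) (x : M) {y : E}
    (hy : y ∈ (chartAt E x).target) :
    HasStrictFDerivAt (chartAt E x ∘ orbitMap ((chartAt E x).symm y)) (velocity n x y)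
      (0 : Fin n → ℂ) := by
  have h1 := (hM.contDiffAt_chartAt_actChart x hy).hasStrictFDerivAt (by simp)
  have h2 : HasStrictFDerivAt (fun w : Fin n → ℂ => (w, y))
      (ContinuousLinearMap.inl ℂ (Fin n → ℂ) E) 0 := by
    exact (hasStrictFDerivAt_id (𝕜 := ℂ) (0 : Fin n → ℂ)).prodMk (hasStrictFDerivAt_const y 0)
  exact HasStrictFDerivAt.comp (0 : Fin n → ℂ) h1 h2

theorem IsToric.velocity_differentiableAt (hM : IsToric n E M) (x : M) {y : E}
    (hy : y ∈ (chartAt E x).target) : DifferentiableAt ℂ (velocity n x) y := by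
  have h1 : ContDiffAt ℂ ω (fderiv ℂ (chartAt E x ∘ actChart (n := n) x)) (0, y) :=
    (hM.contDiffAt_chartAt_actChart x hy).fderiv_right (by simp)
  have h2 : DifferentiableAt ℂ (fun y : E => ((0 : Fin n → ℂ), y)) y := by fun_prop
  have h3 : DifferentiableAt ℂ (fderiv ℂ (chartAt E x ∘ actChart (n := n) x) ∘
    fun y : E => ((0 : Fin n → ℂ), y)) y := (h1.differentiableAt (by simp)).comp y h2
  exact h3.clm_comp (differentiableAt_const _)

theorem IsToric.rdiff_orbitMap_eq_velocity (hM : IsToric n E M) (x : M) {y : E}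
    (hy : y ∈ (chartAt E x).target) (v : Fin n → ℂ) :
    rdiff (Fin n → ℂ) E (orbitMap (n := n) ((chartAt E x).symm y)) 0 v
      = rdiff E E (chartAt E x).symm y (velocity n x y v) := by
  have hs : orbitMap ((chartAt E x).symm y) (0 : Fin n → ℂ) ∈ (chartAt E x).source := by
    simpa [orbitMap_zero] using (chartAt E x).map_target hy
  rw [rdiff_eq_symm_comp_fderiv x (hM.orbitMap_mdiff _ 0) hs,
    ((hM.hasStrictFDerivAt_velocity x hy).hasFDerivAt.restrictScalars ℝ).fderiv]
  simp [orbitMap_zero, (chartAt E x).right_inv hy]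

theorem IsToric.velocity_injective [T2Space M] (hM : IsToric n E M) (x : M) {y : E}
    (hy : y ∈ (chartAt E x).target)
    (hp : Dense (MulAction.orbit (Fin n → ℂˣ) ((chartAt E x).symm y))) :
    Function.Injective (velocity n x y) := by
  intro u v huv
  apply hM.rdiff_orbitMap_injective hp
  rw [hM.rdiff_orbitMap_eq_velocity x hy, hM.rdiff_orbitMap_eq_velocity x hy, huv]

/-- Holomorphy of the determinant is what makes the complement of the dense orbit too thin to
separate a ball. -/
theorem IsToric.velocityDet_differentiableAt (hM : IsToric n E M) (e : E ≃L[ℂ] (Fin n → ℂ))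
    (x : M) {y : E} (hy : y ∈ (chartAt E x).target) :
    DifferentiableAt ℂ (velocityDet n e x) y := by
  have h := hM.velocity_differentiableAt x hy
  have h1 : ∀ i j, DifferentiableAt ℂ (fun y => e (velocity n x y (Pi.single j 1)) i) y := by
    intro i j
    have h2 : DifferentiableAt ℂ (fun y => e (velocity n x y (Pi.single j 1))) y :=
      (e.differentiableAt).comp y (h.clm_apply (differentiableAt_const _))
    exact (differentiableAt_pi.1 h2) i
  unfold velocityDet
  simp only [Matrix.det_apply, Matrix.of_apply]
  refine DifferentiableAt.fun_sum fun σ _ => ?_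
  apply DifferentiableAt.const_smul
  exact (HasFDerivAt.finsetProd fun i _ => (h1 (σ i) i).hasFDerivAt).differentiableAt

variable [FiniteDimensional ℂ E]

/-- A point at which the action is infinitesimally transitive lies in the dense orbit. -/
theorem IsToric.mem_orbit_of_surjective (hM : IsToric n E M) {p : M}
    (hp : Dense (MulAction.orbit (Fin n → ℂˣ) p)) (x : M) {y : E}
    (hy : y ∈ (chartAt E x).target) (hs : Function.Surjective (velocity n x y)) :
    (chartAt E x).symm y ∈ MulAction.orbit (Fin n → ℂˣ) p := by
  set q := (chartAt E x).symm y
  have hq : q ∈ (chartAt E x).source := (chartAt E x).map_target hy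
  -- Surjectivity of the differential makes the orbit map open at `0`: the orbit of `q` contains a
  -- neighbourhood of `q`, meets the dense orbit, and so equals it.
  have h1 := (hM.hasStrictFDerivAt_velocity x hy).map_nhds_eq_of_surj (LinearMap.range_eq_top.2 hs)
  have hc : ContinuousAt (orbitMap (n := n) q) 0 := (hM.orbitMap_smooth q 0).continuousAt
  have h2 : Filter.map (orbitMap (n := n) q) (𝓝 0) = 𝓝 q := by
    have h3 : Filter.map (chartAt E x).symm (Filter.map (chartAt E x ∘ orbitMap (n := n) q) (𝓝 0))
        = 𝓝 q := by
      rw [h1, Function.comp_apply, orbitMap_zero, (chartAt E x).right_inv hy,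
        (chartAt E x).symm.map_nhds_eq hy]
    rw [← h3, Filter.map_map]
    apply Filter.map_congr
    have : ∀ᶠ w in 𝓝 (0 : Fin n → ℂ), orbitMap q w ∈ (chartAt E x).source := by
      apply hc
      rw [orbitMap_zero]
      exact (chartAt E x).open_source.mem_nhds hq
    filter_upwards [this] with w hw
    exact ((chartAt E x).left_inv hw).symm
  have h4 : Set.range (orbitMap (n := n) q) ∈ 𝓝 q := by
    rw [← h2]
    exact Filter.range_mem_map
  obtain ⟨z, hz, ⟨w, rfl⟩⟩ := hp.inter_nhds_nonempty h4
  have h5 : orbitMap q w ∈ MulAction.orbit (Fin n → ℂˣ) q := ⟨torusExp w, rfl⟩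
  rw [← MulAction.orbit_eq_iff] at h5 hz ⊢
  rw [← h5, hz]

end Velocity

/-! ### Local primitives of the contraction -/

section Exactness

variable {n : ℕ} {E : Type*} [NormedAddCommGroup E] [NormedSpace ℂ E]
  {M : Type*} [TopologicalSpace M] [ChartedSpace E M]
  [MulAction (Fin n → ℂˣ) M] {Ω : BilinField E M}

/-- The one-form `- Ω (V, ·)`, with `V` generated by `b`, in the chart at `x`. -/
def contractCoord (Ω : BilinField E M) (b : Fin n → ℝ) (x : M) (y : E) : E →L[ℝ] ℝ :=
  -((pull Ω (actChart (n := n) x) (0, y) (imagVec b, 0)).comp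
    (ContinuousLinearMap.inr ℝ (Fin n → ℂ) E))

variable [IsManifold 𝓘(ℂ, E) ω M]

theorem IsToric.contractCoord_apply (hM : IsToric n E M) (b : Fin n → ℝ) (x : M) {y : E}
    (hy : y ∈ (chartAt E x).target) (v : E) :
    contractCoord Ω b x y v = - Ω ((chartAt E x).symm y) (torusField b ((chartAt E x).symm y))
      (rdiff E E (chartAt E x).symm y v) := by
  simp only [contractCoord, neg_apply, ContinuousLinearMap.comp_apply,
    ContinuousLinearMap.inr_apply, pull_apply, hM.rdiff_actChart_imagVec x hy,
    hM.rdiff_actChart_snd x hy]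
  simp [actChart, torusExp_zero]

theorem IsToric.contractCoord_contDiffAt (hM : IsToric n E M) (hΩ : IsKahler Ω) (b : Fin n → ℝ)
    (x : M) {y : E} (hy : y ∈ (chartAt E x).target) :
    ContDiffAt ℝ ∞ (contractCoord Ω b x) y := by
  have h1 : ContDiffAt ℝ ∞ (pull Ω (actChart (n := n) x)) (0, y) :=
    hΩ.pull_contDiffAt (hM.actChart_smooth x hy)
  have h2 : ContDiffAt ℝ ∞ (fun y : E => ((0 : Fin n → ℂ), y)) y :=
    contDiffAt_const.prodMk contDiffAt_id
  have h3 : ContDiffAt ℝ ∞ (fun y : E => pull Ω (actChart (n := n) x) (0, y)) y := h1.comp y h2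
  exact ((h3.clm_apply contDiffAt_const).clm_comp contDiffAt_const).neg

/-- This is closedness of the contraction. The action map on `ℂⁿ × E` straightens the generating
field to the constant vector `(imagVec b, 0)`, even at its zeros. The pulled back form is constant
in that direction, so Cartan's formula applies before restricting to `0 × E`. -/
theorem IsToric.contractCoord_symm (hM : IsToric n E M) (hΩ : IsKahler Ω)
    (hinv : TorusInvariantForm n Ω) (b : Fin n → ℝ)
    (x : M) {y : E} (hy : y ∈ (chartAt E x).target) (u v : E) :
    fderiv ℝ (contractCoord Ω b x) y u v = fderiv ℝ (contractCoord Ω b x) y v u := by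
  have hs := hM.actChart_smooth x (q := (0, y)) hy
  have h1 := (hΩ.pull_contDiffAt hs).differentiableAt (by simp)
  have h2 : HasFDerivAt (fun y : E => ((0 : Fin n → ℂ), y))
      (ContinuousLinearMap.inr ℝ (Fin n → ℂ) E) y :=
    (hasFDerivAt_const _ _).prodMk (hasFDerivAt_id y)
  have h3 := (hM.contractCoord_contDiffAt hΩ b x hy).differentiableAt (by simp)
  have key : ∀ u v, fderiv ℝ (contractCoord Ω b x) y u v
      = - fderiv ℝ (pull Ω (actChart (n := n) x)) (0, y) (0, u) (imagVec b, 0) (0, v) := by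
    intro u v
    rw [← fderiv_apply₁ h3]
    have h4 : HasFDerivAt (fun y : E => pull Ω (actChart (n := n) x) (0, y))
      ((fderiv ℝ (pull Ω (actChart (n := n) x)) (0, y)).comp
        (ContinuousLinearMap.inr ℝ (Fin n → ℂ) E)) y := h1.hasFDerivAt.comp y h2
    have h5 := ((h4.clm_apply (hasFDerivAt_const (imagVec b, (0 : E)) y)).clm_apply
      (hasFDerivAt_const ((0 : Fin n → ℂ), v) y)).neg
    have h6 : (fun y => contractCoord Ω b x y v)
      = -(fun y => pull Ω (actChart (n := n) x) (0, y) (imagVec b, 0) (0, v)) := rfl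
    rw [h6, h5.fderiv]
    simp
  rw [key, key, hΩ.pull_contract_symm hs]
  intro s
  rw [Prod.smul_mk, ← imagVec_smul, smul_zero]
  refine hM.pull_translate hinv (c := s • b) (hs.mdifferentiableAt (by simp)) fun w => ?_
  simp only [actChart, Prod.fst_add, Prod.snd_add, add_zero]
  rw [add_comm, torusExp_add, mul_smul]

/-- Local primitives of the contraction. -/
theorem IsToric.exists_local_potential (hM : IsToric n E M) (hΩ : IsKahler Ω)
    (hinv : TorusInvariantForm n Ω) (b : Fin n → ℝ) (x : M) {B : Set E} (hB : Convex ℝ B)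
    (hBo : IsOpen B) (hBt : B ⊆ (chartAt E x).target) :
    ∃ h : E → ℝ, ∀ y ∈ B, HasFDerivAt h (contractCoord Ω b x y) y := by
  obtain ⟨h, hh⟩ := Convex.exists_forall_hasFDerivAt_of_fderiv_symmetric hB hBo
    (fun y hy => ((hM.contractCoord_contDiffAt hΩ b x (hBt hy)).differentiableAt
      (by simp)).differentiableWithinAt)
    (fun y hy u v => hM.contractCoord_symm hΩ hinv b x (hBt hy) u v)
  exact ⟨h, hh⟩

theorem rdiff_mul_chartAt_eq {f : M → ℝ} {x p : M} (hp : p ∈ (chartAt E x).source)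
    {L : E →L[ℝ] ℝ} (h : HasFDerivAt (f ∘ (chartAt E x).symm) L (chartAt E x p)) :
    MDifferentiableAt 𝓘(ℝ, E) 𝓘(ℝ, ℝ) f p ∧
      rdiff E ℝ f p = L.comp (rdiff E E (chartAt E x) p) := by
  have h1 : f =ᶠ[𝓝 p] (f ∘ (chartAt E x).symm) ∘ chartAt E x := by
    filter_upwards [(chartAt E x).open_source.mem_nhds hp] with q hq
    simp [(chartAt E x).left_inv hq]
  have h2 := h.differentiableAt.mdifferentiableAt
  have h3 := chartAt_mdiff x hp
  refine ⟨(h2.comp p h3).congr_of_eventuallyEq h1, ?_⟩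
  rw [rdiff_congr h1, rdiff_comp p h2 h3, rdiff_eq_fderiv, h.fderiv]

theorem IsToric.contractCoord_comp (hM : IsToric n E M) (b : Fin n → ℝ) {x p : M}
    (hp : p ∈ (chartAt E x).source) :
    (contractCoord Ω b x (chartAt E x p)).comp (rdiff E E (chartAt E x) p)
      = - Ω p (torusField b p) := by
  ext v
  have hv : rdiff E E (chartAt E x).symm (chartAt E x p) (rdiff E E (chartAt E x) p v) = v :=
    DFunLike.congr_fun (rdiff_chartAt_symm_comp x hp) v
  rw [ContinuousLinearMap.comp_apply, hM.contractCoord_apply b x ((chartAt E x).map_source hp),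
    hv, (chartAt E x).left_inv hp]
  rfl

variable [FiniteDimensional ℂ E] [T2Space M]

/-- The potential along the dense orbit, in a chart. -/
theorem IsToric.hasFDerivAt_orbit_potential (hM : IsToric n E M) {p : M}
    (hp : Dense (MulAction.orbit (Fin n → ℂˣ) p)) {b : Fin n → ℝ} {f : M → ℝ}
    (hf : ∀ w, HasFDerivAt (fun w => f (orbitMap p w)) (-(pull Ω (orbitMap p) w (imagVec b))) w)
    (x : M) {y : E} (hy : y ∈ (chartAt E x).target)
    (hU : (chartAt E x).symm y ∈ MulAction.orbit (Fin n → ℂˣ) p) :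
    HasFDerivAt (f ∘ (chartAt E x).symm) (contractCoord Ω b x y) y := by
  obtain ⟨w₀, hw₀⟩ := mem_orbit_iff_orbitMap.1 hU
  set q := (chartAt E x).symm y with hq
  have hqd : Dense (MulAction.orbit (Fin n → ℂˣ) q) := by
    rwa [MulAction.orbit_eq_iff.2 hU]
  have hinj := hM.velocity_injective x hy hqd
  have hdim : Module.finrank ℂ (Fin n → ℂ) = Module.finrank ℂ E := by
    rw [hM.finrank_eq, Module.finrank_fin_fun]
  -- On the dense orbit the infinitesimal action is an isomorphism. The orbit map of `q` is
  -- therefore a local parametrisation, and its local inverse carries the derivative on `ℂⁿ` to the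
  -- chart.
  let e : (Fin n → ℂ) ≃L[ℂ] E :=
    (LinearMap.linearEquivOfInjective (velocity n x y).toLinearMap hinj hdim).toContinuousLinearEquiv
  have he : (e : (Fin n → ℂ) →L[ℂ] E) = velocity n x y := by
    ext v
    rfl
  let eR : (Fin n → ℂ) ≃L[ℝ] E := (e.toLinearEquiv.restrictScalars ℝ).toContinuousLinearEquiv
  let χ : (Fin n → ℂ) → E := chartAt E x ∘ orbitMap q
  have hχ0 : χ 0 = y := by
    simp [χ, orbitMap_zero, hq, (chartAt E x).right_inv hy]
  have hχ : HasStrictFDerivAt χ (eR : (Fin n → ℂ) →L[ℝ] E) 0 := by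
    have h1 := hM.hasStrictFDerivAt_velocity x hy
    rw [← he] at h1
    exact h1.restrictScalars ℝ
  have hF : HasFDerivAt (fun w => f (orbitMap q w)) ((contractCoord Ω b x y).comp
      (eR : (Fin n → ℂ) →L[ℝ] E)) 0 := by
    have h1 : (fun w => f (orbitMap q w)) = (fun w => f (orbitMap p w)) ∘ fun w => w₀ + w := by
      ext w
      simp only [Function.comp_apply, orbitMap_add', hw₀]
    have h2 : HasFDerivAt (fun w : Fin n → ℂ => w₀ + w) (ContinuousLinearMap.id ℝ _) 0 :=
      (hasFDerivAt_id _).const_add w₀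
    rw [h1]
    have h3 := (hf (w₀ + 0)).comp 0 h2
    refine h3.congr_fderiv ?_
    ext v
    have h4 : rdiff (Fin n → ℂ) E (orbitMap p) w₀ v =
        rdiff (Fin n → ℂ) E (orbitMap (n := n) q) 0 v := by
      rw [← rdiff_line (hM.orbitMap_mdiff p w₀), ← rdiff_line (hM.orbitMap_mdiff q 0)]
      simp only [orbitMap_add', hw₀, orbitMap_zero]
    have h5 : (eR : (Fin n → ℂ) →L[ℝ] E) v = velocity n x y v := by rw [← he]; rfl
    rw [ContinuousLinearMap.comp_apply, ContinuousLinearMap.comp_apply, h5,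
      hM.contractCoord_apply b x hy, ← hM.rdiff_orbitMap_eq_velocity x hy, add_zero]
    simp only [ContinuousLinearMap.id_apply, neg_apply, pull_apply, hM.rdiff_orbitMap_imagVec,
      h4, hw₀]
    rfl
  have hloc := hχ.to_localInverse
  have hinv0 : hχ.localInverse χ eR 0 (χ 0) = 0 := hχ.localInverse_apply_image
  have h6 : HasFDerivAt ((fun w => f (orbitMap q w)) ∘ hχ.localInverse χ eR 0)
      (((contractCoord Ω b x y).comp (eR : (Fin n → ℂ) →L[ℝ] E)).comp
        (eR.symm : E →L[ℝ] (Fin n → ℂ))) (χ 0) :=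
    HasFDerivAt.comp _ (by rw [hinv0]; exact hF) hloc.hasFDerivAt
  rw [hχ0] at h6
  have h7 : ((contractCoord Ω b x y).comp (eR : (Fin n → ℂ) →L[ℝ] E)).comp
        (eR.symm : E →L[ℝ] (Fin n → ℂ)) = contractCoord Ω b x y := by
    ext v; simp
  rw [h7] at h6
  refine h6.congr_of_eventuallyEq ?_
  have h8 := hχ.eventually_right_inverse
  have h9 : ∀ᶠ z in 𝓝 (χ 0), orbitMap q (hχ.localInverse χ eR 0 z) ∈ (chartAt E x).source := by
    have h10 : Filter.Tendsto (fun z => orbitMap q (hχ.localInverse χ eR 0 z)) (𝓝 (χ 0)) (𝓝 q) := by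
      have h11 := hχ.localInverse_continuousAt
      have h12 := (hM.orbitMap_smooth q 0).continuousAt
      rw [ContinuousAt, hinv0] at h11
      rw [ContinuousAt, orbitMap_zero] at h12
      exact h12.comp h11
    exact h10 ((chartAt E x).open_source.mem_nhds ((chartAt E x).map_target hy))
  rw [hχ0] at h8 h9
  filter_upwards [h8, h9] with z hz hz'
  have h13 : (chartAt E x).symm z = orbitMap q (hχ.localInverse χ eR 0 z) := by
    conv_lhs => rw [← hz]
    exact (chartAt E x).left_inv hz'
  simp only [Function.comp_apply, h13]

end Exactness

/-! ### Gluing to a global potential -/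

section Gluing

variable {n : ℕ} {E : Type*} [NormedAddCommGroup E] [NormedSpace ℂ E] [FiniteDimensional ℂ E]
  {M : Type*} [TopologicalSpace M] [ChartedSpace E M] [IsManifold 𝓘(ℂ, E) ω M] [T2Space M]
  [MulAction (Fin n → ℂˣ) M] {Ω : BilinField E M}

/-- A local primitive differs from the potential along the dense orbit by a constant, as the dense
orbit is the complement of the zero set of a holomorphic function. -/
theorem IsToric.orbit_potential_sub_eq (hM : IsToric n E M) {p : M}
    (hp : Dense (MulAction.orbit (Fin n → ℂˣ) p)) {b : Fin n → ℝ} {f : M → ℝ}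
    (hf : ∀ w, HasFDerivAt (fun w => f (orbitMap p w)) (-(pull Ω (orbitMap p) w (imagVec b))) w)
    (x : M) {B : Set E} (hB : Convex ℝ B) (hBo : IsOpen B) (hBt : B ⊆ (chartAt E x).target)
    {h : E → ℝ} (hh : ∀ y ∈ B, HasFDerivAt h (contractCoord Ω b x y) y)
    {y₀ y₁ : E} (hy₀ : y₀ ∈ B) (hy₁ : y₁ ∈ B)
    (hU₀ : (chartAt E x).symm y₀ ∈ MulAction.orbit (Fin n → ℂˣ) p)
    (hU₁ : (chartAt E x).symm y₁ ∈ MulAction.orbit (Fin n → ℂˣ) p) :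
    f ((chartAt E x).symm y₀) - h y₀ = f ((chartAt E x).symm y₁) - h y₁ := by
  have hdim : Module.finrank ℂ E = Module.finrank ℂ (Fin n → ℂ) := by
    rw [hM.finrank_eq, Module.finrank_fin_fun]
  let e : E ≃L[ℂ] (Fin n → ℂ) := ContinuousLinearEquiv.ofFinrankEq hdim
  have hdet : ∀ y ∈ B, (chartAt E x).symm y ∈ MulAction.orbit (Fin n → ℂˣ) p →
      velocityDet n e x y ≠ 0 := by
    intro y hy hU
    rw [velocityDet_ne_zero_iff]
    have hinj := hM.velocity_injective x (hBt hy) (by rwa [MulAction.orbit_eq_iff.2 hU])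
    exact ⟨hinj, (LinearMap.injective_iff_surjective_of_finrank_eq_finrank
      (f := (velocity n x y).toLinearMap) hdim.symm).1 hinj⟩
  -- Restriction to the complex line through both points reduces the claim to one variable. The
  -- determinant is nonzero at `ζ = 0` and `ζ = 1`; wherever it is nonzero the point lies in the
  -- dense orbit and the two primitives have equal derivatives.
  let ℓ : ℂ → E := fun ζ => y₀ + ζ • (y₁ - y₀)
  have hℓ : ∀ ζ, HasFDerivAt ℓ ((1 : ℂ →L[ℂ] ℂ).smulRight (y₁ - y₀)) ζ := fun ζ =>
    ((hasFDerivAt_id ζ).smul_const (y₁ - y₀)).const_add y₀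
  have hℓc : Continuous ℓ := by fun_prop
  have hD : IsOpen (ℓ ⁻¹' B) := hBo.preimage hℓc
  have hconv : Convex ℝ (ℓ ⁻¹' B) := by
    intro s hs t ht u v hu hv huv
    have h1 : ℓ (u • s + v • t) = u • ℓ s + v • ℓ t := by
      have : y₀ = u • y₀ + v • y₀ := by rw [← add_smul, huv, one_smul]
      simp only [ℓ]
      generalize y₁ - y₀ = d
      conv_lhs => rw [this]
      simp only [add_smul, smul_add, smul_assoc]
      abel
    rw [Set.mem_preimage, h1]
    exact hB hs ht hu hv huv
  have hℓ0 : ℓ 0 = y₀ := by simp [ℓ]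
  have hℓ1 : ℓ 1 = y₁ := by simp [ℓ]
  have hg : DifferentiableOn ℂ (fun ζ => velocityDet n e x (ℓ ζ)) (ℓ ⁻¹' B) := fun ζ hζ =>
    ((hM.velocityDet_differentiableAt e x (hBt hζ)).comp ζ
      (hℓ ζ).differentiableAt).differentiableWithinAt
  have key := eq_of_hasFDerivAt_zero_off_zeros hD hconv hg
    (u := fun ζ => f ((chartAt E x).symm (ℓ ζ)) - h (ℓ ζ)) ?_ (by simpa [hℓ0] using hy₀)
    (by simpa [hℓ1] using hy₁) (by simpa [hℓ0] using hdet y₀ hy₀ hU₀)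
    (by simpa [hℓ1] using hdet y₁ hy₁ hU₁)
  · simpa only [hℓ0, hℓ1] using key
  · intro ζ hζ hne
    have hU := hM.mem_orbit_of_surjective hp x (hBt hζ)
      ((velocityDet_ne_zero_iff e x (ℓ ζ)).1 hne).2
    have h1 := (hM.hasFDerivAt_orbit_potential hp hf x (hBt hζ) hU).sub (hh _ hζ)
    rw [sub_self] at h1
    have h2 := h1.comp ζ ((hℓ ζ).restrictScalars ℝ)
    rw [ContinuousLinearMap.zero_comp] at h2
    exact h2

/-- A closed contraction that vanishes along the orbits of the real torus has a global
potential. -/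
theorem IsToric.exists_potential (hM : IsToric n E M) (hΩ : IsKahler Ω)
    (hinv : TorusInvariantForm n Ω) {p : M} (hp : Dense (MulAction.orbit (Fin n → ℂˣ) p))
    {b : Fin n → ℝ} (h0 : ∀ c : Fin n → ℝ, Ω p (torusField b p) (torusField c p) = 0) :
    ∃ f : M → ℝ, ContMDiff 𝓘(ℝ, E) 𝓘(ℝ, ℝ) ∞ f ∧ TorusInvariant n f ∧
      ∀ q, rdiff E ℝ f q = - Ω q (torusField b q) := by
  obtain ⟨fU, hfU, hfUinv⟩ := hM.exists_orbit_potential hΩ hinv hp h0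
  set U := MulAction.orbit (Fin n → ℂˣ) p
  have hball : ∀ x : M, ∃ r > 0, Metric.ball (chartAt E x x) r ⊆ (chartAt E x).target := fun x =>
    Metric.isOpen_iff.1 (chartAt E x).open_target _
      ((chartAt E x).map_source (mem_chart_source E x))
  choose r hr hrt using hball
  have hloc : ∀ x : M, ∃ g : E → ℝ, ∀ y ∈ Metric.ball (chartAt E x x) (r x),
      HasFDerivAt g (contractCoord Ω b x y) y ∧
      ((chartAt E x).symm y ∈ U → fU ((chartAt E x).symm y) = g y) := by
    intro x
    obtain ⟨h, hh⟩ := hM.exists_local_potential hΩ hinv b x (convex_ball (chartAt E x x) (r x))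
      Metric.isOpen_ball (hrt x)
    have hopen : IsOpen ((chartAt E x).source ∩
        chartAt E x ⁻¹' Metric.ball (chartAt E x x) (r x)) :=
      (chartAt E x).isOpen_inter_preimage Metric.isOpen_ball
    obtain ⟨q, ⟨hq1, hq2⟩, hqU⟩ := hp.inter_open_nonempty _ hopen
      ⟨x, mem_chart_source E x, Metric.mem_ball_self (hr x)⟩
    -- The constant is fixed by matching the orbit potential at one point `q` of the orbit; it then
    -- matches at all points of the orbit in the ball.
    refine ⟨fun y => h y + (fU q - h (chartAt E x q)), fun y hy => ⟨(hh y hy).add_const _, ?_⟩⟩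
    intro hyU
    have := hM.orbit_potential_sub_eq hp hfU x (convex_ball (chartAt E x x) (r x))
      Metric.isOpen_ball (hrt x) hh hy hq2 hyU (by rwa [(chartAt E x).left_inv hq1])
    rw [(chartAt E x).left_inv hq1] at this
    linarith
  choose g hg using hloc
  let W : M → Set M := fun x =>
    (chartAt E x).source ∩ chartAt E x ⁻¹' Metric.ball (chartAt E x x) (r x)
  have hW : ∀ x, IsOpen (W x) := fun x => (chartAt E x).isOpen_inter_preimage Metric.isOpen_ball
  have hxW : ∀ x, x ∈ W x := fun x => ⟨mem_chart_source E x, Metric.mem_ball_self (hr x)⟩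
  have hgc : ∀ x, ∀ q ∈ W x, ContinuousAt (fun q => g x (chartAt E x q)) q := fun x q hq =>
    ((hg x _ hq.2).1.continuousAt).comp ((chartAt E x).continuousAt hq.1)
  have hgU : ∀ x, ∀ q ∈ W x, q ∈ U → fU q = g x (chartAt E x q) := by
    intro x q hq hqU
    have := (hg x _ hq.2).2 (by rwa [(chartAt E x).left_inv hq.1])
    rwa [(chartAt E x).left_inv hq.1] at this
  let f : M → ℝ := fun x => g x (chartAt E x x)
  have hfg : ∀ x, ∀ q ∈ W x, f q = g x (chartAt E x q) := by
    intro x q hq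
    -- The local primitives centred at `x` and at `q` both equal `fU` on the dense orbit near `q`,
    -- so by continuity they agree at `q`.
    have hne : (𝓝[U] q).NeBot := mem_closure_iff_nhdsWithin_neBot.1 (hp q)
    have h1 : Filter.Tendsto (fun q => g x (chartAt E x q)) (𝓝[U] q) (𝓝 (g x (chartAt E x q))) :=
      (hgc x q hq).mono_left nhdsWithin_le_nhds
    have h2 : Filter.Tendsto (fun q' => g q (chartAt E q q')) (𝓝[U] q) (𝓝 (f q)) :=
      (hgc q q (hxW q)).mono_left nhdsWithin_le_nhds
    refine tendsto_nhds_unique h2 (h1.congr' ?_)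
    filter_upwards [self_mem_nhdsWithin, mem_nhdsWithin_of_mem_nhds ((hW x).mem_nhds hq),
      mem_nhdsWithin_of_mem_nhds ((hW q).mem_nhds (hxW q))] with q' h3 h4 h5
    rw [← hgU x q' h4 h3, ← hgU q q' h5 h3]
  have hfd : ∀ x, HasFDerivAt (f ∘ (chartAt E x).symm) (contractCoord Ω b x (chartAt E x x))
      (chartAt E x x) := by
    intro x
    refine (hg x _ (Metric.mem_ball_self (hr x))).1.congr_of_eventuallyEq ?_
    filter_upwards [Metric.ball_mem_nhds _ (hr x)] with y hy
    have hyt := hrt x hy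
    have hyW : (chartAt E x).symm y ∈ W x :=
      ⟨(chartAt E x).map_target hyt, by rwa [Set.mem_preimage, (chartAt E x).right_inv hyt]⟩
    rw [Function.comp_apply, hfg x _ hyW, (chartAt E x).right_inv hyt]
  have hsm : ContMDiff 𝓘(ℝ, E) 𝓘(ℝ, ℝ) ∞ f := by
    intro x
    have h1 : ContDiffOn ℝ ∞ (g x) (Metric.ball (chartAt E x x) (r x)) := by
      rw [contDiffOn_infty_iff_fderiv_of_isOpen Metric.isOpen_ball]
      refine ⟨fun y hy => (hg x y hy).1.differentiableAt.differentiableWithinAt, ?_⟩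
      refine ContDiffOn.congr (f := contractCoord Ω b x) ?_ fun y hy => (hg x y hy).1.fderiv
      exact fun y hy => (hM.contractCoord_contDiffAt hΩ b x (hrt x hy)).contDiffWithinAt
    have h2 : ContMDiffAt 𝓘(ℝ, E) 𝓘(ℝ, ℝ) ∞ (g x) (chartAt E x x) :=
      (h1.contDiffAt (Metric.ball_mem_nhds _ (hr x))).contMDiffAt
    have h3 : ContMDiffAt 𝓘(ℝ, E) 𝓘(ℝ, E) ∞ (chartAt E x) x :=
      contMDiffOn_chart.contMDiffAt ((chartAt E x).open_source.mem_nhds (mem_chart_source E x))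
    refine (h2.comp x h3).congr_of_eventuallyEq ?_
    filter_upwards [(hW x).mem_nhds (hxW x)] with q hq using hfg x q hq
  refine ⟨f, hsm, ?_, ?_⟩
  · intro t q
    obtain ⟨c, hc⟩ := exists_torusExp_eq_realTorus t
    rw [← hc]
    have hfU' : ∀ w, f (orbitMap p w) = fU (orbitMap p w) := fun w =>
      (hgU _ _ (hxW _) ⟨torusExp w, rfl⟩).symm
    -- Invariance holds on the dense orbit, where the primitive is constant in imaginary directions,
    -- and extends by continuity.
    have : (fun q => f (torusExp (imagVec c) • q)) = f := by
      apply Continuous.ext_on hp (hsm.continuous.comp (hM.continuous_smul _)) hsm.continuous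
      intro q hq
      obtain ⟨w, rfl⟩ := mem_orbit_iff_orbitMap.1 hq
      simp only [Function.comp_apply, ← orbitMap_add, hfU']
      rw [add_comm, hfUinv]
    exact congrFun this q
  · intro q
    rw [(rdiff_mul_chartAt_eq (mem_chart_source E q) (hfd q)).2,
      hM.contractCoord_comp b (mem_chart_source E q)]

end Gluing

/-! ### The potential and the Kähler form of the cone -/

section Cone

/-- The function `|z|^{2a}`. -/
def conePot (a : ℝ) (z : ℂ) : ℝ := ‖z‖ ^ (2 * a)

theorem conePot_eq (a : ℝ) (z : ℂ) : conePot a z = (‖z‖ ^ 2) ^ a := by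
  rw [conePot, Real.rpow_mul (norm_nonneg z), Real.rpow_two]

theorem radius_sq {D : Type*} (a : ℝ) (q : ℂ × D) : radius a q ^ 2 = conePot a q.1 := by
  rw [radius, conePot, mul_comm, Real.rpow_mul (norm_nonneg _), Real.rpow_two]

variable {a : ℝ} {z : ℂ}

theorem conePot_hasFDerivAt (hz : z ≠ 0 ∨ a = 1) :
    HasFDerivAt (conePot a) ((2 * a * (‖z‖ ^ 2) ^ (a - 1)) • innerSL ℝ z) z := by
  have h1 : HasFDerivAt (fun w : ℂ => ‖w‖ ^ 2) (2 • (innerSL ℝ z)) z :=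
    (hasStrictFDerivAt_norm_sq z).hasFDerivAt
  have h2 := h1.rpow_const (p := a) (by
    rcases hz with hz | rfl
    · left; simpa using hz
    · right; exact le_rfl)
  have h3 : conePot a = fun w : ℂ => (‖w‖ ^ 2) ^ a := funext (conePot_eq a)
  rw [h3]
  refine h2.congr_fderiv ?_
  ext v
  simp
  ring

theorem conePot_contDiffAt (hz : z ≠ 0 ∨ a = 1) : ContDiffAt ℝ ∞ (conePot a) z := by
  have h3 : conePot a = fun w : ℂ => (‖w‖ ^ 2) ^ a := funext (conePot_eq a)
  rw [h3]
  rcases hz with hz | rfl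
  · exact (contDiff_norm_sq ℝ).contDiffAt.rpow_const_of_ne (by simpa using hz)
  · simp only [Real.rpow_one]
    exact (contDiff_norm_sq ℝ).contDiffAt

theorem eventually_ne_zero_or_eq_one (hz : z ≠ 0 ∨ a = 1) : ∀ᶠ w in 𝓝 z, w ≠ 0 ∨ a = 1 := by
  rcases hz with hz | hz
  · filter_upwards [isOpen_ne.mem_nhds hz] with w hw using Or.inl hw
  · exact Filter.Eventually.of_forall fun _ => Or.inr hz

theorem fderiv_conePot_self (hz : z ≠ 0 ∨ a = 1) : fderiv ℝ (conePot a) z z = 2 * a * conePot a z := by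
  rw [(conePot_hasFDerivAt hz).fderiv, conePot_eq]
  simp only [smul_apply, innerSL_apply_apply, real_inner_self_eq_norm_sq, smul_eq_mul]
  rcases hz with hz | rfl
  · have h : 0 < ‖z‖ ^ 2 := by positivity
    rw [mul_assoc, ← Real.rpow_add_one h.ne', sub_add_cancel]
  · simp

theorem fderiv_conePot_I (hz : z ≠ 0 ∨ a = 1) : fderiv ℝ (conePot a) z (Complex.I * z) = 0 := by
  rw [(conePot_hasFDerivAt hz).fderiv]
  have : inner ℝ z (Complex.I * z) = 0 := by
    rw [Complex.inner]
    simp [Complex.mul_re, Complex.mul_im]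
    ring
  simp [this]

/-- Euler's identity for the homogeneous function `D |z|^{2a}`. -/
theorem fderiv_fderiv_conePot_self (hz : z ≠ 0 ∨ a = 1) (v : ℂ) :
    fderiv ℝ (fderiv ℝ (conePot a)) z v z = (2 * a - 1) * fderiv ℝ (conePot a) z v := by
  have hd := (((conePot_contDiffAt hz).fderiv_right (m := ∞) (by simp)).differentiableAt
    (by simp)).hasFDerivAt
  have h1 := hd.clm_apply (hasFDerivAt_id z)
  have h2 := (conePot_hasFDerivAt hz).differentiableAt.hasFDerivAt.const_mul (2 * a)
  have h3 := h2.congr_of_eventuallyEq (f₁ := fun w => fderiv ℝ (conePot a) w (id w)) (by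
    filter_upwards [eventually_ne_zero_or_eq_one hz] with w hw using fderiv_conePot_self hw)
  have h4 := DFunLike.congr_fun (h1.unique h3) v
  simp at h4
  linarith

/-- The derivative of the rotation invariance of `|z|^{2a}`. -/
theorem fderiv_fderiv_conePot_I (hz : z ≠ 0 ∨ a = 1) (v : ℂ) :
    fderiv ℝ (fderiv ℝ (conePot a)) z v (Complex.I * z)
      = - fderiv ℝ (conePot a) z (Complex.I * v) := by
  have hd := (((conePot_contDiffAt hz).fderiv_right (m := ∞) (by simp)).differentiableAt
    (by simp)).hasFDerivAt
  have hI : HasFDerivAt (fun w : ℂ => Complex.I * id w)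
      (Complex.I • ContinuousLinearMap.id ℝ ℂ) z := (hasFDerivAt_id z).const_mul Complex.I
  have h1 := hd.clm_apply hI
  have h3 := (hasFDerivAt_const (𝕜 := ℝ) (0 : ℝ) z).congr_of_eventuallyEq
    (f₁ := fun w => fderiv ℝ (conePot a) w (Complex.I * id w)) (by
    filter_upwards [eventually_ne_zero_or_eq_one hz] with w hw using fderiv_conePot_I hw)
  have h4 := DFunLike.congr_fun (h1.unique h3) v
  simp at h4
  linarith

theorem coneForm_apply (a : ℝ) (z u v : ℂ) : coneForm a z u v = 1 / 4 *
    (fderiv ℝ (fderiv ℝ (conePot a)) z v (Complex.I * u)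
      - fderiv ℝ (fderiv ℝ (conePot a)) z u (Complex.I * v)) := by
  have : (fun w : ℂ => ‖w‖ ^ (2 * a)) = conePot a := rfl
  simp [coneForm, flatDdbar, J, this]
  ring

/-- The contraction of the cone form with `J (r ∂_r)` is `- d (r²/2)`. -/
theorem coneForm_radial (ha : a ≠ 0) (hz : z ≠ 0 ∨ a = 1) (v : ℂ) :
    coneForm a z (Complex.I * ((1 / a : ℝ) • z)) v = - (1 / 2) * fderiv ℝ (conePot a) z v := by
  have hsym : ∀ u v, fderiv ℝ (fderiv ℝ (conePot a)) z u v
      = fderiv ℝ (fderiv ℝ (conePot a)) z v u := fun u v =>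
    ((conePot_contDiffAt hz).isSymmSndFDerivAt (by simpa using ENat.LEInfty.out)).eq u v
  have e1 : Complex.I * (Complex.I * ((1 / a : ℝ) • z)) = (-(1 / a) : ℝ) • z := by
    rw [← mul_assoc, Complex.I_mul_I]
    simp
  have e2 : Complex.I * ((1 / a : ℝ) • z) = (1 / a : ℝ) • (Complex.I * z) := by
    rw [mul_smul_comm]
  rw [coneForm_apply, e1, e2, map_smul, map_smul, smul_apply, hsym (Complex.I * z),
    fderiv_fderiv_conePot_self hz, fderiv_fderiv_conePot_I hz, ← mul_assoc, Complex.I_mul_I]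
  simp only [neg_mul, one_mul, map_neg, smul_eq_mul]
  field_simp
  ring

/-- The cone form degenerates at the origin unless `a = 1`. -/
theorem coneForm_zero (ha1 : a ≠ 1) : coneForm a 0 = 0 := by
  -- Homogeneity gives `4 D²φ (0) = 2^{2a} D²φ (0)`. The scaling rules for `fderiv` hold without
  -- differentiability, so this covers the case in which the derivative at the apex is a default
  -- value.
  have hscale : ∀ w, conePot a ((2 : ℝ) • w) = (2 : ℝ) ^ (2 * a) * conePot a w := by
    intro w
    rw [conePot, conePot, norm_smul, Real.mul_rpow (norm_nonneg _) (norm_nonneg _)]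
    simp
  have h1 : ∀ w, (2 : ℝ) • fderiv ℝ (conePot a) ((2 : ℝ) • w)
      = (2 : ℝ) ^ (2 * a) • fderiv ℝ (conePot a) w := by
    intro w
    have e : (fun w => conePot a ((2 : ℝ) • w)) = (2 : ℝ) ^ (2 * a) • conePot a := funext hscale
    rw [← fderiv_comp_smul, e, fderiv_const_smul_field]
    rfl
  have h2 : (2 : ℝ) • (2 : ℝ) • fderiv ℝ (fderiv ℝ (conePot a)) ((2 : ℝ) • (0 : ℂ))
      = (2 : ℝ) ^ (2 * a) • fderiv ℝ (fderiv ℝ (conePot a)) 0 := by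
    have e : (2 : ℝ) • (fun w => fderiv ℝ (conePot a) ((2 : ℝ) • w))
        = (2 : ℝ) ^ (2 * a) • fderiv ℝ (conePot a) := funext h1
    have e1 := congrFun (fderiv_const_smul_field (𝕜 := ℝ) (f := fun w : ℂ =>
      fderiv ℝ (conePot a) ((2 : ℝ) • w)) (2 : ℝ)) 0
    have e2 := congrFun (fderiv_const_smul_field (𝕜 := ℝ) (f := fderiv ℝ (conePot a))
      ((2 : ℝ) ^ (2 * a))) 0
    rw [e, e2] at e1
    rw [← fderiv_comp_smul]
    exact e1.symm
  have h3 : fderiv ℝ (fderiv ℝ (conePot a)) 0 = 0 := by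
    rw [smul_zero, smul_smul] at h2
    have h4 : ((2 : ℝ) * 2 - (2 : ℝ) ^ (2 * a)) • fderiv ℝ (fderiv ℝ (conePot a)) 0 = 0 := by
      have h5 := sub_smul ((2 : ℝ) * 2) ((2 : ℝ) ^ (2 * a)) (fderiv ℝ (fderiv ℝ (conePot a)) 0)
      rw [h5, h2, sub_self]
    rcases smul_eq_zero.1 h4 with h5 | h5
    · exfalso
      have h6 : (2 : ℝ) ^ (2 : ℝ) = (2 : ℝ) ^ (2 * a) := by
        rw [Real.rpow_two]; linarith
      have := (Real.rpow_right_inj (by norm_num) (by norm_num)).1 h6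
      apply ha1
      linarith
    · exact h5
  ext u v
  rw [coneForm_apply, h3]
  simp

end Cone

/-! ### The end of `M` seen through `ν` -/

section ModelAtInfinity

variable {F : Type*} [NormedAddCommGroup F] [NormedSpace ℂ F]
  {D : Type*} [TopologicalSpace D] [ChartedSpace F D]
  {E : Type*} [NormedAddCommGroup E] [NormedSpace ℂ E]
  {M : Type*} [TopologicalSpace M] [ChartedSpace E M]
  {a : ℝ} {ΩD : BilinField F D} {Ω : BilinField E M} {X : VField E M}
  {K : Set M} {K' : Set (ℂ × D)} {ν : OpenPartialHomeomorph M (ℂ × D)}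

namespace IsModelAtInfinity

theorem isOpen_compl (hν : IsModelAtInfinity a ΩD Ω X K K' ν) : IsOpen Kᶜ :=
  hν.source_eq ▸ ν.open_source

theorem map_notMem (hν : IsModelAtInfinity a ΩD Ω X K K' ν) {p : M} (hp : p ∉ K) :
    ν p ∉ K' := by
  have h : ν p ∈ ν.target := ν.map_source (by rw [hν.source_eq]; exact hp)
  rwa [hν.target_eq] at h

theorem symm_notMem (hν : IsModelAtInfinity a ΩD Ω X K K' ν) {q : ℂ × D} (hq : q ∉ K') :
    ν.symm q ∉ K := by
  have h : ν.symm q ∈ ν.source := ν.map_target (by rw [hν.target_eq]; exact hq)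
  rwa [hν.source_eq] at h

theorem left_inv (hν : IsModelAtInfinity a ΩD Ω X K K' ν) {p : M} (hp : p ∉ K) :
    ν.symm (ν p) = p := ν.left_inv (by rw [hν.source_eq]; exact hp)

theorem right_inv (hν : IsModelAtInfinity a ΩD Ω X K K' ν) {q : ℂ × D} (hq : q ∉ K') :
    ν (ν.symm q) = q := ν.right_inv (by rw [hν.target_eq]; exact hq)

theorem fst_holo (hν : IsModelAtInfinity a ΩD Ω X K K' ν) {p : M} (hp : p ∉ K) :
    ContMDiffAt 𝓘(ℂ, E) 𝓘(ℂ, ℂ) ω (fun p => (ν p).1) p :=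
  contMDiffAt_fst.comp p (hν.holomorphic.contMDiffAt (hν.isOpen_compl.mem_nhds hp))

theorem snd_holo (hν : IsModelAtInfinity a ΩD Ω X K K' ν) {p : M} (hp : p ∉ K) :
    ContMDiffAt 𝓘(ℂ, E) 𝓘(ℂ, F) ω (fun p => (ν p).2) p :=
  contMDiffAt_snd.comp p (hν.holomorphic.contMDiffAt (hν.isOpen_compl.mem_nhds hp))

theorem fst_mdiff (hν : IsModelAtInfinity a ΩD Ω X K K' ν) {p : M} (hp : p ∉ K) :
    MDifferentiableAt 𝓘(ℝ, E) 𝓘(ℝ, ℂ) (fun p => (ν p).1) p :=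
  mdifferentiableAt_real ((hν.fst_holo hp).mdifferentiableAt (by simp))

theorem snd_mdiff (hν : IsModelAtInfinity a ΩD Ω X K K' ν) {p : M} (hp : p ∉ K) :
    MDifferentiableAt 𝓘(ℝ, E) 𝓘(ℝ, F) (fun p => (ν p).2) p :=
  mdifferentiableAt_real ((hν.snd_holo hp).mdifferentiableAt (by simp))

theorem prodTangentMapAt_eq (hν : IsModelAtInfinity a ΩD Ω X K K' ν) {p : M} (hp : p ∉ K)
    (u : E) : prodTangentMapAt (F := F) ν p u
      = (rdiff E ℂ (fun p => (ν p).1) p u, rdiff E F (fun p => (ν p).2) p u) := by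
  have h : prodTangentMapAt (F := F) ν p
      = (rdiff E ℂ (fun p => (ν p).1) p).prod (rdiff E F (fun p => (ν p).2) p) :=
    mfderiv_prodMk (hν.fst_mdiff hp) (hν.snd_mdiff hp)
  rw [h]
  rfl

theorem rdiff_fst_J (hν : IsModelAtInfinity a ΩD Ω X K K' ν) {p : M} (hp : p ∉ K) (u : E) :
    rdiff E ℂ (fun p => (ν p).1) p (J E u) = Complex.I * rdiff E ℂ (fun p => (ν p).1) p u := by
  rw [rdiff_J ((hν.fst_holo hp).mdifferentiableAt (by simp))]
  rfl

theorem rdiff_snd_J (hν : IsModelAtInfinity a ΩD Ω X K K' ν) {p : M} (hp : p ∉ K) (u : E) :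
    rdiff E F (fun p => (ν p).2) p (J E u) = J F (rdiff E F (fun p => (ν p).2) p u) :=
  rdiff_J ((hν.snd_holo hp).mdifferentiableAt (by simp)) u

theorem form_apply (hν : IsModelAtInfinity a ΩD Ω X K K' ν) {p : M} (hp : p ∉ K) (u v : E) :
    Ω p u v = coneForm a (ν p).1 (rdiff E ℂ (fun p => (ν p).1) p u)
        (rdiff E ℂ (fun p => (ν p).1) p v)
      + ΩD (ν p).2 (rdiff E F (fun p => (ν p).2) p u) (rdiff E F (fun p => (ν p).2) p v) := by
  rw [hν.pullback p hp, hν.prodTangentMapAt_eq hp, hν.prodTangentMapAt_eq hp]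
  rfl

theorem rdiff_fst_field (hν : IsModelAtInfinity a ΩD Ω X K K' ν) {p : M} (hp : p ∉ K) :
    rdiff E ℂ (fun p => (ν p).1) p (X p) = (1 / a : ℝ) • (ν p).1 := by
  have h := hν.map_field p hp
  rw [hν.prodTangentMapAt_eq hp] at h
  exact congrArg Prod.fst h

theorem rdiff_snd_field (hν : IsModelAtInfinity a ΩD Ω X K K' ν) {p : M} (hp : p ∉ K) :
    rdiff E F (fun p => (ν p).2) p (X p) = 0 := by
  have h := hν.map_field p hp
  rw [hν.prodTangentMapAt_eq hp] at h
  exact congrArg Prod.snd h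

/-- The differential of `ν` is a linear isomorphism. -/
theorem rdiff_bijective (hν : IsModelAtInfinity a ΩD Ω X K K' ν) (hΩ : IsKahler Ω)
    [FiniteDimensional ℂ F] [FiniteDimensional ℂ E]
    (hdim : Module.finrank ℂ F + 1 = Module.finrank ℂ E) {p : M} (hp : p ∉ K) :
    Function.Bijective ((rdiff E ℂ (fun p => (ν p).1) p).prod (rdiff E F (fun p => (ν p).2) p)) := by
  have hinj : Function.Injective
      ((rdiff E ℂ (fun p => (ν p).1) p).prod (rdiff E F (fun p => (ν p).2) p)) := by
    rw [injective_iff_map_eq_zero]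
    -- `Ω` is a pullback by the differential of `ν`, so a kernel vector would have zero length.
    intro u hu
    by_contra hne
    have h1 := hΩ.positive p u hne
    have hz : rdiff E ℂ (fun p => (ν p).1) p u = 0 := congrArg Prod.fst hu
    have hx : rdiff E F (fun p => (ν p).2) p u = 0 := congrArg Prod.snd hu
    rw [hν.form_apply hp, hz, hx] at h1
    simp at h1
  have : FiniteDimensional ℝ E := FiniteDimensional.complexToReal E
  have : FiniteDimensional ℝ F := FiniteDimensional.complexToReal F
  have hd : Module.finrank ℝ E = Module.finrank ℝ (ℂ × F) := by
    rw [Module.finrank_prod, finrank_real_of_complex E, finrank_real_of_complex F,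
      Complex.finrank_real_complex]
    omega
  exact ⟨hinj, (LinearMap.injective_iff_surjective_of_finrank_eq_finrank hd (f :=
    ((rdiff E ℂ (fun p => (ν p).1) p).prod
      (rdiff E F (fun p => (ν p).2) p) : E →L[ℝ] ℂ × F).toLinearMap)).1 hinj⟩

/-- The cone form is smooth at the points that occur. -/
theorem fst_ne_zero_or (hν : IsModelAtInfinity a ΩD Ω X K K' ν) (hΩ : IsKahler Ω)
    [FiniteDimensional ℂ F] [FiniteDimensional ℂ E]
    (hdim : Module.finrank ℂ F + 1 = Module.finrank ℂ E) {p : M} (hp : p ∉ K) :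
    (ν p).1 ≠ 0 ∨ a = 1 := by
  by_contra! hcon
  -- A vector pointing along the `ℂ` factor would have zero length at the apex, against positivity
  -- of `Ω`.
  obtain ⟨u, hu⟩ := (hν.rdiff_bijective hΩ hdim hp).2 ((1 : ℂ), (0 : F))
  have hz : rdiff E ℂ (fun p => (ν p).1) p u = 1 := congrArg Prod.fst hu
  have hx : rdiff E F (fun p => (ν p).2) p u = 0 := congrArg Prod.snd hu
  have hne : u ≠ 0 := by
    rintro rfl
    simp at hz
  have h1 := hΩ.positive p u hne
  rw [hν.form_apply hp, hx, hcon.1, coneForm_zero hcon.2] at h1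
  simp at h1

variable (a ν) in
/-- The model potential `r² / 2 - 1`. -/
def _root_.KahlerToric.modelPot (p : M) : ℝ := conePot a (ν p).1 / 2 - 1

theorem _root_.KahlerToric.modelPot_eq (a : ℝ) (ν : OpenPartialHomeomorph M (ℂ × D)) (p : M) :
    modelPot a ν p = radius a (ν p) ^ 2 / 2 - 1 := by
  rw [modelPot, radius_sq]

theorem _root_.KahlerToric.hasFDerivAt_half_conePot {z : ℂ} (hz : z ≠ 0 ∨ a = 1) :
    HasFDerivAt (fun z => conePot a z / 2 - 1) ((1 / 2 : ℝ) • fderiv ℝ (conePot a) z) z := by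
  have := ((conePot_hasFDerivAt hz).differentiableAt.hasFDerivAt.const_mul (1 / 2)).sub_const 1
  refine this.congr_of_eventuallyEq (Filter.Eventually.of_forall fun z => ?_)
  simp only
  ring

theorem modelPot_mdiff (hν : IsModelAtInfinity a ΩD Ω X K K' ν) {p : M} (hp : p ∉ K)
    (hz : (ν p).1 ≠ 0 ∨ a = 1) :
    MDifferentiableAt 𝓘(ℝ, E) 𝓘(ℝ, ℝ) (modelPot a ν) p :=
  (hasFDerivAt_half_conePot hz).differentiableAt.mdifferentiableAt.comp p (hν.fst_mdiff hp)

theorem rdiff_modelPot (hν : IsModelAtInfinity a ΩD Ω X K K' ν) {p : M} (hp : p ∉ K)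
    (hz : (ν p).1 ≠ 0 ∨ a = 1) (v : E) :
    rdiff E ℝ (modelPot a ν) p v
    = 1 / 2 * fderiv ℝ (conePot a) (ν p).1 (rdiff E ℂ (fun p => (ν p).1) p v) := by
  have h1 := hasFDerivAt_half_conePot hz
  have h2 := rdiff_comp (g := fun z => conePot a z / 2 - 1) p
    h1.differentiableAt.mdifferentiableAt (hν.fst_mdiff hp)
  have h3 : modelPot a ν = (fun z => conePot a z / 2 - 1) ∘ fun p => (ν p).1 := rfl
  rw [h3, h2, rdiff_eq_fderiv, h1.fderiv]
  rfl

/-- `X` has no component along `D`, so only the cone form contributes, and there the contraction is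
computed by `coneForm_radial`. -/
theorem contract_eq_rdiff (hν : IsModelAtInfinity a ΩD Ω X K K' ν) {p : M} (hp : p ∉ K)
    (hz : (ν p).1 ≠ 0 ∨ a = 1) (ha : a ≠ 0) (v : E) :
    - Ω p (J E (X p)) v = rdiff E ℝ (modelPot a ν) p v := by
  rw [hν.rdiff_modelPot hp hz, hν.form_apply hp, hν.rdiff_fst_J hp, hν.rdiff_snd_J hp,
    hν.rdiff_fst_field hp, hν.rdiff_snd_field hp, coneForm_radial ha hz]
  simp

theorem rdiff_modelPot_field (hν : IsModelAtInfinity a ΩD Ω X K K' ν) {p : M} (hp : p ∉ K)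
    (hz : (ν p).1 ≠ 0 ∨ a = 1) (ha : a ≠ 0) :
    rdiff E ℝ (modelPot a ν) p (X p) = conePot a (ν p).1 := by
  rw [hν.rdiff_modelPot hp hz, hν.rdiff_fst_field hp, map_smul, fderiv_conePot_self hz]
  simp only [smul_eq_mul]
  field_simp

/-- This expresses `r²` as the squared length of `X`, a quantity defined by torus-invariant data on
`M`. It is the only link between the model radius and the torus action. -/
theorem form_field (hν : IsModelAtInfinity a ΩD Ω X K K' ν) {p : M} (hp : p ∉ K)
    (hz : (ν p).1 ≠ 0 ∨ a = 1) (ha : a ≠ 0) (hΩ : IsKahler Ω) :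
    Ω p (X p) (J E (X p)) = conePot a (ν p).1 := by
  rw [hΩ.antisymm, hν.contract_eq_rdiff hp hz ha, hν.rdiff_modelPot_field hp hz ha]

end IsModelAtInfinity

end ModelAtInfinity

/-! ### The form `i ∂ ∂̄` of the model potential and its trace -/

section FlatDdbar

variable {E : Type*} [NormedAddCommGroup E] [NormedSpace ℂ E]

theorem flatDdbar_apply (φ : E → ℝ) (y u v : E) : flatDdbar φ y u v = 1 / 2 *
    (fderiv ℝ (fderiv ℝ φ) y v (Complex.I • u) - fderiv ℝ (fderiv ℝ φ) y u (Complex.I • v)) := by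
  simp [flatDdbar, J]

theorem flatDdbar_congr {φ ψ : E → ℝ} {y : E} (h : φ =ᶠ[𝓝 y] ψ) : flatDdbar φ y = flatDdbar ψ y := by
  unfold flatDdbar
  rw [h.fderiv.fderiv_eq]

/-- The form `i ∂ ∂̄` commutes with pullback by holomorphic functions. -/
theorem flatDdbar_comp {ψ : ℂ → ℝ} {ζ : E → ℂ} {y : E} (hψ : ContDiffAt ℝ ∞ ψ (ζ y))
    (hζ : ContDiffAt ℂ ω ζ y) (u v : E) :
    flatDdbar (ψ ∘ ζ) y u v = flatDdbar ψ (ζ y) (fderiv ℝ ζ y u) (fderiv ℝ ζ y v) := by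
  have hζ' : ContDiffAt ℝ ω ζ y := hζ.restrict_scalars ℝ
  have hζd : ∀ᶠ y in 𝓝 y, DifferentiableAt ℂ ζ y := by
    filter_upwards [(hζ.of_le (m := 1) le_top).eventually (by simp)] with z hz
    exact hz.differentiableAt (by simp)
  have hψd : ∀ᶠ y in 𝓝 y, DifferentiableAt ℝ ψ (ζ y) := by
    have := (hψ.of_le (m := 1) ENat.LEInfty.out).eventually (by simp)
    filter_upwards [hζ.continuousAt.eventually this] with z hz
    exact hz.differentiableAt (by simp)
  have hreal : ∀ z, DifferentiableAt ℂ ζ z → ∀ w, fderiv ℝ ζ z (Complex.I • w)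
      = Complex.I * fderiv ℝ ζ z w := by
    intro z hz w
    rw [(hz.hasFDerivAt.restrictScalars ℝ).fderiv]
    simp
  have dζ : HasFDerivAt (fderiv ℝ ζ) (fderiv ℝ (fderiv ℝ ζ) y) y :=
    ((hζ'.fderiv_right (m := ω) (by simp)).differentiableAt (by simp)).hasFDerivAt
  have hζ1 : HasFDerivAt ζ (fderiv ℝ ζ y) y := (hζ'.differentiableAt (by simp)).hasFDerivAt
  have dψ : HasFDerivAt (fun z => fderiv ℝ ψ (ζ z))
      ((fderiv ℝ (fderiv ℝ ψ) (ζ y)).comp (fderiv ℝ ζ y)) y :=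
    ((hψ.fderiv_right (m := ∞) (by simp)).differentiableAt (by simp)).hasFDerivAt.comp y hζ1
  have h1 : fderiv ℝ (ψ ∘ ζ) =ᶠ[𝓝 y] fun z => (fderiv ℝ ψ (ζ z)).comp (fderiv ℝ ζ z) := by
    filter_upwards [hζd, hψd] with z h2 h3
    exact fderiv_comp z h3 (h2.restrictScalars ℝ)
  have h2 : ∀ u v, fderiv ℝ (fderiv ℝ (ψ ∘ ζ)) y u v
      = fderiv ℝ (fderiv ℝ ψ) (ζ y) (fderiv ℝ ζ y u) (fderiv ℝ ζ y v)
        + fderiv ℝ ψ (ζ y) (fderiv ℝ (fderiv ℝ ζ) y u v) := by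
    intro u v
    rw [h1.fderiv_eq, (dψ.clm_comp dζ).fderiv]
    simp
    ring
  -- The second derivative of a holomorphic function is complex linear and symmetric, so the two
  -- terms `Dψ (D²ζ)` cancel in the antisymmetrisation.
  have h3 : ∀ u v, fderiv ℝ (fderiv ℝ ζ) y u (Complex.I • v)
      = Complex.I * fderiv ℝ (fderiv ℝ ζ) y u v := by
    intro u v
    have e1 := dζ.clm_apply (hasFDerivAt_const (Complex.I • v) y)
    have e2 := (dζ.clm_apply (hasFDerivAt_const v y)).const_mul Complex.I
    have e3 := e2.congr_of_eventuallyEq (f₁ := fun z => fderiv ℝ ζ z (Complex.I • v)) (by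
      filter_upwards [hζd] with z hz using hreal z hz v)
    have e4 := DFunLike.congr_fun (e1.unique e3) u
    simpa using e4
  have h4 : fderiv ℝ (fderiv ℝ ζ) y u v = fderiv ℝ (fderiv ℝ ζ) y v u :=
    (hζ'.isSymmSndFDerivAt (by simp)).eq u v
  rw [flatDdbar_apply, flatDdbar_apply, h2, h2, h3, h3, hreal y hζd.self_of_nhds,
    hreal y hζd.self_of_nhds, h4]
  simp only [smul_eq_mul]
  ring

theorem flatDdbar_half_conePot (a : ℝ) (z : ℂ) :
    flatDdbar (fun z => conePot a z / 2 - 1) z = coneForm a z := by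
  have h : (fun z => conePot a z / 2 - 1) = fun z => ((1 / 2 : ℝ) • conePot a) z - 1 := by
    ext z
    simp
    ring
  have h1 : fderiv ℝ (fun z => conePot a z / 2 - 1) = (1 / 2 : ℝ) • fderiv ℝ (conePot a) := by
    rw [h, ← fderiv_const_smul_field]
    ext1 z
    exact fderiv_sub_const _
  have h2 : fderiv ℝ (fderiv ℝ (fun z => conePot a z / 2 - 1))
      = (1 / 2 : ℝ) • fderiv ℝ (fderiv ℝ (conePot a)) := by
    rw [h1]
    exact fderiv_const_smul_field (𝕜 := ℝ) (f := fderiv ℝ (conePot a)) (1 / 2 : ℝ)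
  ext u v
  rw [flatDdbar_apply, coneForm_apply, h2]
  simp
  ring

end FlatDdbar

section PreferredChart

variable {E : Type*} [NormedAddCommGroup E] [NormedSpace ℝ E]
  {F : Type*} [NormedAddCommGroup F] [NormedSpace ℝ F]
  {M : Type*} [TopologicalSpace M] [ChartedSpace E M]

/-- Tangent vectors at `p` are written in the preferred chart at `p`, so no chart differential
appears. This matches the definition of `ddbar`, computed in the same chart. -/
theorem rdiff_eq_fderiv_chartAt {f : M → F} {p : M}
    (hf : MDifferentiableAt 𝓘(ℝ, E) 𝓘(ℝ, F) f p) :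
    rdiff E F f p = fderiv ℝ (f ∘ (chartAt E p).symm) (chartAt E p p) := by
  unfold rdiff
  rw [hf.mfderiv]
  simp only [mfld_simps, fderivWithin_univ]
  rfl

end PreferredChart

section ModelPotential

variable {n : ℕ} {F : Type*} [NormedAddCommGroup F] [NormedSpace ℂ F]
  {D : Type*} [TopologicalSpace D] [ChartedSpace F D]
  {E : Type*} [NormedAddCommGroup E] [NormedSpace ℂ E]
  {M : Type*} [TopologicalSpace M] [ChartedSpace E M]
  [MulAction (Fin n → ℂˣ) M]
  {a : ℝ} {ΩD : BilinField F D} {Ω : BilinField E M} {X : VField E M}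
  {K : Set M} {K' : Set (ℂ × D)} {ν : OpenPartialHomeomorph M (ℂ × D)}

/-- As `r² = |X|²` is invariant under the real torus, `J X` is `Ω`-orthogonal to its orbits. -/
theorem IsModelAtInfinity.torusField_orthogonal (hν : IsModelAtInfinity a ΩD Ω X K K' ν)
    (hM : IsToric n E M) (hΩ : IsKahler Ω) (hinv : TorusInvariantForm n Ω) (ha : a ≠ 0)
    (hz : ∀ p ∉ K, (ν p).1 ≠ 0 ∨ a = 1) {b : Fin n → ℝ}
    (hb : (fun p => J E (X p)) = torusField b) {p : M} (hp : p ∉ K) (c : Fin n → ℝ) :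
    Ω p (torusField b p) (torusField c p) = 0 := by
  have hb' : ∀ q, J E (X q) = torusField b q := congrFun hb
  rw [← hb', ← neg_eq_zero, hν.contract_eq_rdiff hp (hz p hp) ha, torusField_eq]
  set γ : ℝ → M := fun s => orbitMap p (s • imagVec c) with hγ
  have hγ0 : γ 0 = p := by simp [hγ, orbitMap_zero]
  have hγd : MDifferentiableAt 𝓘(ℝ, ℝ) 𝓘(ℝ, E) γ 0 :=
    (hM.orbitMap_mdiff p _).comp (0 : ℝ)
      ((differentiableAt_id.smul_const (imagVec c) :
        DifferentiableAt ℝ (fun s : ℝ => s • imagVec c) 0) |>.mdifferentiableAt)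
  have h1 := rdiff_comp (g := modelPot a ν) (f := γ) (0 : ℝ)
    (by rw [hγ0]; exact hν.modelPot_mdiff hp (hz p hp)) hγd
  rw [hγ0] at h1
  rw [← ContinuousLinearMap.comp_apply, ← h1]
  -- Along `γ` the value of `r²` is `Ω (X, J X)`. Pulled back by the orbit map, the two fields are
  -- the constant vectors `realVec b` and `imagVec b`, and the form does not change in imaginary
  -- directions.
  have h2 : modelPot a ν ∘ γ =ᶠ[𝓝 0]
      fun _ => pull Ω (orbitMap p) 0 (realVec b) (imagVec b) / 2 - 1 := by
    have h3 : ∀ᶠ s in 𝓝 0, γ s ∈ Kᶜ := hγd.continuousAt.eventually_mem (by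
      rw [hγ0]
      exact hν.isOpen_compl.mem_nhds hp)
    filter_upwards [h3] with s hs
    rw [Function.comp_apply, modelPot, ← hν.form_field hs (hz _ hs) ha hΩ,
      ← hM.pull_orbitMap_translate hinv p 0 c s, pull_apply, hM.rdiff_orbitMap_realVec p _ hb,
      hM.rdiff_orbitMap_imagVec, zero_add, hb']
  rw [rdiff_congr h2, rdiff_const]
  rfl

theorem IsModelAtInfinity.ddbar_apply [IsManifold 𝓘(ℂ, E) ω M]
    (hν : IsModelAtInfinity a ΩD Ω X K K' ν) {p : M} (hp : p ∉ K) (hz : (ν p).1 ≠ 0 ∨ a = 1)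
    {f : M → ℝ} (hf : f =ᶠ[𝓝 p] modelPot a ν) (u v : E) :
    ddbar f p u v = coneForm a (ν p).1 (rdiff E ℂ (fun p => (ν p).1) p u)
      (rdiff E ℂ (fun p => (ν p).1) p v) := by
  set e := chartAt E p
  have hps : p ∈ e.source := mem_chart_source E p
  have hpt := e.map_source hps
  have hcs : Filter.Tendsto e.symm (𝓝 (e p)) (𝓝 p) := by
    have := e.continuousAt_symm hpt
    rwa [ContinuousAt, e.left_inv hps] at this
  have h1 : f ∘ e.symm =ᶠ[𝓝 (e p)]
      (fun z => conePot a z / 2 - 1) ∘ ((fun p => (ν p).1) ∘ e.symm) := hcs.eventually hf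
  have hζ : ContDiffAt ℂ ω ((fun p => (ν p).1) ∘ e.symm) (e p) := by
    rw [← contMDiffAt_iff_contDiffAt]
    have h2 : ContMDiffAt 𝓘(ℂ, E) 𝓘(ℂ, E) ω e.symm (e p) :=
      contMDiffOn_chart_symm.contMDiffAt (e.open_target.mem_nhds hpt)
    refine ContMDiffAt.comp (e p) ?_ h2
    rw [e.left_inv hps]
    exact hν.fst_holo hp
  have hval : ((fun p => (ν p).1) ∘ e.symm) (e p) = (ν p).1 := by
    simp [e.left_inv hps]
  have hψ : ContDiffAt ℝ ∞ (fun z => conePot a z / 2 - 1)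
      (((fun p => (ν p).1) ∘ e.symm) (e p)) := by
    rw [hval]
    exact ((conePot_contDiffAt hz).div_const 2).sub contDiffAt_const
  rw [ddbar, flatDdbar_congr h1, flatDdbar_comp hψ hζ, hval, flatDdbar_half_conePot,
    ← rdiff_eq_fderiv_chartAt (hν.fst_mdiff hp)]

end ModelPotential

section Laplacian

variable {F : Type*} [NormedAddCommGroup F] [NormedSpace ℂ F] [FiniteDimensional ℂ F]
  {D : Type*} [TopologicalSpace D] [ChartedSpace F D]
  {E : Type*} [NormedAddCommGroup E] [NormedSpace ℂ E] [FiniteDimensional ℂ E]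
  {M : Type*} [TopologicalSpace M] [ChartedSpace E M]
  {a : ℝ} {ΩD : BilinField F D} {Ω : BilinField E M} {X : VField E M}
  {K : Set M} {K' : Set (ℂ × D)} {ν : OpenPartialHomeomorph M (ℂ × D)}

/-- It guarantees that `inverse` in the definition of the Laplacian is a true inverse and not the
default value `0`. -/
theorem IsKahler.metric_isInvertible (hΩ : IsKahler Ω) (p : M) : (metric Ω p).IsInvertible := by
  have : FiniteDimensional ℝ E := FiniteDimensional.complexToReal E
  have hinj : Function.Injective (metric Ω p) := by
    rw [injective_iff_map_eq_zero]
    intro u hu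
    by_contra hne
    have h1 := hΩ.positive p u hne
    have h2 : metric Ω p u u = 0 := by rw [hu]; rfl
    exact h1.ne' h2
  have hdim : Module.finrank ℝ E = Module.finrank ℝ (E →L[ℝ] ℝ) := by
    rw [← (LinearMap.toContinuousLinearMap (𝕜 := ℝ) (E := E) (F' := ℝ)).finrank_eq]
    exact (Subspace.dual_finrank_eq (K := ℝ) (V := E)).symm
  let e : E ≃L[ℝ] (E →L[ℝ] ℝ) :=
    (LinearMap.linearEquivOfInjective (metric Ω p).toLinearMap hinj hdim).toContinuousLinearEquiv
  exact ⟨e, by ext u v; rfl⟩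

/-- The model potential has Laplacian `1`. -/
theorem IsModelAtInfinity.laplacian_eq_one [IsManifold 𝓘(ℂ, E) ω M]
    (hν : IsModelAtInfinity a ΩD Ω X K K' ν) (hΩ : IsKahler Ω)
    (hdim : Module.finrank ℂ F + 1 = Module.finrank ℂ E) {p : M} (hp : p ∉ K)
    (hz : (ν p).1 ≠ 0 ∨ a = 1) {f : M → ℝ} (hf : f =ᶠ[𝓝 p] modelPot a ν) :
    laplacian Ω f p = 1 := by
  have : FiniteDimensional ℝ E := FiniteDimensional.complexToReal E
  have : FiniteDimensional ℝ F := FiniteDimensional.complexToReal F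
  let L : E ≃ₗ[ℝ] ℂ × F := LinearEquiv.ofBijective
    ((rdiff E ℂ (fun p => (ν p).1) p).prod (rdiff E F (fun p => (ν p).2) p)).toLinearMap
    (hν.rdiff_bijective hΩ hdim hp)
  -- Both `i ∂ ∂̄ f` and the cone part of `Ω` are the cone form in the `ℂ` directions. Hence the
  -- endomorphism relating the two metrics is the projection `P` to `ℂ`, transported by the
  -- differential of `ν`. Its real trace is `2`, and the factor `1 / 2` gives `1`.
  let P : ℂ × F →ₗ[ℝ] ℂ × F := LinearMap.prodMap LinearMap.id 0
  let T : E →L[ℝ] E := LinearMap.toContinuousLinearMap (L.symm.conj P)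
  have hLT : ∀ u, L (T u) = P (L u) := by
    intro u
    simp [T, LinearEquiv.conj_apply]
  have h1 : metric (ddbar f) p = (metric Ω p).comp T := by
    ext u v
    have e1 : rdiff E ℂ (fun p => (ν p).1) p (T u) = rdiff E ℂ (fun p => (ν p).1) p u :=
      congrArg Prod.fst (hLT u)
    have e2 : rdiff E F (fun p => (ν p).2) p (T u) = 0 := congrArg Prod.snd (hLT u)
    change ddbar f p u (J E v) = Ω p (T u) (J E v)
    rw [hν.ddbar_apply hp hz hf, hν.form_apply hp, e1, e2]
    simp
  have h2 : (metric Ω p).inverse ∘L metric (ddbar f) p = T := by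
    obtain ⟨e, he⟩ := hΩ.metric_isInvertible p
    rw [h1, ← he, ContinuousLinearMap.inverse_equiv, ← ContinuousLinearMap.comp_assoc]
    ext u
    simp
  rw [laplacian, h2]
  have h3 : LinearMap.trace ℝ E T.toLinearMap = 2 := by
    have : T.toLinearMap = L.symm.conj P := rfl
    rw [this, LinearMap.trace_conj', LinearMap.trace_prodMap']
    simp
  rw [h3]
  norm_num

end Laplacian

/-! ### Riemannian distance and lengths of curves -/

section Norms

variable {E : Type*} [NormedAddCommGroup E] [NormedSpace ℂ E]

theorem metric_smul_smul {M : Type*} (Ω : BilinField E M) (p : M) (c : ℝ) (v : E) :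
    metric Ω p (c • v) (c • v) = c ^ 2 * metric Ω p v v := by
  simp
  ring

theorem norm_J_le (v : E) : ‖J E v‖ ≤ ‖v‖ := by
  simp [J, norm_smul]

theorem form_J_le (B : E →L[ℝ] E →L[ℝ] ℝ) {C : ℝ} (hB : ‖B‖ ≤ C) (v : E) :
    B v (J E v) ≤ C * ‖v‖ ^ 2 := by
  have h1 : B v (J E v) ≤ ‖B‖ * ‖v‖ * ‖J E v‖ :=
    (le_abs_self _).trans (B.le_opNorm₂ v (J E v))
  have h2 := norm_J_le v
  have hC : 0 ≤ C := (norm_nonneg B).trans hB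
  calc B v (J E v) ≤ ‖B‖ * ‖v‖ * ‖J E v‖ := h1
    _ ≤ C * ‖v‖ * ‖v‖ := by gcongr
    _ = C * ‖v‖ ^ 2 := by ring

end Norms

section Distance

variable {E : Type*} [NormedAddCommGroup E] [NormedSpace ℂ E]
  {M : Type*} [TopologicalSpace M] [ChartedSpace E M] {Ω : BilinField E M}

/-- The length of a tangent vector for the metric of `Ω`. -/
abbrev kahlerENorm (Ω : BilinField E M) (p : M) : ENorm (TangentSpace 𝓘(ℝ, E) p) :=
  ⟨fun v : E => ENNReal.ofReal (Real.sqrt (metric Ω p v v))⟩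

theorem kahlerENorm_smul (Ω : BilinField E M) (p : M) :
    letI := kahlerENorm Ω p
    ENormSMulClass ℝ (TangentSpace 𝓘(ℝ, E) p) := by
  let := kahlerENorm Ω p
  have key : ∀ (c : ℝ) (v : E), ENNReal.ofReal (Real.sqrt (metric Ω p (c • v) (c • v)))
      = ‖c‖ₑ * ENNReal.ofReal (Real.sqrt (metric Ω p v v)) := fun c v => by
    rw [metric_smul_smul, Real.sqrt_mul (sq_nonneg c), Real.sqrt_sq_eq_abs,
      ENNReal.ofReal_mul (abs_nonneg c), ← Real.enorm_eq_ofReal_abs]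
  exact ⟨key⟩

theorem kahlerEDist_comm (Ω : BilinField E M) (p q : M) :
    kahlerEDist Ω p q = kahlerEDist Ω q p := by
  let : ∀ p : M, ENorm (TangentSpace 𝓘(ℝ, E) p) := kahlerENorm Ω
  have : ∀ p : M, ENormSMulClass ℝ (TangentSpace 𝓘(ℝ, E) p) := kahlerENorm_smul Ω
  exact Manifold.riemannianEDist_comm (I := 𝓘(ℝ, E))

theorem kahlerEDist_triangle (Ω : BilinField E M) (p q r : M) :
    kahlerEDist Ω p r ≤ kahlerEDist Ω p q + kahlerEDist Ω q r := by
  let : ∀ p : M, ENorm (TangentSpace 𝓘(ℝ, E) p) := kahlerENorm Ω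
  have : ∀ p : M, ENormSMulClass ℝ (TangentSpace 𝓘(ℝ, E) p) := kahlerENorm_smul Ω
  exact Manifold.riemannianEDist_triangle (I := 𝓘(ℝ, E))

theorem kahlerEDist_le_of_speed_le {γ : ℝ → M} {s t C : ℝ} (hst : s ≤ t)
    (hγ : ContMDiffOn 𝓘(ℝ, ℝ) 𝓘(ℝ, E) 1 γ (Set.Icc s t)) (hC : 0 ≤ C)
    (hspeed : ∀ r ∈ Set.Icc s t,
      metric Ω (γ r) (rdiff ℝ E γ r 1) (rdiff ℝ E γ r 1) ≤ C ^ 2) :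
    kahlerEDist Ω (γ s) (γ t) ≤ ENNReal.ofReal (C * (t - s)) := by
  let : ∀ p : M, ENorm (TangentSpace 𝓘(ℝ, E) p) := kahlerENorm Ω
  have : ∀ p : M, ENormSMulClass ℝ (TangentSpace 𝓘(ℝ, E) p) := kahlerENorm_smul Ω
  refine (Manifold.riemannianEDist_le_pathELength (I := 𝓘(ℝ, E)) hγ rfl rfl hst).trans ?_
  rw [Manifold.pathELength_eq_lintegral_mfderiv_Icc, ENNReal.ofReal_mul hC, ← Real.volume_Icc,
    ← MeasureTheory.setLIntegral_const]
  refine MeasureTheory.setLIntegral_mono measurable_const fun r hr => ?_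
  change ENNReal.ofReal (Real.sqrt (metric Ω (γ r) (rdiff ℝ E γ r 1) (rdiff ℝ E γ r 1))) ≤ _
  exact ENNReal.ofReal_le_ofReal ((Real.sqrt_le_sqrt (hspeed r hr)).trans_eq (Real.sqrt_sq hC))

theorem pull_chartAt_symm (Ω : BilinField E M) (x : M) (y : E) :
    pull Ω (chartAt E x).symm y = coordExpr Ω x y := rfl

/-- The distance along a curve in holomorphic coordinates. -/
theorem kahlerEDist_le_of_pull_le {G : Type*} [NormedAddCommGroup G] [NormedSpace ℂ G]
    {Ψ : G → M} {c : ℝ → G} {s t C : ℝ} (hst : s ≤ t)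
    (hc : ∀ r ∈ Set.Icc s t, ContDiffAt ℝ 1 c r)
    (hΨ : ∀ r ∈ Set.Icc s t, ContMDiffAt 𝓘(ℂ, G) 𝓘(ℂ, E) ω Ψ (c r)) (hC : 0 ≤ C)
    (hspeed : ∀ r ∈ Set.Icc s t, pull Ω Ψ (c r) (deriv c r) (J G (deriv c r)) ≤ C ^ 2) :
    kahlerEDist Ω (Ψ (c s)) (Ψ (c t)) ≤ ENNReal.ofReal (C * (t - s)) := by
  have hsm : ∀ r ∈ Set.Icc s t, ContMDiffAt 𝓘(ℝ, ℝ) 𝓘(ℝ, E) 1 (Ψ ∘ c) r := fun r hr =>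
    ((contMDiffAt_real (hΨ r hr)).of_le le_top).comp r (hc r hr).contMDiffAt
  refine kahlerEDist_le_of_speed_le (γ := Ψ ∘ c) hst
    (fun r hr => (hsm r hr).contMDiffWithinAt) hC fun r hr => ?_
  have hd : MDifferentiableAt 𝓘(ℂ, G) 𝓘(ℂ, E) Ψ (c r) := (hΨ r hr).mdifferentiableAt (by simp)
  have hcd : DifferentiableAt ℝ c r := (hc r hr).differentiableAt (by simp)
  have h1 : rdiff ℝ E (Ψ ∘ c) r 1 = rdiff G E Ψ (c r) (deriv c r) := by
    rw [rdiff_comp r (mdifferentiableAt_real hd) hcd.mdifferentiableAt, rdiff_eq_fderiv]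
    rfl
  have h2 := hspeed r hr
  rw [pull_apply, rdiff_J hd] at h2
  rw [h1]
  exact h2

variable [IsManifold 𝓘(ℂ, E) ω M]

/-- The Riemannian distance is continuous for the manifold topology. -/
theorem IsKahler.eventually_kahlerEDist_le (hΩ : IsKahler Ω) (x : M) {ε : ℝ} (hε : 0 < ε) :
    ∀ᶠ q in 𝓝 x, kahlerEDist Ω q x ≤ ENNReal.ofReal ε := by
  set e := chartAt E x
  have hx : x ∈ e.source := mem_chart_source E x
  have ht := e.map_source hx
  have hcx : ContinuousAt (coordExpr Ω x) (e x) := (hΩ.coordExpr_contDiffAt x ht).continuousAt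
  have hcont : ContinuousAt (fun y => ‖coordExpr Ω x y‖) (e x) :=
    (continuous_norm (E := E →L[ℝ] E →L[ℝ] ℝ)).continuousAt.comp hcx
  obtain ⟨C, hC0, hC⟩ : ∃ C : ℝ, 0 < C ∧ ∀ᶠ y in 𝓝 (e x), ‖coordExpr Ω x y‖ ≤ C :=
    ⟨‖coordExpr Ω x (e x)‖ + 1, by positivity,
      (hcont.eventually (gt_mem_nhds (lt_add_one _))).mono fun _ h => le_of_lt h⟩
  obtain ⟨ρ, hρ, hB⟩ := Metric.eventually_nhds_iff_ball.1
    (hC.and (e.open_target.eventually_mem ht))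
  have hnear : ∀ᶠ q in 𝓝 x, q ∈ e.source ∧ e q ∈ Metric.ball (e x) ρ ∧
      Real.sqrt C * ‖e x - e q‖ ≤ ε := by
    have hce : ContinuousAt e x := e.continuousAt hx
    have h1 : Filter.Tendsto (fun q => Real.sqrt C * ‖e x - e q‖) (𝓝 x) (𝓝 0) := by
      have : ContinuousAt (fun q => Real.sqrt C * ‖e x - e q‖) x := by fun_prop
      simpa [ContinuousAt] using this
    filter_upwards [e.open_source.mem_nhds hx, hce (Metric.ball_mem_nhds _ hρ),
      h1.eventually (gt_mem_nhds hε)] with q h2 h3 h4 using ⟨h2, h3, le_of_lt h4⟩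
  filter_upwards [hnear] with q ⟨hq1, hq2, hq3⟩
  -- The straight segment in the chart. The form is bounded by `C` on the ball, so the length is at
  -- most `√C` times the coordinate distance.
  let c : ℝ → E := fun t => e q + t • (e x - e q)
  have hcd : ∀ r, HasDerivAt c (e x - e q) r := fun r => by
    have h := ((hasDerivAt_id r).smul_const (e x - e q)).const_add (e q)
    rwa [one_smul] at h
  have hcB : ∀ r ∈ Set.Icc (0 : ℝ) 1, c r ∈ Metric.ball (e x) ρ := fun r hr =>
    (convex_ball (e x) ρ).add_smul_sub_mem hq2 (Metric.mem_ball_self hρ) hr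
  have key := kahlerEDist_le_of_pull_le (Ω := Ω) (Ψ := e.symm) (c := c) (C := Real.sqrt C * ‖e x - e q‖)
    zero_le_one (fun r _ => by fun_prop)
    (fun r hr => contMDiffOn_chart_symm.contMDiffAt
      (e.open_target.mem_nhds (hB _ (hcB r hr)).2)) (by positivity) (fun r hr => by
      rw [(hcd r).deriv, pull_chartAt_symm, mul_pow, Real.sq_sqrt hC0.le]
      exact form_J_le _ (hB _ (hcB r hr)).1 _)
  have h0 : e.symm (c 0) = q := by simp [c, e.left_inv hq1]
  have h1 : e.symm (c 1) = x := by simp [c, e.left_inv hx]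
  rw [h0, h1] at key
  refine key.trans (ENNReal.ofReal_le_ofReal ?_)
  simpa using hq3

end Distance

/-! ### Lengths in the cone -/

section Cone

variable {a : ℝ} {z : ℂ}

/-- The left side is a quarter of `D²φ (v, v) + D²φ (i v, i v)`. The bound is not sharp; only its
dependence on `‖v‖ ^ 2` matters. -/
theorem coneForm_I_le (a : ℝ) (z v : ℂ) {C : ℝ} (hC : ‖fderiv ℝ (fderiv ℝ (conePot a)) z‖ ≤ C) :
    coneForm a z v (Complex.I * v) ≤ C * ‖v‖ ^ 2 := by
  set B := fderiv ℝ (fderiv ℝ (conePot a)) z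
  have h : ∀ u : ℂ, ‖u‖ = ‖v‖ → |B u u| ≤ C * ‖v‖ ^ 2 := fun u hu => by
    have h1 := B.le_opNorm₂ u u
    rw [hu, mul_assoc, ← sq] at h1
    exact h1.trans (by gcongr)
  have e : Complex.I * (Complex.I * v) = -v := by
    rw [← mul_assoc, Complex.I_mul_I, neg_one_mul]
  have h1 := abs_le.1 (h v rfl)
  have h2 := abs_le.1 (h (Complex.I * v) (by simp))
  have h0 : 0 ≤ C * ‖v‖ ^ 2 := mul_nonneg ((norm_nonneg B).trans hC) (sq_nonneg _)
  rw [coneForm_apply, e, map_neg]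
  linarith [h1.2, h2.2]

theorem coneForm_self_I (ha : a ≠ 0) (hz : z ≠ 0 ∨ a = 1) (c : ℝ) :
    coneForm a z (c • z) (Complex.I * (c • z)) = c ^ 2 * a ^ 2 * conePot a z := by
  have h1 := coneForm_radial ha hz z
  rw [fderiv_conePot_self hz] at h1
  have h2 : Complex.I * ((1 / a : ℝ) • z) = (1 / a : ℝ) • (Complex.I * z) := by
    rw [mul_smul_comm]
  have h3 : coneForm a z z (Complex.I * z) = - coneForm a z (Complex.I * z) z := by
    rw [coneForm_apply, coneForm_apply]
    ring
  rw [h2, map_smul, smul_apply, smul_eq_mul] at h1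
  rw [mul_smul_comm, map_smul, map_smul, smul_apply, h3]
  simp only [smul_eq_mul]
  field_simp at h1
  linear_combination (-c ^ 2) * h1

end Cone

/-! ### Product coordinates and curves running into `K'` -/

section ProductChart

variable {F : Type*} [NormedAddCommGroup F] {D : Type*} [TopologicalSpace D] [ChartedSpace F D]

/-- The inverse of the product of the identity of `ℂ` and the chart at `x`. -/
def prodChart (x : D) (w : ℂ × F) : ℂ × D := (w.1, (chartAt F x).symm w.2)

theorem prodChart_continuousAt (x : D) {w : ℂ × F} (hw : w.2 ∈ (chartAt F x).target) :
    ContinuousAt (prodChart x) w :=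
  continuousAt_fst.prodMk (((chartAt F x).continuousAt_symm hw).comp continuousAt_snd)

end ProductChart

section ProductCoordinates

variable {F : Type*} [NormedAddCommGroup F] [NormedSpace ℂ F]
  {D : Type*} [TopologicalSpace D] [ChartedSpace F D]
  {E : Type*} [NormedAddCommGroup E] [NormedSpace ℂ E]
  {M : Type*} [TopologicalSpace M] [ChartedSpace E M]
  {a : ℝ} {ΩD : BilinField F D} {Ω : BilinField E M} {X : VField E M}
  {K : Set M} {K' : Set (ℂ × D)} {ν : OpenPartialHomeomorph M (ℂ × D)}

namespace IsModelAtInfinity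

theorem isOpen_compl' (hν : IsModelAtInfinity a ΩD Ω X K K' ν) : IsOpen K'ᶜ :=
  hν.target_eq ▸ ν.open_target

variable [IsManifold 𝓘(ℂ, F) ω D]

theorem symm_prodChart_holo (hν : IsModelAtInfinity a ΩD Ω X K K' ν) {x : D} {w : ℂ × F}
    (hw : w.2 ∈ (chartAt F x).target) (hK : prodChart x w ∉ K') :
    ContMDiffAt 𝓘(ℂ, ℂ × F) 𝓘(ℂ, E) ω (fun w => ν.symm (prodChart x w)) w := by
  have h1 : ContMDiffAt 𝓘(ℂ, ℂ × F) 𝓘(ℂ, ℂ) ω (fun w : ℂ × F => w.1) w :=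
    contDiff_fst.contMDiff.contMDiffAt
  have h2 : ContMDiffAt 𝓘(ℂ, ℂ × F) 𝓘(ℂ, F) ω (fun w : ℂ × F => w.2) w :=
    contDiff_snd.contMDiff.contMDiffAt
  have h3 : ContMDiffAt 𝓘(ℂ, F) 𝓘(ℂ, F) ω (chartAt F x).symm w.2 :=
    contMDiffOn_chart_symm.contMDiffAt ((chartAt F x).open_target.mem_nhds hw)
  exact (hν.holomorphic_symm.contMDiffAt (hν.isOpen_compl'.mem_nhds hK)).comp w
    (h1.prodMk (h3.comp w h2))

/-- Lengths of curves in the end of `M` can thus be computed in `ℂ × F`, where the form splits. -/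
theorem pull_symm_prodChart (hν : IsModelAtInfinity a ΩD Ω X K K' ν) {x : D} {w : ℂ × F}
    (hw : w.2 ∈ (chartAt F x).target) (hK : prodChart x w ∉ K') (u v : ℂ × F) :
    pull Ω (fun w => ν.symm (prodChart x w)) w u v
      = coneForm a w.1 u.1 v.1 + coordExpr ΩD x w.2 u.2 v.2 := by
  set Ψ : ℂ × F → M := fun w => ν.symm (prodChart x w)
  have hΨ : MDifferentiableAt 𝓘(ℝ, ℂ × F) 𝓘(ℝ, E) Ψ w :=
    mdifferentiableAt_real ((hν.symm_prodChart_holo hw hK).mdifferentiableAt (by simp))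
  have hp : Ψ w ∉ K := hν.symm_notMem hK
  have hnear : ∀ᶠ w' in 𝓝 w, ν (Ψ w') = prodChart x w' := by
    filter_upwards [prodChart_continuousAt x hw (hν.isOpen_compl'.mem_nhds hK)] with w' hw'
    exact hν.right_inv hw'
  have e1 : ∀ u, rdiff E ℂ (fun p => (ν p).1) (Ψ w) (rdiff (ℂ × F) E Ψ w u) = u.1 := fun u => by
    have h : (fun p => (ν p).1) ∘ Ψ =ᶠ[𝓝 w] Prod.fst := by
      filter_upwards [hnear] with w' hw'
      simp [hw', prodChart]
    have h2 := rdiff_comp w (hν.fst_mdiff hp) hΨ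
    rw [rdiff_congr h, rdiff_eq_fderiv, fderiv_fst] at h2
    exact (DFunLike.congr_fun h2 u).symm
  have e2 : ∀ u, rdiff E F (fun p => (ν p).2) (Ψ w) (rdiff (ℂ × F) E Ψ w u)
      = rdiff F F (chartAt F x).symm w.2 u.2 := fun u => by
    have h : (fun p => (ν p).2) ∘ Ψ =ᶠ[𝓝 w] (chartAt F x).symm ∘ Prod.snd := by
      filter_upwards [hnear] with w' hw'
      simp [hw', prodChart]
    have h2 := rdiff_comp w (hν.snd_mdiff hp) hΨ
    have h3 := rdiff_comp (g := (chartAt F x).symm) (f := (Prod.snd : ℂ × F → F)) w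
      (chartAt_symm_mdiff x hw) differentiableAt_snd.mdifferentiableAt
    rw [rdiff_congr h, h3, rdiff_eq_fderiv, fderiv_snd] at h2
    exact (DFunLike.congr_fun h2 u).symm
  rw [pull_apply, hν.form_apply hp, e1, e1, e2, e2, hnear.self_of_nhds]
  rfl

/-- A curve of finite length in the model that ends in `K'` gives a point of `K`. -/
theorem exists_mem_kahlerEDist_le [T2Space D] [IsManifold 𝓘(ℂ, E) ω M]
    (hν : IsModelAtInfinity a ΩD Ω X K K' ν)
    (hΩ : IsKahler Ω) (hcomplete : IsCompleteMetric Ω) {x : D} {c : ℝ → ℂ × F} {C ε : ℝ}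
    (hC : 0 ≤ C) (hCε : C < ε) (hcont : ContinuousOn c (Set.Icc 0 1))
    (hx : ∀ t ∈ Set.Icc (0 : ℝ) 1, (c t).2 ∈ (chartAt F x).target)
    (h0 : prodChart x (c 0) ∉ K') (h1 : prodChart x (c 1) ∈ K')
    (hc : ∀ t ∈ Set.Ico (0 : ℝ) 1, ContDiffAt ℝ 1 c t)
    (hspeed : ∀ t ∈ Set.Ico (0 : ℝ) 1, prodChart x (c t) ∉ K' →
      coneForm a (c t).1 (deriv c t).1 (Complex.I * (deriv c t).1)
        + coordExpr ΩD x (c t).2 (deriv c t).2 (J F (deriv c t).2) ≤ C ^ 2) :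
    ∃ m ∈ K, kahlerEDist Ω (ν.symm (prodChart x (c 0))) m ≤ ENNReal.ofReal ε := by
  have hcc : ContinuousOn (fun t => prodChart x (c t)) (Set.Icc 0 1) := fun t ht =>
    (prodChart_continuousAt x (hx t ht)).comp_continuousWithinAt (hcont t ht)
  -- The times spent in `K'`. Up to the first such time `τ` the curve lifts to `M`, with speed at
  -- most `C`.
  set S : Set ℝ := Set.Icc 0 1 ∩ (fun t => prodChart x (c t)) ⁻¹' K'
  have hS : IsCompact S := isCompact_Icc.of_isClosed_subset
    (hcc.preimage_isClosed_of_isClosed isClosed_Icc hν.compact'.isClosed) Set.inter_subset_left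
  have hτ := hS.sInf_mem ⟨1, ⟨zero_le_one, le_rfl⟩, h1⟩
  set τ := sInf S
  have hlt : ∀ t, 0 ≤ t → t < τ → prodChart x (c t) ∉ K' := fun t ht0 ht hK =>
    notMem_of_lt_csInf ht hS.bddBelow ⟨⟨ht0, ht.le.trans hτ.1.2⟩, hK⟩
  have hτ0 : 0 < τ := lt_of_le_of_ne hτ.1.1 fun h => h0 (by rw [h]; exact hτ.2)
  have hdist : ∀ s t, 0 ≤ s → s ≤ t → t < τ → kahlerEDist Ω (ν.symm (prodChart x (c s)))
      (ν.symm (prodChart x (c t))) ≤ ENNReal.ofReal (C * (t - s)) := by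
    intro s t hs hst ht
    have hI : ∀ r ∈ Set.Icc s t, r ∈ Set.Ico (0 : ℝ) 1 ∧ prodChart x (c r) ∉ K' := fun r hr =>
      ⟨⟨hs.trans hr.1, (hr.2.trans_lt ht).trans_le hτ.1.2⟩,
        hlt r (hs.trans hr.1) (hr.2.trans_lt ht)⟩
    refine kahlerEDist_le_of_pull_le (Ψ := fun w => ν.symm (prodChart x w)) hst
      (fun r hr => hc r (hI r hr).1)
      (fun r hr => hν.symm_prodChart_holo (hx r (Set.Ico_subset_Icc_self (hI r hr).1))
        (hI r hr).2) hC fun r hr => ?_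
    rw [hν.pull_symm_prodChart (hx r (Set.Ico_subset_Icc_self (hI r hr).1)) (hI r hr).2]
    exact hspeed r (hI r hr).1 (hI r hr).2
  -- Times increasing to `τ` without reaching it. The lifted points form a Cauchy sequence, so
  -- completeness provides the endpoint `m`.
  set θ : ℕ → ℝ := fun j => τ * (1 - 1 / ((j : ℝ) + 1))
  have hθ : Filter.Tendsto θ Filter.atTop (𝓝 τ) := by
    simpa [θ] using (tendsto_one_div_add_atTop_nhds_zero_nat (𝕜 := ℝ)).const_sub 1 |>.const_mul τ
  have hθ0 : ∀ j, 0 ≤ θ j := fun j => mul_nonneg hτ0.le (by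
    rw [sub_nonneg, div_le_one (by positivity)]
    simp)
  have hθτ : ∀ j, θ j < τ := fun j => mul_lt_of_lt_one_right hτ0 (by
    rw [sub_lt_self_iff]
    positivity)
  have hdist' : ∀ k l, kahlerEDist Ω (ν.symm (prodChart x (c (θ k))))
      (ν.symm (prodChart x (c (θ l)))) ≤ ENNReal.ofReal (C * |θ k - θ l|) := by
    intro k l
    rcases le_total (θ k) (θ l) with h | h
    · rw [abs_sub_comm, abs_of_nonneg (sub_nonneg.2 h)]
      exact hdist _ _ (hθ0 k) h (hθτ l)
    · rw [kahlerEDist_comm, abs_of_nonneg (sub_nonneg.2 h)]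
      exact hdist _ _ (hθ0 l) h (hθτ k)
  obtain ⟨m, hm⟩ := hcomplete (fun j => ν.symm (prodChart x (c (θ j)))) fun δ hδ => by
    obtain ⟨δ', hδ'0, hδ'⟩ := ENNReal.lt_iff_exists_real_btwn.1 hδ
    have hδ'' : 0 < δ' := ENNReal.ofReal_pos.1 hδ'.1
    obtain ⟨N, hN⟩ := Metric.cauchySeq_iff.1 hθ.cauchySeq (δ' / (C + 1)) (by positivity)
    refine ⟨N, fun k hk l hl => (hdist' k l).trans_lt (lt_of_le_of_lt ?_ hδ'.2)⟩
    refine ENNReal.ofReal_le_ofReal ?_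
    have h2 := hN k hk l hl
    rw [Real.dist_eq, lt_div_iff₀ (by positivity)] at h2
    nlinarith [abs_nonneg (θ k - θ l)]
  refine ⟨m, ?_, ?_⟩
  -- If `m` were outside `K`, continuity of `ν` at `m` would identify `ν m` with the point of the
  -- curve at time `τ`, which lies in `K'`.
  · by_contra hmK
    have h2 : Filter.Tendsto (fun j => ν (ν.symm (prodChart x (c (θ j))))) Filter.atTop
        (𝓝 (ν m)) :=
      (ν.continuousAt (by rw [hν.source_eq]; exact hmK)).tendsto.comp hm
    have h3 : Filter.Tendsto (fun j => prodChart x (c (θ j))) Filter.atTop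
        (𝓝 (prodChart x (c τ))) :=
      (hcc τ hτ.1).tendsto.comp (tendsto_nhdsWithin_iff.2 ⟨hθ, Filter.Eventually.of_forall
        fun j => ⟨hθ0 j, (hθτ j).le.trans hτ.1.2⟩⟩)
    have h4 : (fun j => ν (ν.symm (prodChart x (c (θ j))))) = fun j => prodChart x (c (θ j)) :=
      funext fun j => hν.right_inv (hlt _ (hθ0 j) (hθτ j))
    rw [h4] at h2
    exact hν.map_notMem hmK (tendsto_nhds_unique h2 h3 ▸ hτ.2)
  -- The slack `ε - C` pays for the last step, from a lifted point to the limit `m`.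
  · obtain ⟨j, hj⟩ := (hm.eventually
      (hΩ.eventually_kahlerEDist_le m (sub_pos.2 hCε))).exists
    have h2 := hdist 0 (θ j) le_rfl (hθ0 j) (hθτ j)
    calc kahlerEDist Ω (ν.symm (prodChart x (c 0))) m
        ≤ ENNReal.ofReal (C * (θ j - 0)) + ENNReal.ofReal (ε - C) :=
          (kahlerEDist_triangle Ω _ _ _).trans (add_le_add h2 hj)
      _ ≤ ENNReal.ofReal C + ENNReal.ofReal (ε - C) := by
          gcongr
          exact mul_le_of_le_one_right hC (by linarith [hθτ j, hτ.1.2])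
      _ = ENNReal.ofReal ε := by
          rw [← ENNReal.ofReal_add hC (by linarith)]
          congr 1
          ring

end IsModelAtInfinity

end ProductCoordinates

section Cauchy

variable {E : Type*} [NormedAddCommGroup E] [NormedSpace ℂ E]
  {M : Type*} [TopologicalSpace M] [ChartedSpace E M] [IsManifold 𝓘(ℂ, E) ω M]
  {Ω : BilinField E M}

/-- Applied with `m i` in the compact set `K`: points whose distance to `K` tends to `0` have a
Cauchy subsequence. -/
theorem cauchy_of_kahlerEDist_le {p : ℕ → M} {m : ℕ → M} {x : M} {δ : ℕ → ℝ}
    (hΩ : IsKahler Ω) (hm : Filter.Tendsto m Filter.atTop (𝓝 x))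
    (hδ : Filter.Tendsto δ Filter.atTop (𝓝 0))
    (h : ∀ i, kahlerEDist Ω (p i) (m i) ≤ ENNReal.ofReal (δ i)) (ε : ENNReal) (hε : 0 < ε) :
    ∃ N, ∀ k ≥ N, ∀ l ≥ N, kahlerEDist Ω (p k) (p l) < ε := by
  obtain ⟨η, _, hη⟩ := ENNReal.lt_iff_exists_real_btwn.1 hε
  have hη0 : 0 < η := ENNReal.ofReal_pos.1 hη.1
  obtain ⟨N, hN⟩ := Filter.eventually_atTop.1 ((hδ.eventually (gt_mem_nhds
    (show (0 : ℝ) < η / 4 by positivity))).and (hm.eventually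
      (hΩ.eventually_kahlerEDist_le x (show (0 : ℝ) < η / 4 by positivity))))
  have hd : ∀ k ≥ N, kahlerEDist Ω (p k) x ≤ ENNReal.ofReal (η / 2) := fun k hk => by
    calc kahlerEDist Ω (p k) x ≤ ENNReal.ofReal (η / 4) + ENNReal.ofReal (η / 4) :=
          (kahlerEDist_triangle Ω _ (m k) _).trans (add_le_add
            ((h k).trans (ENNReal.ofReal_le_ofReal (hN k hk).1.le)) (hN k hk).2)
      _ = ENNReal.ofReal (η / 2) := by
          rw [← ENNReal.ofReal_add (by positivity) (by positivity)]
          congr 1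
          ring
  refine ⟨N, fun k hk l hl => lt_of_le_of_lt ?_ hη.2⟩
  calc kahlerEDist Ω (p k) (p l) ≤ ENNReal.ofReal (η / 2) + ENNReal.ofReal (η / 2) :=
        (kahlerEDist_triangle Ω _ x _).trans (add_le_add (hd k hk)
          (by rw [kahlerEDist_comm]; exact hd l hl))
    _ = ENNReal.ofReal η := by
        rw [← ENNReal.ofReal_add (by positivity) (by positivity)]
        congr 1
        ring

end Cauchy

/-! ### Completeness forces escape to infinity in the model -/

section Escape

variable {F : Type*} [NormedAddCommGroup F] [NormedSpace ℂ F]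
  {D : Type*} [TopologicalSpace D] [ChartedSpace F D]
  {E : Type*} [NormedAddCommGroup E] [NormedSpace ℂ E]
  {M : Type*} [TopologicalSpace M] [ChartedSpace E M]
  {a : ℝ} {ΩD : BilinField F D} {Ω : BilinField E M} {X : VField E M}
  {K : Set M} {K' : Set (ℂ × D)} {ν : OpenPartialHomeomorph M (ℂ × D)}

namespace IsModelAtInfinity

/-- For `a ≠ 1` no point of the end lies over `z = 0`, because the cone form degenerates there. All
of `{0} × D` must therefore have been removed. -/
theorem zero_mem [FiniteDimensional ℂ F] [FiniteDimensional ℂ E]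
    (hν : IsModelAtInfinity a ΩD Ω X K K' ν) (hΩ : IsKahler Ω)
    (hdim : Module.finrank ℂ F + 1 = Module.finrank ℂ E) (ha1 : a ≠ 1) (x : D) :
    ((0 : ℂ), x) ∈ K' := by
  by_contra h
  have h1 := hν.fst_ne_zero_or hΩ hdim (hν.symm_notMem h)
  rw [hν.right_inv h] at h1
  exact h1.elim (fun h => h rfl) ha1

variable [IsManifold 𝓘(ℂ, F) ω D] [T2Space D] [IsManifold 𝓘(ℂ, E) ω M]

/-- Points of the model near a smooth point of `K'` are close to `K`. -/
theorem eventually_exists_mem_of_smooth (hν : IsModelAtInfinity a ΩD Ω X K K' ν)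
    (hΩ : IsKahler Ω) (hΩD : IsKahler ΩD) (hcomplete : IsCompleteMetric Ω) {q : ℂ × D}
    (hq : q ∈ K') (hz : q.1 ≠ 0 ∨ a = 1) {ε : ℝ} (hε : 0 < ε) :
    ∀ᶠ q' in 𝓝 q, q' ∉ K' → ∃ m ∈ K, kahlerEDist Ω (ν.symm q') m ≤ ENNReal.ofReal ε := by
  set e := chartAt F q.2
  have hx : q.2 ∈ e.source := mem_chart_source F q.2
  have ht := e.map_source hx
  set w₀ : ℂ × F := (q.1, e q.2)
  have hD2 : ContinuousAt (fderiv ℝ (fderiv ℝ (conePot a))) q.1 :=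
    (((conePot_contDiffAt hz).fderiv_right (m := ∞) (by simp)).fderiv_right (m := ∞)
      (by simp)).continuousAt
  have hD2' : ContinuousAt (fun z => ‖fderiv ℝ (fderiv ℝ (conePot a)) z‖) q.1 :=
    (continuous_norm (E := ℂ →L[ℝ] ℂ →L[ℝ] ℝ)).continuousAt.comp hD2
  have hcx : ContinuousAt (coordExpr ΩD q.2) (e q.2) :=
    (hΩD.coordExpr_contDiffAt q.2 ht).continuousAt
  have hcx' : ContinuousAt (fun y => ‖coordExpr ΩD q.2 y‖) (e q.2) :=
    (continuous_norm (E := F →L[ℝ] F →L[ℝ] ℝ)).continuousAt.comp hcx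
  obtain ⟨C, hC0, hC⟩ : ∃ C : ℝ, 0 < C ∧ ∀ᶠ w in 𝓝 w₀,
      ‖fderiv ℝ (fderiv ℝ (conePot a)) w.1‖ ≤ C ∧ ‖coordExpr ΩD q.2 w.2‖ ≤ C := by
    refine ⟨‖fderiv ℝ (fderiv ℝ (conePot a)) q.1‖ + ‖coordExpr ΩD q.2 (e q.2)‖ + 1,
      by positivity, ?_⟩
    have h1 := (hD2'.comp (x := w₀) continuousAt_fst).eventually
      (gt_mem_nhds (lt_add_one _))
    have h2 := (hcx'.comp (x := w₀) continuousAt_snd).eventually (gt_mem_nhds (lt_add_one _))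
    filter_upwards [h1, h2] with w h3 h4
    simp only [Function.comp_apply] at h3 h4
    exact ⟨by linarith [norm_nonneg (coordExpr ΩD q.2 (e q.2))],
      by linarith [norm_nonneg (fderiv ℝ (fderiv ℝ (conePot a)) q.1)]⟩
  obtain ⟨ρ, hρ, hB⟩ := Metric.eventually_nhds_iff_ball.1
    (hC.and (continuousAt_snd.eventually (e.open_target.eventually_mem ht)))
  -- The cone part and the `D` part each contribute at most `C ‖w₀ - w‖ ^ 2` to the squared speed of
  -- the segment, whence `2 * C`.
  have hnear : ∀ᶠ q' in 𝓝 q, q'.2 ∈ e.source ∧ (q'.1, e q'.2) ∈ Metric.ball w₀ ρ ∧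
      Real.sqrt (2 * C) * ‖w₀ - (q'.1, e q'.2)‖ < ε := by
    have hce : ContinuousAt (fun q' : ℂ × D => (q'.1, e q'.2)) q :=
      continuousAt_fst.prodMk ((e.continuousAt hx).comp continuousAt_snd)
    have h1 : Filter.Tendsto (fun q' : ℂ × D => Real.sqrt (2 * C) * ‖w₀ - (q'.1, e q'.2)‖)
        (𝓝 q) (𝓝 0) := by
      have h2 : ContinuousAt
          (fun q' : ℂ × D => Real.sqrt (2 * C) * ‖w₀ - (q'.1, e q'.2)‖) q :=
        continuousAt_const.mul (continuousAt_const.sub hce).norm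
      have h3 : Real.sqrt (2 * C) * ‖w₀ - (q.1, e q.2)‖ = 0 := by simp [w₀]
      rw [← h3]
      exact h2
    filter_upwards [continuousAt_snd.eventually (e.open_source.mem_nhds hx),
      hce (Metric.ball_mem_nhds _ hρ), h1.eventually (gt_mem_nhds hε)] with q' h2 h3 h4
      using ⟨h2, h3, h4⟩
  filter_upwards [hnear] with q' ⟨hq1, hq2, hq3⟩ hqK
  set w : ℂ × F := (q'.1, e q'.2)
  let c : ℝ → ℂ × F := fun t => w + t • (w₀ - w)
  have hcd : ∀ r, HasDerivAt c (w₀ - w) r := fun r => by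
    have h := ((hasDerivAt_id r).smul_const (w₀ - w)).const_add w
    rwa [one_smul] at h
  have hcB : ∀ r ∈ Set.Icc (0 : ℝ) 1, c r ∈ Metric.ball w₀ ρ := fun r hr =>
    (convex_ball w₀ ρ).add_smul_sub_mem hq2 (Metric.mem_ball_self hρ) hr
  have hc0 : prodChart q.2 (c 0) = q' := by
    simp only [c, zero_smul, add_zero, w, prodChart]
    exact Prod.ext rfl (e.left_inv hq1)
  have hc1 : prodChart q.2 (c 1) = q := by
    simp only [c, one_smul, add_sub_cancel, w₀, prodChart]
    exact Prod.ext rfl (e.left_inv hx)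
  have key := hν.exists_mem_kahlerEDist_le (c := c) (x := q.2) hΩ hcomplete (by positivity) hq3
    (fun r _ => (hcd r).continuousAt.continuousWithinAt) (fun r hr => (hB _ (hcB r hr)).2)
    (by rwa [hc0]) (by rwa [hc1]) (fun r _ => by fun_prop) fun r hr _ => by
      have hb := (hB _ (hcB r (Set.Ico_subset_Icc_self hr))).1
      rw [(hcd r).deriv, mul_pow, Real.sq_sqrt (by positivity)]
      have h1 := coneForm_I_le a (c r).1 (w₀ - w).1 hb.1
      have h2 := form_J_le _ hb.2 (w₀ - w).2
      have h3 : ‖(w₀ - w).1‖ ^ 2 ≤ ‖w₀ - w‖ ^ 2 := by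
        gcongr
        exact norm_fst_le _
      have h4 : ‖(w₀ - w).2‖ ^ 2 ≤ ‖w₀ - w‖ ^ 2 := by
        gcongr
        exact norm_snd_le _
      nlinarith
  rwa [hc0] at key

/-- Points of the model near the apex of the cone are close to `K`. -/
theorem eventually_exists_mem_of_apex (hν : IsModelAtInfinity a ΩD Ω X K K' ν) (ha : 0 < a)
    (hΩ : IsKahler Ω) (hcomplete : IsCompleteMetric Ω)
    (hK' : ∀ x : D, ((0 : ℂ), x) ∈ K') {q : ℂ × D} (hz : q.1 = 0) {ε : ℝ} (hε : 0 < ε) :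
    ∀ᶠ q' in 𝓝 q, q' ∉ K' → ∃ m ∈ K, kahlerEDist Ω (ν.symm q') m ≤ ENNReal.ofReal ε := by
  have hnear : ∀ᶠ q' in 𝓝 q, ‖q'.1‖ ^ a < ε := by
    have h1 : ContinuousAt (fun q' : ℂ × D => ‖q'.1‖ ^ a) q :=
      (continuousAt_fst.norm).rpow_const (Or.inr ha.le)
    refine h1.eventually (gt_mem_nhds ?_)
    simp only
    rwa [hz, norm_zero, Real.zero_rpow ha.ne']
  filter_upwards [hnear] with q' hq' hqK
  set e := chartAt F q'.2
  have hx : q'.2 ∈ e.source := mem_chart_source F q'.2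
  have hq0 : q'.1 ≠ 0 := fun h => hqK (by
    have := hK' q'.2
    rwa [← h] at this)
  -- The ray to the apex, parametrised so that `r` decreases linearly. Its speed is then the
  -- constant `‖q'.1‖ ^ a`, although the curve need not be differentiable at `t = 1`.
  let c : ℝ → ℂ × F := fun t => ((1 - t) ^ (1 / a) • q'.1, e q'.2)
  have hcont : Continuous c :=
    (((continuous_const.sub continuous_id).rpow_const fun t => Or.inr (by positivity)).smul
      continuous_const).prodMk continuous_const
  have hcd : ∀ r ∈ Set.Ico (0 : ℝ) 1,
      HasDerivAt c ((-(1 / a) / (1 - r)) • ((1 - r) ^ (1 / a) • q'.1), 0) r := fun r hr => by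
    have hr1 : 0 < 1 - r := sub_pos.2 hr.2
    have h := (((hasDerivAt_id r).const_sub 1).rpow_const (p := 1 / a)
      (Or.inl hr1.ne')).smul_const q'.1
    refine HasDerivAt.prodMk ?_ (hasDerivAt_const r _)
    have h' : (-(1 / a) / (1 - r)) • ((1 - r) ^ (1 / a) • q'.1)
        = (-1 * (1 / a) * (1 - id r) ^ (1 / a - 1)) • q'.1 := ?_
    · rw [h']
      exact h
    rw [smul_smul, id, Real.rpow_sub_one hr1.ne']
    congr 1
    ring
  have hcs : ∀ r ∈ Set.Ico (0 : ℝ) 1, ContDiffAt ℝ 1 c r := fun r hr => by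
    have h : ContDiffAt ℝ 1 (fun t : ℝ => (1 - t) ^ (1 / a)) r :=
      (contDiffAt_const.sub contDiffAt_id).rpow_const_of_ne (sub_pos.2 hr.2).ne'
    exact (h.smul contDiffAt_const).prodMk contDiffAt_const
  have hc0 : prodChart q'.2 (c 0) = q' := by
    simp only [c, sub_zero, Real.one_rpow, one_smul, prodChart]
    exact Prod.ext rfl (e.left_inv hx)
  have hc1 : prodChart q'.2 (c 1) ∈ K' := by
    have h : (1 / a : ℝ) ≠ 0 := by positivity
    simp only [c, sub_self, Real.zero_rpow h, zero_smul, prodChart]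
    exact hK' _
  have key := hν.exists_mem_kahlerEDist_le (c := c) (x := q'.2) hΩ hcomplete
    (Real.rpow_nonneg (norm_nonneg q'.1) a) hq' hcont.continuousOn
    (fun r _ => e.map_source hx) (by rwa [hc0]) hc1 hcs fun r hr _ => by
      have hr1 : 0 < 1 - r := sub_pos.2 hr.2
      have hne : (c r).1 ≠ 0 := smul_ne_zero (Real.rpow_pos_of_pos hr1 _).ne' hq0
      rw [(hcd r hr).deriv]
      have h1 := coneForm_self_I ha.ne' (Or.inl hne) (-(1 / a) / (1 - r))
      have h2 : conePot a (c r).1 = (1 - r) ^ 2 * (‖q'.1‖ ^ a) ^ 2 := by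
        have h3 : ‖(c r).1‖ = (1 - r) ^ (1 / a) * ‖q'.1‖ := by
          rw [norm_smul, Real.norm_of_nonneg (Real.rpow_nonneg hr1.le _)]
        rw [conePot, h3, mul_comm 2 a, Real.rpow_mul (by positivity), Real.rpow_two,
          Real.mul_rpow (by positivity) (norm_nonneg _), ← Real.rpow_mul hr1.le,
          one_div_mul_cancel ha.ne', Real.rpow_one, mul_pow]
      rw [h2] at h1
      refine le_of_eq ?_
      simp only [map_zero, add_zero]
      refine h1.trans ?_
      field_simp
  rwa [hc0] at key

variable [FiniteDimensional ℂ F] [FiniteDimensional ℂ E]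

/-- Segments to `q` serve where smoothness of the cone potential is available. At `z = 0` with `a ≠
1` rays are used instead, and they end in `K'` because it contains `{0} × D`. -/
theorem eventually_exists_mem (hν : IsModelAtInfinity a ΩD Ω X K K' ν) (ha : 0 < a)
    (hΩ : IsKahler Ω) (hΩD : IsKahler ΩD) (hcomplete : IsCompleteMetric Ω)
    (hdim : Module.finrank ℂ F + 1 = Module.finrank ℂ E) {q : ℂ × D} (hq : q ∈ K')
    {ε : ℝ} (hε : 0 < ε) :
    ∀ᶠ q' in 𝓝 q, q' ∉ K' → ∃ m ∈ K, kahlerEDist Ω (ν.symm q') m ≤ ENNReal.ofReal ε := by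
  by_cases hz : q.1 ≠ 0 ∨ a = 1
  · exact hν.eventually_exists_mem_of_smooth hΩ hΩD hcomplete hq hz hε
  · push Not at hz
    exact hν.eventually_exists_mem_of_apex ha hΩ hcomplete (hν.zero_mem hΩ hdim hz.2) hz.1 hε

/-- By completeness, the points of `M` that leave every compact set go to infinity in the model. -/
theorem eventually_cocompact [CompactSpace D] [T2Space M] [SecondCountableTopology M]
    (hν : IsModelAtInfinity a ΩD Ω X K K' ν) (ha : 0 < a)
    (hΩ : IsKahler Ω) (hΩD : IsKahler ΩD) (hcomplete : IsCompleteMetric Ω)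
    (hdim : Module.finrank ℂ F + 1 = Module.finrank ℂ E) (R : ℝ) :
    ∀ᶠ p in Filter.cocompact M, p ∉ K ∧ R < ‖(ν p).1‖ := by
  have : LocallyCompactSpace M := Manifold.locallyCompact_of_finiteDimensional 𝓘(ℂ, E)
  have : SecondCountableTopology F := by
    have : ProperSpace F := FiniteDimensional.proper ℂ F
    infer_instance
  have : SecondCountableTopology D := ChartedSpace.secondCountable_of_sigmaCompact F D
  by_contra hcon
  let κ := CompactExhaustion.choice M
  have hex : ∀ j, ∃ p, p ∉ κ j ∧ p ∉ K ∧ ‖(ν p).1‖ ≤ R := fun j => by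
    by_contra! h
    refine hcon ?_
    filter_upwards [((κ.isCompact j).union hν.compact).compl_mem_cocompact] with p hp
    rw [Set.mem_compl_iff, Set.mem_union, not_or] at hp
    exact ⟨hp.2, h p hp.1 hp.2⟩
  choose p hpκ hpK hpR using hex
  -- The points leave every set of the exhaustion, so no subsequence converges. Both cases below
  -- contradict this.
  have hesc : ∀ (φ : ℕ → ℕ), StrictMono φ → ∀ y, ¬ Filter.Tendsto (p ∘ φ) Filter.atTop (𝓝 y) := by
    intro φ hφ y hy
    obtain ⟨N, hN⟩ := κ.exists_mem_nhds y
    obtain ⟨j, hj, hjN⟩ := ((hy.eventually hN).and (Filter.eventually_ge_atTop N)).exists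
    exact hpκ (φ j) (κ.subset (hjN.trans (hφ.id_le j)) hj)
  have hcpt : IsCompact (Metric.closedBall (0 : ℂ) R ×ˢ (Set.univ : Set D)) :=
    (isCompact_closedBall 0 R).prod isCompact_univ
  obtain ⟨q, -, φ, hφ, hq⟩ := hcpt.tendsto_subseq (x := fun j => ν (p j)) fun j =>
    ⟨by simpa using hpR j, trivial⟩
  by_cases hqK : q ∈ K'
  · have h1 : ∀ i : ℕ, ∀ᶠ j in Filter.atTop,
        ∃ m ∈ K, kahlerEDist Ω (p (φ j)) m ≤ ENNReal.ofReal (1 / ((i : ℝ) + 1)) := fun i => by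
      filter_upwards [hq.eventually (hν.eventually_exists_mem ha hΩ hΩD hcomplete hdim hqK
        (ε := 1 / ((i : ℝ) + 1)) (by positivity))] with j hj
      have h2 := hj (hν.map_notMem (hpK (φ j)))
      simp only [Function.comp_apply] at h2
      rwa [hν.left_inv (hpK (φ j))] at h2
    -- A diagonal subsequence whose `i`-th point lies within `1 / (i + 1)` of `K`.
    obtain ⟨ψ, hψ, h2⟩ := Filter.extraction_forall_of_eventually h1
    choose m hmK hmd using h2
    obtain ⟨x, -, χ, hχ, hx⟩ := hν.compact.tendsto_subseq hmK
    obtain ⟨y, hy⟩ := hcomplete (p ∘ (φ ∘ ψ ∘ χ)) (cauchy_of_kahlerEDist_le hΩ hx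
      ((tendsto_one_div_add_atTop_nhds_zero_nat (𝕜 := ℝ)).comp hχ.tendsto_atTop)
      fun i => hmd (χ i))
    exact hesc _ (hφ.comp (hψ.comp hχ)) y hy
  · have h1 : Filter.Tendsto (fun j => ν.symm (ν (p (φ j)))) Filter.atTop (𝓝 (ν.symm q)) :=
      (ν.continuousAt_symm (by rw [hν.target_eq]; exact hqK)).tendsto.comp hq
    have h2 : (fun j => ν.symm (ν (p (φ j)))) = p ∘ φ :=
      funext fun j => hν.left_inv (hpK (φ j))
    rw [h2] at h1
    exact hesc φ hφ _ h1

end IsModelAtInfinity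

end Escape

/-! ### Connectedness, and the soliton equation on the end -/

section Constancy

variable {E : Type*} [NormedAddCommGroup E] [NormedSpace ℝ E]
  {M : Type*} [TopologicalSpace M] [ChartedSpace E M] [IsManifold 𝓘(ℝ, E) ∞ M]

/-- Two functions with the same differential on a connected open set differ by a constant. -/
theorem sub_eq_sub_of_rdiff_eq {f g : M → ℝ} {U : Set M} (hU : IsOpen U) (hc : IsPreconnected U)
    (hf : ∀ q ∈ U, MDifferentiableAt 𝓘(ℝ, E) 𝓘(ℝ, ℝ) f q)
    (hg : ∀ q ∈ U, MDifferentiableAt 𝓘(ℝ, E) 𝓘(ℝ, ℝ) g q)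
    (h : ∀ q ∈ U, rdiff E ℝ f q = rdiff E ℝ g q) {p q : M} (hp : p ∈ U) (hq : q ∈ U) :
    f p - g p = f q - g q := by
  refine hc.induction₂ (fun p q => f p - g p = f q - g q) (fun x hx => ?_)
    (fun x y z _ _ _ => Eq.trans) (fun x y _ _ => Eq.symm) hp hq
  have h1 : ∀ᶠ y in 𝓝 x, (f - g) y = (f - g) x := by
    refine eventually_eq_of_rdiff_eq_zero (E := E) (F := ℝ) ?_
    filter_upwards [hU.mem_nhds hx] with y hy
    refine ⟨(hf y hy).sub (hg y hy), ?_⟩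
    have h2 : rdiff E ℝ (f - g) y = rdiff E ℝ f y - rdiff E ℝ g y :=
      mfderiv_sub (hf y hy) (hg y hy)
    rw [h2, h y hy, sub_self]
  filter_upwards [h1.filter_mono nhdsWithin_le_nhds] with y hy using hy.symm

end Constancy

/-- The exterior of the disc is the image of a half-plane, which is convex, under the exponential
map. -/
theorem isPreconnected_lt_norm {R : ℝ} (hR : 0 < R) : IsPreconnected {z : ℂ | R < ‖z‖} := by
  have h : {z : ℂ | R < ‖z‖} = Complex.exp '' {w : ℂ | Real.log R < w.re} := by
    ext z
    constructor
    · intro hz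
      have hz0 : z ≠ 0 := norm_pos_iff.1 (hR.trans hz)
      exact ⟨Complex.log z, by simpa [Complex.log_re] using Real.log_lt_log hR hz, Complex.exp_log hz0⟩
    · rintro ⟨w, hw, rfl⟩
      rw [Set.mem_ofPred_eq, Complex.norm_exp]
      exact (Real.log_lt_iff_lt_exp hR).1 hw
  rw [h]
  exact (convex_halfSpace_re_gt _).isPreconnected.image _ Complex.continuous_exp.continuousOn

/-- Connectedness of `M` is not a hypothesis: it comes from the dense orbit, a continuous image of
`ℂⁿ`. -/
theorem IsToric.preconnectedSpace {n : ℕ} {E : Type*} [NormedAddCommGroup E] [NormedSpace ℂ E]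
    {M : Type*} [TopologicalSpace M] [ChartedSpace E M] [MulAction (Fin n → ℂˣ) M]
    (hM : IsToric n E M) : PreconnectedSpace M := by
  obtain ⟨p, -, hp⟩ := hM.dense_orbit
  have h : MulAction.orbit (Fin n → ℂˣ) p = Set.range (orbitMap (n := n) p) := by
    ext q
    exact mem_orbit_iff_orbitMap
  have hc : Continuous (orbitMap (n := n) p) :=
    continuous_iff_continuousAt.2 fun w => (hM.orbitMap_smooth p w).continuousAt
  rw [h] at hp
  refine ⟨?_⟩
  rw [← hp.closure_eq]
  exact (isPreconnected_range hc).closure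

section End

variable {F : Type*} [NormedAddCommGroup F] [NormedSpace ℂ F]
  {D : Type*} [TopologicalSpace D] [ChartedSpace F D]
  {E : Type*} [NormedAddCommGroup E] [NormedSpace ℂ E]
  {M : Type*} [TopologicalSpace M] [ChartedSpace E M]
  {a : ℝ} {ΩD : BilinField F D} {Ω : BilinField E M} {X : VField E M}
  {K : Set M} {K' : Set (ℂ × D)} {ν : OpenPartialHomeomorph M (ℂ × D)}

namespace IsModelAtInfinity

theorem exists_bound (hν : IsModelAtInfinity a ΩD Ω X K K' ν) :
    ∃ R : ℝ, 0 < R ∧ ∀ q ∈ K', ‖q.1‖ ≤ R := by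
  obtain ⟨C, hC⟩ := hν.compact'.exists_bound_of_continuousOn
    (continuous_fst (X := ℂ) (Y := D)).continuousOn
  -- The maximum with `1` keeps `R` positive, as `isPreconnected_lt_norm` requires.
  exact ⟨max C 1, by positivity, fun q hq => (hC q hq).trans (le_max_left _ _)⟩

/-- The part of the end of `M` outside a large disc is open. -/
theorem isOpen_end (hν : IsModelAtInfinity a ΩD Ω X K K' ν) (R : ℝ) :
    IsOpen {p : M | p ∉ K ∧ R < ‖(ν p).1‖} := by
  have h := ν.isOpen_inter_preimage (s := {q : ℂ × D | R < ‖q.1‖})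
    (isOpen_lt continuous_const (continuous_fst.norm))
  rw [hν.source_eq] at h
  exact h

theorem isPreconnected_end [PreconnectedSpace D] (hν : IsModelAtInfinity a ΩD Ω X K K' ν) {R : ℝ}
    (hR : 0 < R) (hK' : ∀ q ∈ K', ‖q.1‖ ≤ R) :
    IsPreconnected {p : M | p ∉ K ∧ R < ‖(ν p).1‖} := by
  have hnot : ∀ q : ℂ × D, R < ‖q.1‖ → q ∉ K' := fun q hq h => (hK' q h).not_gt hq
  have h : {p : M | p ∉ K ∧ R < ‖(ν p).1‖}
      = ν.symm '' ({z : ℂ | R < ‖z‖} ×ˢ (Set.univ : Set D)) := by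
    ext p
    constructor
    · rintro ⟨hp, hpR⟩
      exact ⟨ν p, ⟨hpR, trivial⟩, hν.left_inv hp⟩
    · rintro ⟨q, ⟨hq, -⟩, rfl⟩
      refine ⟨hν.symm_notMem (hnot q hq), ?_⟩
      rw [hν.right_inv (hnot q hq)]
      exact hq
  rw [h]
  refine ((isPreconnected_lt_norm hR).prod isPreconnected_univ).image _
    (ν.continuousOn_symm.mono ?_)
  rintro q ⟨hq, -⟩
  rw [hν.target_eq]
  exact hnot q hq

theorem exists_fst_eq [Nonempty D] (hν : IsModelAtInfinity a ΩD Ω X K K' ν) {R : ℝ}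
    (hK' : ∀ q ∈ K', ‖q.1‖ ≤ R) {z : ℂ} (hz : R < ‖z‖) : ∃ p ∉ K, (ν p).1 = z := by
  obtain ⟨x⟩ := ‹Nonempty D›
  have h : ((z, x) : ℂ × D) ∉ K' := fun h => (hK' _ h).not_gt hz
  exact ⟨ν.symm (z, x), hν.symm_notMem h, by rw [hν.right_inv h]⟩

/-- The soliton equation for the model potential. -/
theorem equation_of_eventuallyEq [FiniteDimensional ℂ F] [FiniteDimensional ℂ E]
    [IsManifold 𝓘(ℂ, E) ω M]
    (hν : IsModelAtInfinity a ΩD Ω X K K' ν) (hΩ : IsKahler Ω)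
    (hdim : Module.finrank ℂ F + 1 = Module.finrank ℂ E) (ha : a ≠ 0) {p : M} (hp : p ∉ K)
    {f : M → ℝ} (hf : f =ᶠ[𝓝 p] modelPot a ν) :
    laplacian Ω f p + f p - diff f p (X p) / 2 = 0 := by
  have hz := hν.fst_ne_zero_or hΩ hdim hp
  have h1 : diff f p (X p) = conePot a (ν p).1 := by
    rw [← hν.rdiff_modelPot_field hp hz ha, ← rdiff_congr hf]
    rfl
  rw [hν.laplacian_eq_one hΩ hdim hp hz hf, h1, hf.eq_of_nhds, modelPot]
  ring

end IsModelAtInfinity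

end End

end KahlerToric

end


/-! ### Proof of the lemma -/

open KahlerToric Filter in
theorem lemma4p2 {n : ℕ}
    -- the compact connected Kähler manifold `(D, Ω_D)` of dimension `n - 1`
    {F : Type*} [NormedAddCommGroup F] [NormedSpace ℂ F] [FiniteDimensional ℂ F]
    {D : Type*} [TopologicalSpace D] [ChartedSpace F D] [IsManifold 𝓘(ℂ, F) ω D]
    [T2Space D] [CompactSpace D] [ConnectedSpace D] (hF : Module.finrank ℂ F + 1 = n)
    (ΩD : BilinField F D) (hΩD : IsKahler ΩD)
    -- the toric manifold `M` of dimension `n`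
    {E : Type*} [NormedAddCommGroup E] [NormedSpace ℂ E] [FiniteDimensional ℂ E]
    {M : Type*} [TopologicalSpace M] [ChartedSpace E M] [IsManifold 𝓘(ℂ, E) ω M]
    [T2Space M] [SecondCountableTopology M] [MulAction (Fin n → ℂˣ) M] (hM : IsToric n E M)
    -- the complete torus-invariant Kähler metric, the vector field and the model at infinity
    (Ω : BilinField E M) (hΩ : IsKahler Ω) (hcomplete : IsCompleteMetric Ω)
    (hinv : TorusInvariantForm n Ω)
    (X : VField E M) (hX : InTorusLieAlgebra n (fun p => J E (X p)))
    (a : ℝ) (ha : 0 < a) (K : Set M) (K' : Set (ℂ × D)) (ν : OpenPartialHomeomorph M (ℂ × D))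
    (hν : IsModelAtInfinity a ΩD Ω X K K' ν) :
    ∃ f : M → ℝ,
      IsNormalisedPotential n a Ω X ν f ∧
      (∀ f' : M → ℝ, IsNormalisedPotential n a Ω X ν f' → f' = f) ∧
      (∀ᶠ p in cocompact M, laplacian Ω f p + f p - diff f p (X p) / 2 = 0) ∧
      (IsConnected Kᶜ → ∀ p ∉ K, f p = radius a (ν p) ^ 2 / 2 - 1 ∧
        laplacian Ω f p + f p - diff f p (X p) / 2 = 0) ∧
      Tendsto f (comap (fun p => radius a (ν p)) atTop ⊓ 𝓟 Kᶜ) atTop ∧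
      Tendsto f (cocompact M) atTop ∧
      IsProperMap f := by
  have hdim : Module.finrank ℂ F + 1 = Module.finrank ℂ E := hF.trans hM.finrank_eq.symm
  have hz : ∀ p ∉ K, (ν p).1 ≠ 0 ∨ a = 1 := fun p hp => hν.fst_ne_zero_or hΩ hdim hp
  have : LocallyCompactSpace M := Manifold.locallyCompact_of_finiteDimensional 𝓘(ℂ, E)
  have : PreconnectedSpace M := hM.preconnectedSpace
  obtain ⟨b, hb⟩ := hX
  obtain ⟨R, hR, hK'⟩ := hν.exists_bound
  have hcon : ∀ r : ℝ, ∃ p ∉ K, R < ‖(ν p).1‖ ∧ r < radius a (ν p) := fun r => by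
    have h1 : Tendsto (fun t : ℝ => t ^ a) atTop atTop := tendsto_rpow_atTop ha
    obtain ⟨t, ht0, htR, htr⟩ := ((eventually_gt_atTop 0).and
      ((eventually_gt_atTop R).and (h1.eventually_gt_atTop r))).exists
    have htn : ‖(t : ℂ)‖ = t := by rw [Complex.norm_real, Real.norm_of_nonneg ht0.le]
    obtain ⟨p, hp, hpz⟩ := hν.exists_fst_eq hK' (z := (t : ℂ)) (by rwa [htn])
    exact ⟨p, hp, by rwa [hpz, htn], by rwa [radius, hpz, htn]⟩
  -- the potential, normalised on the end
  obtain ⟨f₀, hf₀s, hf₀i, hf₀d⟩ : ∃ f : M → ℝ, ContMDiff 𝓘(ℝ, E) 𝓘(ℝ, ℝ) ∞ f ∧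
      TorusInvariant n f ∧ ∀ q, rdiff E ℝ f q = - Ω q (J E (X q)) := by
    obtain ⟨p₀, -, hdense⟩ := hM.dense_orbit
    obtain ⟨p₁, hp₁, -⟩ := hcon 0
    -- The base point of the orbit is moved into the end, where `J X` is known to be orthogonal to
    -- the torus orbits.
    obtain ⟨p, hpK, hp⟩ := hdense.inter_open_nonempty Kᶜ hν.isOpen_compl ⟨p₁, hp₁⟩
    rw [← MulAction.orbit_eq_iff.2 hp] at hdense
    have hb' : ∀ q, J E (X q) = torusField b q := congrFun hb
    simp only [hb']
    exact hM.exists_potential hΩ hinv hdense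
      (hν.torusField_orthogonal hM hΩ hinv ha.ne' hz hb hpK)
  obtain ⟨p₁, hp₁, hp₁R, -⟩ := hcon 0
  -- The constant makes `f` equal to the model potential at `p₁`, hence on the connected set `|z| >
  -- R`.
  set f : M → ℝ := fun p => f₀ p - (f₀ p₁ - modelPot a ν p₁) with hf
  have hfs : ContMDiff 𝓘(ℝ, E) 𝓘(ℝ, ℝ) ∞ f := hf₀s.sub contMDiff_const
  have hfd : ∀ q, MDifferentiableAt 𝓘(ℝ, E) 𝓘(ℝ, ℝ) f q := fun q =>
    (hfs q).mdifferentiableAt (by simp)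
  have hfΩ : ∀ q, rdiff E ℝ f q = - Ω q (J E (X q)) := fun q => by
    have h : rdiff E ℝ f q = rdiff E ℝ f₀ q - rdiff E ℝ (fun _ => f₀ p₁ - modelPot a ν p₁) q :=
      mfderiv_sub ((hf₀s q).mdifferentiableAt (by simp)) mdifferentiableAt_const
    rw [h, rdiff_const, sub_zero, hf₀d]
  have hmodel : ∀ q ∉ K, rdiff E ℝ f q = rdiff E ℝ (modelPot a ν) q := fun q hq => by
    ext v
    rw [hfΩ, ← hν.contract_eq_rdiff hq (hz q hq) ha.ne']
    rfl
  have hfp₁ : f p₁ - modelPot a ν p₁ = 0 := by simp [hf]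
  have hfend : ∀ p, p ∉ K → R < ‖(ν p).1‖ → f p = modelPot a ν p := fun p hp hpR => by
    rw [← sub_eq_zero, ← hfp₁]
    exact sub_eq_sub_of_rdiff_eq (hν.isOpen_end R) (hν.isPreconnected_end hR hK')
      (fun q _ => hfd q) (fun q hq => hν.modelPot_mdiff hq.1 (hz q hq.1))
      (fun q hq => hmodel q hq.1) ⟨hp, hpR⟩ ⟨hp₁, hp₁R⟩
  have hfnear : ∀ p, p ∉ K → R < ‖(ν p).1‖ → f =ᶠ[𝓝 p] modelPot a ν := fun p hp hpR => by
    filter_upwards [(hν.isOpen_end R).mem_nhds ⟨hp, hpR⟩] with q hq using hfend q hq.1 hq.2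
  have hesc := hν.eventually_cocompact ha hΩ hΩD hcomplete hdim
  have hlarge : Tendsto (fun r : ℝ => r ^ 2 / 2 - 1) atTop atTop :=
    tendsto_atTop_add_const_right _ _ ((tendsto_pow_atTop two_ne_zero).atTop_div_const two_pos)
  have htend : Tendsto f (comap (fun p => radius a (ν p)) atTop ⊓ 𝓟 Kᶜ) atTop := by
    have h1 : Tendsto (fun p => radius a (ν p))
        (comap (fun p => radius a (ν p)) atTop ⊓ 𝓟 Kᶜ) atTop :=
      tendsto_comap.mono_left inf_le_left
    refine (hlarge.comp h1).congr' ?_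
    filter_upwards [h1.eventually_gt_atTop (R ^ a),
      (eventually_principal.2 fun _ h => h : ∀ᶠ p in 𝓟 Kᶜ, p ∈ Kᶜ).filter_mono inf_le_right]
      with p hpr hpK
    rw [hfend p hpK (lt_of_not_ge fun h => hpr.not_ge
      (Real.rpow_le_rpow (norm_nonneg _) h ha.le)), modelPot_eq]
    rfl
  have hcoc : Tendsto f (cocompact M) atTop := by
    -- Leaving every compact subset of `M` forces `r` to infinity within the end, so growth in `r`
    -- implies growth at infinity.
    refine htend.mono_left (le_inf (tendsto_iff_comap.1 (tendsto_atTop.2 fun r => ?_)) ?_)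
    · obtain ⟨t, ht0, ht⟩ := ((eventually_ge_atTop 0).and
        ((tendsto_rpow_atTop ha).eventually_ge_atTop r)).exists
      filter_upwards [hesc t] with p hp
      exact ht.trans (Real.rpow_le_rpow ht0 hp.2.le ha.le)
    · exact le_principal_iff.2 ((hesc 0).mono fun p hp => hp.1)
  -- `M` is not compact, since the continuous function `f` is unbounded on the end. Otherwise the
  -- condition at infinity would be vacuous and uniqueness would fail.
  have hne : (cocompact M).NeBot := by
    rw [cocompact_neBot_iff, ← not_compactSpace_iff]
    intro hcpt
    obtain ⟨B, hB⟩ := isCompact_univ.bddAbove_image hfs.continuous.continuousOn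
    obtain ⟨r, hrB⟩ := (hlarge.eventually_gt_atTop B).exists_forall_of_atTop
    obtain ⟨p, hp, hpR, hpr⟩ := hcon r
    have h1 := hB ⟨p, trivial, rfl⟩
    rw [hfend p hp hpR, modelPot_eq] at h1
    exact (hrB _ hpr.le).not_ge h1
  have hinf : ∀ᶠ p in cocompact M, f p = radius a (ν p) ^ 2 / 2 - 1 :=
    (hesc R).mono fun p hp => (hfend p hp.1 hp.2).trans (modelPot_eq a ν p)
  refine ⟨f, ⟨hfs, fun t p => by simp only [hf, hf₀i t p], fun p v => ?_, hinf⟩, ?_, ?_, ?_, htend,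
    hcoc, isProperMap_iff_tendsto_cocompact.2 ⟨hfs.continuous, hcoc.mono_right atTop_le_cocompact⟩⟩
  · exact (DFunLike.congr_fun (hfΩ p) v).symm
  · intro f' hf'
    -- The two potentials agree at some point near infinity; having the same differential on the
    -- connected `M`, they agree everywhere.
    obtain ⟨q, hq, hq'⟩ := (hinf.and hf'.at_infinity).exists
    have h0 : f' q - f q = 0 := by rw [hq, hq', sub_self]
    funext p
    rw [← sub_eq_zero, ← h0]
    refine sub_eq_sub_of_rdiff_eq isOpen_univ isPreconnected_univ
      (fun y _ => (hf'.smooth y).mdifferentiableAt (by simp)) (fun y _ => hfd y)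
      (fun y _ => ?_) trivial trivial
    ext v
    rw [hfΩ]
    exact (hf'.hamiltonian y v).symm
  · exact (hesc R).mono fun p hp =>
      hν.equation_of_eventuallyEq hΩ hdim ha.ne' hp.1 (hfnear p hp.1 hp.2)
  · intro hconn
    have hall : ∀ p ∉ K, f p = modelPot a ν p := fun p hp => by
      rw [← sub_eq_zero, ← hfp₁]
      exact sub_eq_sub_of_rdiff_eq hν.isOpen_compl hconn.isPreconnected
        (fun q _ => hfd q) (fun q hq => hν.modelPot_mdiff hq (hz q hq)) hmodel hp hp₁
    intro p hp
    refine ⟨(hall p hp).trans (modelPot_eq a ν p),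
      hν.equation_of_eventuallyEq hΩ hdim ha.ne' hp ?_⟩
    filter_upwards [hν.isOpen_compl.mem_nhds hp] with q hq using hall q hq
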